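/- Let $q$ be an odd prime power. Write the points of $\mathrm{PG}(3,q^2)$ as $P=\langle(\alpha,\beta,\gamma,\delta)\rangle$ and put $$Q=\alpha\delta-\beta\gamma,\qquad H=\alpha^{q+1}-\beta^{q+1}-\gamma^{q+1}+\delta^{q+1}.$$ Let $\mathcal Q$ be the quadric $Q=0$ and $\mathcal H$ the Hermitian surface $H=0$. Let $\Sigma\cong\mathrm{PG}(3,q)$ be the Baer subgeometry of the points $\langle(\alpha,\beta,\beta^q,\alpha^q)\rangle$, and let $\mathcal Q_0=\mathcal Q\cap\Sigma$. A line of $\mathrm{PG}(3,q^2)$ meeting $\Sigma$ in a line of $\Sigma$ is called an extended generator of $\mathcal Q_0$ if all of its points in $\Sigma$ lie on $\mathcal Q_0$, and an extended tangent line of $\mathcal Q_0$ if exactly one of its points lies on $\mathcal Q_0$. A point $P$ is nonsingular if $$(\alpha z+\delta^qz^q)x+(\gamma z+\beta^qz^q)x^q\neq0\quad\text{for all nonzero }x,z\in\mathbb F_{q^2}$$ (that is, if the threefold tensor it represents is nonsingular), and singular otherwise. Define the following sets of points. - $\tilde\Sigma=\Sigma\setminus\mathcal Q_0$ and $\tilde{\mathcal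 Q}=\mathcal Q\setminus\mathcal H$. - $\mathcal T$ is the set of points on extended generators of $\mathcal Q_0$ but not on $\mathcal Q_0$. - $\tilde{\mathcal D}$ is the set of points on extended tangent lines of $\mathcal Q_0$ but not in $\Sigma$. - $\mathcal H_1$ is the set of nonsingular points of $\mathcal H$, and $\mathcal H_2$ is the set of singular points of $\mathcal H\setminus\mathcal Q$. - For $\xi\in\mathbb F_{q^2}$, $S_\xi$ is the surface $H-2\xi Q^{(q+1)/2}=0$, and $\tilde S_\xi=S_\xi\setminus\mathcal H$. Let $\mathcal Z_1$ be the set of $\xi\in\mathbb F_{q^2}\setminus\{0,1,-1\}$ such that $1-1/\xi^2$ is a nonzero square of $\mathbb F_q$, and $\mathcal Z_2$ the set of $\xi\in\mathbb F_{q^2}\setminus\{0\}$ such that $1-1/\xi^2$ is a nonsquare of $\mathbb F_q$. **Theorem.** Let $G\leq\mathrm{PGL}(4,q^2)$ be the stabiliser of the set $\mathcal Q_0$. The orbits of $G$ on the points of $\mathrm{PG}(3,q^2)$ are exactly the following $7+\frac{q-3}2+\frac{q-1}2$ pairwise distinct sets: - $\mathcal Q_0$, of size $(q+1)^2$; - $\tilde\Sigma$,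 of size $q^3-q$; - $\mathcal T$, of size $2(q+1)(q^2-q)$; - $\tilde{\mathcal Q}$, of size $q^4-2q^3+q^2$; - $\tilde{\mathcal D}$, of size $q(q^2-1)^2$; - $\mathcal H_1$, of size $(q+1)(q-1)^2q^2/2$; - $\mathcal H_2$, of size $(q-1)q^2(q+1)^2/2$; - the sets $\tilde S_\xi\cup\tilde S_{-\xi}$ with $\xi\in\mathcal Z_1$; there are $(q-3)/2$ of them, each of size $(q+1)(q-1)^2q^2$; - the sets $\tilde S_\xi\cup\tilde S_{-\xi}$ with $\xi\in\mathcal Z_2$; there are $(q-1)/2$ of them, each of size $(q-1)q^2(q+1)^2$. -/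

import Mathlib

namespace PointOrbits

open scoped LinearAlgebra.Projectivization Pointwise MatrixGroups

/-- The points of the three-dimensional projective space over `K`. A point is spanned by a
vector `(α, β, γ, δ)`, whose coordinates are indexed by `0, 1, 2, 3`. -/
abbrev PG3 (K : Type*) [Field K] : Type _ := ℙ K (Fin 4 → K)

section

variable (q : ℕ) {K : Type*} [Field K]

/-! Throughout, `K` is the field of order `q ^ 2`, and its subfield of order `q` consists of the
`x` with `x ^ q = x`. -/

/-- Nonzero squares of the subfield of order `q`. -/
def IsNonzeroSquareFq (x : K) : Prop := ∃ t : K, t ^ q = t ∧ t ≠ 0 ∧ x = t ^ 2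

/-- Nonsquares of the subfield of order `q`. -/
def IsNonsquareFq (x : K) : Prop := x ^ q = x ∧ ¬ ∃ t : K, t ^ q = t ∧ x = t ^ 2

/-- The quadratic form `αδ - βγ`. -/
def formQ (v : Fin 4 → K) : K := v 0 * v 3 - v 1 * v 2

/-- The Hermitian form `α^(q+1) - β^(q+1) - γ^(q+1) + δ^(q+1)`. -/
def formH (v : Fin 4 → K) : K :=
  v 0 ^ (q + 1) - v 1 ^ (q + 1) - v 2 ^ (q + 1) + v 3 ^ (q + 1)

/-! The equations below are homogeneous, so that they may be tested on any representative. -/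

/-- The quadric `Q = 0`. -/
def quadric (K : Type*) [Field K] : Set (PG3 K) := {P | formQ P.rep = 0}

/-- The Hermitian surface `H = 0`. -/
def hermitian (K : Type*) [Field K] : Set (PG3 K) := {P | formH q P.rep = 0}

/-- The Baer subgeometry `Σ` of the points spanned by Dickson matrices
`(α, β; β^q, α^q)`. -/
def subgeometry (K : Type*) [Field K] : Set (PG3 K) :=
  {P | ∃ (v : Fin 4 → K) (hv : v ≠ 0),
    P = Projectivization.mk K v hv ∧ v 2 = v 1 ^ q ∧ v 3 = v 0 ^ q}

/-- The subquadric `Q₀`. -/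
def subquadric (K : Type*) [Field K] : Set (PG3 K) := quadric K ∩ subgeometry q K

/-- The points on the subspace of the projective space given by the vector subspace `L`. -/
def pointsOn (L : Submodule K (Fin 4 → K)) : Set (PG3 K) := {P | P.submodule ≤ L}

/-- `L` is a line that meets `Σ` in a line of `Σ`, that is, in at least two points. -/
def IsSigmaLine (L : Submodule K (Fin 4 → K)) : Prop :=
  Module.finrank K L = 2 ∧ (pointsOn L ∩ subgeometry q K).Nontrivial

/-- `L` is the extension of a line of `Σ` that is contained in `Q₀`. -/
def IsExtendedGenerator (L : Submodule K (Fin 4 → K)) : Prop :=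
  IsSigmaLine q L ∧ pointsOn L ∩ subgeometry q K ⊆ subquadric q K

/-- `L` is the extension of a line of `Σ` that meets `Q₀` in exactly one point. -/
def IsExtendedTangent (L : Submodule K (Fin 4 → K)) : Prop :=
  IsSigmaLine q L ∧ ∃ R : PG3 K, pointsOn L ∩ subquadric q K = {R}

/-- The points of `Σ` off `Q₀`. -/
def sigmaTilde (K : Type*) [Field K] : Set (PG3 K) := subgeometry q K \ subquadric q K

/-- The set `𝒯` of the points on extended generators of `Q₀` that are not on `Q₀`. -/
def setT (K : Type*) [Field K] : Set (PG3 K) :=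
  {P | ∃ L, IsExtendedGenerator q L ∧ P ∈ pointsOn L} \ subquadric q K

/-- The points of the quadric off the Hermitian surface. -/
def quadricTilde (K : Type*) [Field K] : Set (PG3 K) := quadric K \ hermitian q K

/-- The points on extended tangent lines of `Q₀` that are not in `Σ`. -/
def setDTilde (K : Type*) [Field K] : Set (PG3 K) :=
  {P | ∃ L, IsExtendedTangent q L ∧ P ∈ pointsOn L} \ subgeometry q K

/-- The value at `x` of the contraction by `z` of the threefold tensor with matrix
`(α, β; γ, δ)` in the cyclic model. -/
def contraction (v : Fin 4 → K) (z x : K) : K :=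
  (v 0 * z + v 3 ^ q * z ^ q) * x + (v 2 * z + v 1 ^ q * z ^ q) * x ^ q

/-- The tensor spanning `P` is nonsingular: all its contractions by `z ≠ 0` are nonsingular. -/
def IsNonsingularPoint (P : PG3 K) : Prop :=
  ∀ z x : K, z ≠ 0 → x ≠ 0 → contraction q P.rep z x ≠ 0

/-- The nonsingular points of the Hermitian surface. -/
def setH1 (K : Type*) [Field K] : Set (PG3 K) :=
  {P | P ∈ hermitian q K ∧ IsNonsingularPoint q P}

/-- The singular points of the Hermitian surface off the quadric. -/
def setH2 (K : Type*) [Field K] : Set (PG3 K) :=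
  {P | P ∈ hermitian q K ∧ P ∉ quadric K ∧ ¬ IsNonsingularPoint q P}

/-- The surface `S_ξ` with equation `H - 2 ξ Q^((q+1)/2) = 0`. -/
def surface (ξ : K) : Set (PG3 K) :=
  {P | formH q P.rep - 2 * ξ * formQ P.rep ^ ((q + 1) / 2) = 0}

/-- The part of `S_ξ` off the Hermitian surface. -/
def surfaceTilde (ξ : K) : Set (PG3 K) := surface q ξ \ hermitian q K

/-- The set `𝒵₁` of parameters. -/
def paramZ1 (K : Type*) [Field K] : Set K :=
  {ξ | ξ ≠ 0 ∧ ξ ≠ 1 ∧ ξ ≠ -1 ∧ IsNonzeroSquareFq q (1 - 1 / ξ ^ 2)}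

/-- The set `𝒵₂` of parameters. -/
def paramZ2 (K : Type*) [Field K] : Set K :=
  {ξ | ξ ≠ 0 ∧ IsNonsquareFq q (1 - 1 / ξ ^ 2)}

/-- The group `G ≤ PGL(4, K)` stabilising the subquadric `Q₀`. -/
def groupG (K : Type*) [Field K] : Subgroup PGL(4, K) :=
  MulAction.stabilizer PGL(4, K) (subquadric q K)

/-- The orbits of `G` on the points. -/
def pointOrbits (K : Type*) [Field K] : Set (Set (PG3 K)) :=
  {O | ∃ P : PG3 K, O = MulAction.orbit (groupG q K) P}

/-- The sets `S̃_ξ ∪ S̃_{-ξ}` for `ξ` in a set `Z`. -/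
def surfacePairs (Z : Set K) : Set (Set (PG3 K)) :=
  {O | ∃ ξ ∈ Z, O = surfaceTilde q ξ ∪ surfaceTilde q (-ξ)}

end

end PointOrbits

/-!
Write `σ` for `x ↦ x ^ q` and read the vector `(α, β, γ, δ)` as a two-by-two matrix, so that
`formQ` is the determinant. The semilinear involution `tau : (α, β, γ, δ) ↦ (σ δ, σ γ, σ β, σ α)`
is multiplicative, its fixed vectors are the Dickson matrices spanning the points of `Σ`, and
`formH v` is the polar form of `formQ` at `v` and `tau v`.

The group. A quadratic form that vanishes on the pure tensors `(x, σ x) ⊗ (y, σ y)` spanning the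
points of `𝒬₀` is a multiple of `formQ`, because `x ^ 2`, `x σ x` and `σ x ^ 2` are linearly
independent functions (`IsConj.coeff_eq_zero`). Hence an element of `G` multiplies `formQ` by a
constant, and after scaling it commutes with `tau` (`IsConj.exists_isSim_of_mem`). Conversely such
similitudes preserve `𝒬₀`; examples are the multiplications by Dickson matrices and transposition.

The orbits. A similitude scales `formQ` and `formH` by one factor of the subfield, and changing
the representative of a point by `c` scales them by `c ^ 2` and `c σ c`. Up to these scalars, and
up to membership in `Σ`, the two values determine the orbit (`IsConj.mem_orbit_iff`). The main
case is that of a point off `Σ` with values not both zero. Then some multiple `v` of the given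
vector has `x = v + tau v` invertible, `x` is a Dickson matrix, and `u = x⁻¹ v` satisfies
`u + tau u = 1`. Two such `u` with the same determinant have the same trace as well, and are
conjugate by a Dickson matrix (`IsConj.exists_conjugator`).

The sets. By `IsConj.formQ_smul_add_tau`, the form
`z ↦ formQ v z ^ 2 + formH v z σ z + σ (formQ v) σ z ^ 2` is the restriction of `formQ` to the
points of `Σ` on the line joining `v` to `tau v`, which is the only extended line through `v` when
`v` is off `Σ`. It is also the difference of the norms of the two coefficients in the contraction
by `z`. So its zeros decide both the type of that line and the singularity of the tensor, and they
are governed by the discriminant `formH ^ 2 - 4 N(formQ)`. Every set of the list is thus given by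
conditions on the two forms and on membership in `Σ` that single out one class.

The sizes. The map `v ↦ z v + tau (z v)` reduces the count of the vectors with given values of the
forms to the counts of the Dickson matrices of given determinant and of the `u` as above
(`IsConj.ncard_formQ_formH`); the result depends only on the number of square roots of the
discriminant in the subfield.
-/

namespace PointOrbits

open scoped LinearAlgebra.Projectivization Pointwise MatrixGroups

set_option linter.unusedSectionVars false

/-! ### The quadratic extension of finite fields -/

/-- Counting by fibres of constant size. -/
theorem ncard_eq_ncard_mul_of_fibers {α β : Type*} [Finite α] [Finite β] {s : Set α} {t : Set β}
    (f : α → β) (k : ℕ) (hf : ∀ a ∈ s, f a ∈ t) (hk : ∀ b ∈ t, {a | a ∈ s ∧ f a = b}.ncard = k) :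
    s.ncard = t.ncard * k := by
  classical
  have := Fintype.ofFinite α
  have := Fintype.ofFinite β
  rw [Set.ncard_eq_toFinset_card' s, Set.ncard_eq_toFinset_card' t,
    Finset.card_eq_sum_card_fiberwise (f := f) (t := t.toFinset)]
  · rw [Finset.sum_const_nat (m := k)]
    intro b hb
    rw [← hk b (by simpa using hb), Set.ncard_eq_toFinset_card']
    congr 1
    ext a
    simp
  · intro a ha
    simpa using hf a (by simpa using ha)

theorem ncard_eq_of_bij {α β : Type*} {s : Set α} {t : Set β} (f : α → β)
    (hf : Function.Injective f) (hst : ∀ a, f a ∈ t ↔ a ∈ s) (hsurj : ∀ b ∈ t, ∃ a, f a = b) :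
    t.ncard = s.ncard := by
  have : t = f '' s := by
    ext b
    constructor
    · intro hb
      obtain ⟨a, rfl⟩ := hsurj b hb
      exact ⟨a, (hst a).1 hb, rfl⟩
    · rintro ⟨a, ha, rfl⟩
      exact (hst a).2 ha
  rw [this, Set.ncard_image_of_injective _ hf]

theorem ncard_ne_zero {α : Type*} [Finite α] [Zero α] :
    {x : α | x ≠ 0}.ncard = Nat.card α - 1 := by
  have : {x : α | x ≠ 0} = Set.univ \ {0} := by
    ext
    simp
  rw [this, Set.ncard_sdiff_singleton_of_mem (Set.mem_univ _), Set.ncard_univ]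

/-- `σ` is the involution `x ↦ x ^ q` of a field `K` of order `q ^ 2`, with `q` odd. -/
structure IsConj (q : ℕ) {K : Type*} [Field K] (σ : K →+* K) : Prop where
  odd : Odd q
  card : Nat.card K = q ^ 2
  pow : ∀ x, σ x = x ^ q

theorem exists_isConj {q : ℕ} (hq : Odd q) {K : Type*} [Field K] [Finite K]
    (hK : Nat.card K = q ^ 2) : ∃ σ : K →+* K, IsConj q σ := by
  have := Fintype.ofFinite K
  obtain ⟨p, hp⟩ := CharP.exists K
  obtain ⟨n, hpp, hn⟩ := FiniteField.card K p
  rw [← Nat.card_eq_fintype_card, hK] at hn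
  have hd : q ∣ p ^ (n : ℕ) := by
    rw [← hn]
    exact dvd_pow_self q two_ne_zero
  obtain ⟨m, -, rfl⟩ := (Nat.dvd_prime_pow hpp).1 hd
  have := Fact.mk hpp
  exact ⟨iterateFrobenius K p m, hq, hK, fun x => iterateFrobenius_def p m x⟩

section

variable {q : ℕ} {K : Type*} [Field K] [Finite K] {σ : K →+* K}

namespace IsConj

theorem conj_conj (h : IsConj q σ) (x : K) : σ (σ x) = x := by
  have := Fintype.ofFinite K
  rw [h.pow, h.pow, ← pow_mul, ← sq, ← h.card, Nat.card_eq_fintype_card, FiniteField.pow_card]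

theorem conj_ne_zero (_ : IsConj q σ) {x : K} (hx : x ≠ 0) : σ x ≠ 0 := by
  simpa using hx

theorem norm_fixed (h : IsConj q σ) (x : K) : σ (x * σ x) = x * σ x := by
  rw [map_mul, h.conj_conj, mul_comm]

theorem three_le (h : IsConj q σ) : 3 ≤ q := by
  have h1 : 1 < Nat.card K := Finite.one_lt_card
  rw [h.card] at h1
  obtain ⟨m, hm⟩ := h.odd
  rcases Nat.eq_zero_or_pos m with rfl | hm'
  · subst hm
    simp at h1
  · omega

theorem ringChar_ne_two (h : IsConj q σ) : ringChar K ≠ 2 := by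
  have := Fintype.ofFinite K
  intro h2
  have h3 := FiniteField.even_card_of_char_two h2
  rw [← Nat.card_eq_fintype_card, h.card] at h3
  have h4 : Odd (q ^ 2) := h.odd.pow
  rw [Nat.odd_iff] at h4
  omega

theorem two_ne_zero (h : IsConj q σ) : (2 : K) ≠ 0 :=
  Ring.two_ne_zero h.ringChar_ne_two

theorem four_ne_zero (h : IsConj q σ) : (4 : K) ≠ 0 := by
  have : (4 : K) = 2 * 2 := by norm_num
  rw [this]
  exact mul_ne_zero h.two_ne_zero h.two_ne_zero

theorem card_ne_zero_set (h : IsConj q σ) : {x : K | x ≠ 0}.ncard = q ^ 2 - 1 := by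
  rw [ncard_ne_zero, h.card]

theorem fixed_iff (h : IsConj q σ) {x : K} (hx : x ≠ 0) : σ x = x ↔ x ^ (q - 1) = 1 := by
  have h3 := h.three_le
  rw [h.pow]
  obtain ⟨m, rfl⟩ : ∃ m, q = m + 1 := ⟨q - 1, by omega⟩
  rw [pow_succ, Nat.add_sub_cancel]
  exact mul_eq_right₀ hx

theorem ncard_pow_eq_le {n : ℕ} (hn : 0 < n) (a : K) : {x : K | x ^ n = a}.ncard ≤ n := by
  classical
  have : {x : K | x ^ n = a} = ((Polynomial.nthRoots n a).toFinset : Set K) := by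
    ext x
    simp [Polynomial.mem_nthRoots hn]
  rw [this, Set.ncard_coe_finset]
  exact (Multiset.toFinset_card_le _).trans (Polynomial.card_nthRoots n a)

theorem ncard_norm_eq_le (h : IsConj q σ) (a : K) : {x : K | x * σ x = a}.ncard ≤ q + 1 := by
  have : {x : K | x * σ x = a} = {x : K | x ^ (q + 1) = a} := by
    ext x
    simp [h.pow, pow_succ']
  rw [this]
  exact ncard_pow_eq_le (by omega) a

/-- There are at most `q - 1` nonzero elements of the subfield and at most `q + 1` elements of a
given norm; as there are `q ^ 2 - 1` nonzero elements, both bounds are attained. -/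
theorem ncard_fixed_and_norm (h : IsConj q σ) : {x : K | σ x = x ∧ x ≠ 0}.ncard = q - 1 ∧
    ∀ a, σ a = a → a ≠ 0 → {x : K | x * σ x = a}.ncard = q + 1 := by
  classical
  have := Fintype.ofFinite K
  have h3 := h.three_le
  set F : Set K := {x : K | σ x = x ∧ x ≠ 0} with hF
  have hF1 : F.ncard ≤ q - 1 := by
    refine le_trans (Set.ncard_le_ncard ?_ (Set.toFinite _))
      (ncard_pow_eq_le (K := K) (n := q - 1) (by omega) 1)
    rintro x ⟨hx, hx0⟩
    exact (h.fixed_iff hx0).1 hx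
  have hsum : q ^ 2 - 1 = ∑ a ∈ F.toFinset, {x : K | x * σ x = a}.ncard := by
    rw [← h.card_ne_zero_set, Set.ncard_eq_toFinset_card',
      Finset.card_eq_sum_card_fiberwise (f := fun x => x * σ x) (t := F.toFinset)]
    · refine Finset.sum_congr rfl fun a ha => ?_
      rw [Set.ncard_eq_toFinset_card']
      congr 1
      ext x
      simp only [Finset.mem_filter, Set.mem_toFinset, Set.mem_ofPred_eq, and_iff_right_iff_imp]
      rintro rfl hx
      simp [hF, hx] at ha
    · intro x hx
      have hx : x ≠ 0 := by simpa using hx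
      simp [hF, h.norm_fixed x, hx, -map_mul]
  have hle : ∀ a ∈ F.toFinset, {x : K | x * σ x = a}.ncard ≤ q + 1 :=
    fun a _ => h.ncard_norm_eq_le a
  have hsq : q ^ 2 - 1 = (q - 1) * (q + 1) := by
    obtain ⟨m, rfl⟩ : ∃ m, q = m + 1 := ⟨q - 1, by omega⟩
    simp only [Nat.add_sub_cancel]
    rw [Nat.sub_eq_of_eq_add]
    ring
  have hsum2 : ∑ a ∈ F.toFinset, {x : K | x * σ x = a}.ncard ≤ F.ncard * (q + 1) := by
    rw [Set.ncard_eq_toFinset_card', ← smul_eq_mul]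
    exact Finset.sum_le_card_nsmul _ _ _ hle
  have hF2 : F.ncard = q - 1 := by
    refine le_antisymm hF1 (Nat.le_of_mul_le_mul_right (c := q + 1) ?_ (by omega))
    rw [← hsq, hsum]
    exact hsum2
  refine ⟨hF2, fun a ha ha0 => ?_⟩
  have heq : ∑ a ∈ F.toFinset, {x : K | x * σ x = a}.ncard = ∑ a ∈ F.toFinset, (q + 1) := by
    rw [← hsum, Finset.sum_const, ← Set.ncard_eq_toFinset_card', hF2, hsq, smul_eq_mul]
  exact (Finset.sum_eq_sum_iff_of_le hle).1 heq a (by simp [hF, ha, ha0])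

theorem ncard_norm_eq (h : IsConj q σ) {a : K} (ha : σ a = a) (ha0 : a ≠ 0) :
    {x : K | x * σ x = a}.ncard = q + 1 :=
  h.ncard_fixed_and_norm.2 a ha ha0

theorem ncard_norm_eq_zero (_ : IsConj q σ) : {x : K | x * σ x = 0}.ncard = 1 := by
  have : {x : K | x * σ x = 0} = {0} := by
    ext x
    simp
  rw [this, Set.ncard_singleton]

theorem exists_norm_eq (h : IsConj q σ) {a : K} (ha : σ a = a) : ∃ x, x * σ x = a := by
  by_cases ha0 : a = 0
  · exact ⟨0, by simp [ha0]⟩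
  · have : {x : K | x * σ x = a}.Nonempty := by
      rw [← Set.ncard_pos (Set.toFinite _), h.ncard_norm_eq ha ha0]
      omega
    exact this

theorem ncard_fixed_ne_zero (h : IsConj q σ) : {x : K | σ x = x ∧ x ≠ 0}.ncard = q - 1 :=
  h.ncard_fixed_and_norm.1

theorem ncard_fixed (h : IsConj q σ) : {x : K | σ x = x}.ncard = q := by
  have h1 := h.ncard_fixed_ne_zero
  have : {x : K | σ x = x ∧ x ≠ 0} = {x : K | σ x = x} \ {0} := by
    ext
    simp
  rw [this, Set.ncard_sdiff_singleton_of_mem (by simp)] at h1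
  have h2 : 0 < {x : K | σ x = x}.ncard := by
    rw [Set.ncard_pos (Set.toFinite _)]
    exact ⟨0, by simp⟩
  have := h.three_le
  omega

theorem exists_conj_eq_neg (h : IsConj q σ) : ∃ w : K, w ≠ 0 ∧ σ w = -w := by
  have : ∃ x : K, σ x ≠ x := by
    by_contra! hc
    have h1 := h.ncard_fixed
    have : {x : K | σ x = x} = Set.univ := by
      ext x
      simp [hc x]
    rw [this, Set.ncard_univ, h.card] at h1
    have := h.three_le
    nlinarith
  obtain ⟨x, hx⟩ := this
  exact ⟨σ x - x, sub_ne_zero.2 hx, by rw [map_sub, h.conj_conj]; ring⟩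

/-- Hilbert's theorem 90. -/
theorem exists_conj_eq_mul (h : IsConj q σ) {x : K} (hx : x * σ x = 1) :
    ∃ y, y ≠ 0 ∧ σ y = x * y := by
  obtain ⟨w, hw0, hw⟩ := h.exists_conj_eq_neg
  have key : ∀ c, σ (c + σ x * σ c) = x * (c + σ x * σ c) := by
    intro c
    rw [map_add, map_mul, h.conj_conj, h.conj_conj]
    linear_combination (-σ c) * hx
  -- `c = 1` works unless `x = -1`, and then `c = w` does
  by_cases h1 : 1 + σ x = 0
  · refine ⟨w + σ x * σ w, ?_, key w⟩
    rw [hw, eq_neg_of_add_eq_zero_right h1]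
    have := mul_ne_zero h.two_ne_zero hw0
    intro h2
    apply this
    linear_combination h2
  · exact ⟨1 + σ x * σ 1, by simpa using h1, key 1⟩

/-- An element of `K` is a square if and only if its norm is a square in the subfield. -/
theorem isSquare_iff_norm (h : IsConj q σ) (a : K) :
    IsSquare a ↔ ∃ t, σ t = t ∧ a * σ a = t ^ 2 := by
  have := Fintype.ofFinite K
  constructor
  · rintro ⟨b, rfl⟩
    exact ⟨b * σ b, h.norm_fixed b, by rw [map_mul]; ring⟩
  · rintro ⟨t, ht, hat⟩
    by_cases ha : a = 0
    · simp [ha]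
    have ht0 : t ≠ 0 := by
      rintro rfl
      simp [ha] at hat
    rw [FiniteField.isSquare_iff h.ringChar_ne_two ha, ← Nat.card_eq_fintype_card, h.card]
    obtain ⟨m, hm⟩ := h.odd
    have hm2 : q ^ 2 / 2 = (q + 1) * m := by
      have : q ^ 2 = 2 * ((q + 1) * m) + 1 := by
        rw [hm]
        ring
      omega
    have hm3 : q - 1 = 2 * m := by omega
    rw [hm2, pow_mul, pow_succ', ← h.pow, hat, ← pow_mul, ← hm3]
    exact (h.fixed_iff ht0).1 ht

/-- All elements of the subfield are squares in `K`. -/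
theorem isSquare_of_fixed (h : IsConj q σ) {a : K} (ha : σ a = a) : IsSquare a :=
  (h.isSquare_iff_norm a).2 ⟨a, ha, by rw [ha]; ring⟩

theorem isSquare_div_of_not_isSquare (_ : IsConj q σ) {a b : K} (ha : ¬ IsSquare a)
    (hb : ¬ IsSquare b) : IsSquare (a / b) := by
  classical
  have := Fintype.ofFinite K
  have ha0 : a ≠ 0 := by
    rintro rfl
    simp at ha
  have hb0 : b ≠ 0 := by
    rintro rfl
    simp at hb
  have h1 := (quadraticChar_neg_one_iff_not_isSquare (F := K)).2 ha
  have h2 := (quadraticChar_neg_one_iff_not_isSquare (F := K)).2 hb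
  have h3 : quadraticChar K (a * b) = 1 := by
    rw [map_mul, h1, h2]
    rfl
  obtain ⟨c, hc⟩ := (quadraticChar_one_iff_isSquare (mul_ne_zero ha0 hb0)).1 h3
  refine ⟨c / b, ?_⟩
  field_simp
  linear_combination hc

theorem isNonzeroSquareFq_iff (h : IsConj q σ) {x : K} :
    IsNonzeroSquareFq q x ↔ ∃ t, σ t = t ∧ t ≠ 0 ∧ x = t ^ 2 := by
  simp only [IsNonzeroSquareFq, h.pow]

theorem isNonsquareFq_iff (h : IsConj q σ) {x : K} :
    IsNonsquareFq q x ↔ σ x = x ∧ ¬ ∃ t, σ t = t ∧ x = t ^ 2 := by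
  simp only [IsNonsquareFq, h.pow]

theorem ncard_isNonzeroSquareFq (h : IsConj q σ) :
    {x : K | IsNonzeroSquareFq q x}.ncard = (q - 1) / 2 := by
  have h1 := ncard_eq_ncard_mul_of_fibers (s := {x : K | σ x = x ∧ x ≠ 0})
    (t := {x : K | IsNonzeroSquareFq q x}) (fun x => x ^ 2) 2
    (fun x hx => h.isNonzeroSquareFq_iff.2 ⟨x, hx.1, hx.2, rfl⟩) (by
      intro b hb
      obtain ⟨t, ht, ht0, rfl⟩ := h.isNonzeroSquareFq_iff.1 hb
      have : {a | a ∈ {x : K | σ x = x ∧ x ≠ 0} ∧ a ^ 2 = t ^ 2} = {t, -t} := by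
        ext a
        simp only [Set.mem_ofPred_eq, Set.mem_insert_iff, Set.mem_singleton_iff,
          sq_eq_sq_iff_eq_or_eq_neg]
        constructor
        · exact fun h' => h'.2
        · rintro (rfl | rfl)
          · simp [ht, ht0]
          · simp [ht, ht0]
      rw [this, Set.ncard_pair]
      intro h2
      apply mul_ne_zero h.two_ne_zero ht0
      linear_combination h2)
  rw [h.ncard_fixed_ne_zero] at h1
  omega

theorem ncard_isNonsquareFq (h : IsConj q σ) :
    {x : K | IsNonsquareFq q x}.ncard = (q - 1) / 2 := by
  have h1 : {x : K | σ x = x ∧ x ≠ 0} =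
      {x : K | IsNonzeroSquareFq q x} ∪ {x : K | IsNonsquareFq q x} := by
    ext x
    simp only [Set.mem_ofPred_eq, Set.mem_union, h.isNonzeroSquareFq_iff, h.isNonsquareFq_iff]
    constructor
    · rintro ⟨hx, hx0⟩
      by_cases hs : ∃ t, σ t = t ∧ x = t ^ 2
      · obtain ⟨t, ht, rfl⟩ := hs
        exact Or.inl ⟨t, ht, by rintro rfl; simp at hx0, rfl⟩
      · exact Or.inr ⟨hx, hs⟩
    · rintro (⟨t, ht, ht0, rfl⟩ | ⟨hx, hs⟩)
      · simp [ht, ht0]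
      · exact ⟨hx, by rintro rfl; exact hs ⟨0, by simp⟩⟩
  have h2 : Disjoint {x : K | IsNonzeroSquareFq q x} {x : K | IsNonsquareFq q x} := by
    rw [Set.disjoint_left]
    intro x hx hx2
    obtain ⟨t, ht, -, rfl⟩ := h.isNonzeroSquareFq_iff.1 hx
    exact (h.isNonsquareFq_iff.1 hx2).2 ⟨t, ht, rfl⟩
  have h3 := h.ncard_fixed_ne_zero
  rw [h1, Set.ncard_union_eq h2, h.ncard_isNonzeroSquareFq] at h3
  obtain ⟨m, hm⟩ := h.odd
  omega

/-- The functions `x ^ 2`, `x ^ (q + 1)` and `x ^ (2 * q)` are linearly independent. -/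
theorem coeff_eq_zero (h : IsConj q σ) {a b c : K}
    (H : ∀ x, x ≠ 0 → a * x ^ 2 + b * (x * σ x) + c * σ x ^ 2 = 0) : a = 0 ∧ b = 0 ∧ c = 0 := by
  have H1 : ∀ t, t * σ t = 1 → a + b * t + c * t ^ 2 = 0 := by
    intro t ht
    obtain ⟨y, hy0, hy⟩ := h.exists_conj_eq_mul ht
    have := H y hy0
    rw [hy] at this
    have h2 : (a + b * t + c * t ^ 2) * y ^ 2 = 0 := by linear_combination this
    exact (mul_eq_zero.1 h2).resolve_right (pow_ne_zero 2 hy0)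
  have h1 := H1 1 (by simp)
  have h2 := H1 (-1) (by simp)
  have hb : b = 0 := by
    have : 2 * b = 0 := by linear_combination h1 - h2
    exact (mul_eq_zero.1 this).resolve_left h.two_ne_zero
  obtain ⟨t, ht, ht1, ht2⟩ : ∃ t : K, t * σ t = 1 ∧ t ≠ 1 ∧ t ≠ -1 := by
    by_contra! hc
    have h3 : {x : K | x * σ x = 1} ⊆ {1, -1} := fun t ht => by
      by_cases h1 : t = 1
      · simp [h1]
      · simp [hc t ht h1]
    have h4 := (Set.ncard_le_ncard h3 (Set.toFinite _)).trans (Set.ncard_insert_le _ _)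
    rw [h.ncard_norm_eq (by simp) one_ne_zero, Set.ncard_singleton] at h4
    have := h.three_le
    omega
  have h3 := H1 t ht
  have hc : c = 0 := by
    have : c * ((t - 1) * (t + 1)) = 0 := by
      rw [hb] at h1 h3
      linear_combination h3 - h1
    refine (mul_eq_zero.1 this).resolve_right (mul_ne_zero (sub_ne_zero.2 ht1) ?_)
    intro h5
    exact ht2 (eq_neg_of_add_eq_zero_left h5)
  refine ⟨?_, hb, hc⟩
  rw [hb, hc] at h1
  linear_combination h1

end IsConj
end

/-! ### Two-by-two matrices as vectors and the involution fixing the Dickson matrices -/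

section Algebra

variable {K : Type*} [Field K] (σ : K →+* K)

/-- The polar form of `formQ`. -/
def polarQ (v w : Fin 4 → K) : K := v 0 * w 3 + v 3 * w 0 - v 1 * w 2 - v 2 * w 1

/-- The semilinear involution whose fixed vectors are the Dickson matrices. -/
def tau (v : Fin 4 → K) : Fin 4 → K := ![σ (v 3), σ (v 2), σ (v 1), σ (v 0)]

/-- The product of two-by-two matrices, written as vectors of length four row by row. -/
def vmul (v w : Fin 4 → K) : Fin 4 → K :=
  ![v 0 * w 0 + v 1 * w 2, v 0 * w 1 + v 1 * w 3, v 2 * w 0 + v 3 * w 2, v 2 * w 1 + v 3 * w 3]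

/-- The adjugate of a two-by-two matrix. -/
def vadj (v : Fin 4 → K) : Fin 4 → K := ![v 3, -v 1, -v 2, v 0]

/-- The vector `v` spans a point of the subgeometry. -/
def InSigma (v : Fin 4 → K) : Prop := ∃ c : K, c ≠ 0 ∧ tau σ (c • v) = c • v

theorem vec4_ext {v w : Fin 4 → K} (h0 : v 0 = w 0) (h1 : v 1 = w 1) (h2 : v 2 = w 2)
    (h3 : v 3 = w 3) : v = w := by
  ext i
  fin_cases i <;> assumption

theorem formQ_smul (c : K) (v : Fin 4 → K) : formQ (c • v) = c ^ 2 * formQ v := by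
  simp only [formQ, Pi.smul_apply, smul_eq_mul]
  ring

theorem polarQ_smul_smul (c d : K) (v w : Fin 4 → K) :
    polarQ (c • v) (d • w) = c * d * polarQ v w := by
  simp only [polarQ, Pi.smul_apply, smul_eq_mul]
  ring

theorem polarQ_eq (v w : Fin 4 → K) : polarQ v w = formQ (v + w) - formQ v - formQ w := by
  simp only [polarQ, formQ, Pi.add_apply]
  ring

theorem formQ_add (v w : Fin 4 → K) : formQ (v + w) = formQ v + formQ w + polarQ v w := by
  rw [polarQ_eq]
  ring

theorem formQ_vmul (v w : Fin 4 → K) : formQ (vmul v w) = formQ v * formQ w := by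
  simp [formQ, vmul]
  ring

theorem formQ_vadj (v : Fin 4 → K) : formQ (vadj v) = formQ v := by
  simp [formQ, vadj]
  ring

theorem vmul_assoc (u v w : Fin 4 → K) : vmul (vmul u v) w = vmul u (vmul v w) := by
  apply vec4_ext <;> simp [vmul] <;> ring

theorem vmul_vadj_vmul (v w : Fin 4 → K) : vmul v (vmul (vadj v) w) = formQ v • w := by
  apply vec4_ext <;> simp [vmul, vadj, formQ] <;> ring

theorem vadj_vmul_vmul (v w : Fin 4 → K) : vmul (vadj v) (vmul v w) = formQ v • w := by
  apply vec4_ext <;> simp [vmul, vadj, formQ] <;> ring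

theorem vmul_vmul_vadj (v w : Fin 4 → K) : vmul w (vmul v (vadj v)) = formQ v • w := by
  apply vec4_ext <;> simp [vmul, vadj, formQ] <;> ring

theorem vadj_vmul (v w : Fin 4 → K) : vadj (vmul v w) = vmul (vadj w) (vadj v) := by
  apply vec4_ext <;> simp [vmul, vadj] <;> ring

theorem vmul_add (u v w : Fin 4 → K) : vmul u (v + w) = vmul u v + vmul u w := by
  apply vec4_ext <;> simp [vmul] <;> ring

theorem add_vmul (u v w : Fin 4 → K) : vmul (u + v) w = vmul u w + vmul v w := by
  apply vec4_ext <;> simp [vmul] <;> ring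

theorem vmul_smul (c : K) (v w : Fin 4 → K) : vmul v (c • w) = c • vmul v w := by
  apply vec4_ext <;> simp [vmul] <;> ring

theorem smul_vmul (c : K) (v w : Fin 4 → K) : vmul (c • v) w = c • vmul v w := by
  apply vec4_ext <;> simp [vmul] <;> ring

theorem tau_vmul (v w : Fin 4 → K) : tau σ (vmul v w) = vmul (tau σ v) (tau σ w) := by
  apply vec4_ext <;> simp [vmul, tau] <;> ring

theorem tau_vadj (v : Fin 4 → K) : tau σ (vadj v) = vadj (tau σ v) := by
  apply vec4_ext <;> simp [vadj, tau]

theorem tau_add (v w : Fin 4 → K) : tau σ (v + w) = tau σ v + tau σ w := by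
  apply vec4_ext <;> simp [tau]

theorem tau_smul (c : K) (v : Fin 4 → K) : tau σ (c • v) = σ c • tau σ v := by
  apply vec4_ext <;> simp [tau]

theorem formQ_tau (v : Fin 4 → K) : formQ (tau σ v) = σ (formQ v) := by
  simp [formQ, tau]
  ring

theorem eq_zero_of_polarQ {v : Fin 4 → K} (h : ∀ w, polarQ v w = 0) : v = 0 := by
  have h0 := h ![1, 0, 0, 0]
  have h1 := h ![0, 1, 0, 0]
  have h2 := h ![0, 0, 1, 0]
  have h3 := h ![0, 0, 0, 1]
  simp [polarQ] at h0 h1 h2 h3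
  apply vec4_ext <;> simp [*]

theorem inSigma_smul {c : K} (hc : c ≠ 0) {v : Fin 4 → K} :
    InSigma σ (c • v) ↔ InSigma σ v := by
  constructor
  · rintro ⟨d, hd, h⟩
    exact ⟨d * c, mul_ne_zero hd hc, by rw [mul_smul, h]⟩
  · rintro ⟨d, hd, h⟩
    exact ⟨d * c⁻¹, mul_ne_zero hd (inv_ne_zero hc), by
      rw [smul_smul, mul_assoc, inv_mul_cancel₀ hc, mul_one, h]⟩

theorem inSigma_of_tau_eq {v : Fin 4 → K} (hv : tau σ v = v) : InSigma σ v :=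
  ⟨1, one_ne_zero, by simpa using hv⟩

/-- A linear map that commutes with the involution and is a similitude of `formQ`. -/
structure IsSim (f : (Fin 4 → K) →ₗ[K] (Fin 4 → K)) : Prop where
  comm : ∀ v, tau σ (f v) = f (tau σ v)
  sim : ∃ κ, κ ≠ 0 ∧ ∀ v, formQ (f v) = κ * formQ v

/-- Multiplication from the left by `a`. -/
def lmul (a : Fin 4 → K) : (Fin 4 → K) →ₗ[K] (Fin 4 → K) where
  toFun v := vmul a v
  map_add' v w := vmul_add a v w
  map_smul' c v := vmul_smul c a v

/-- Multiplication from the right by `a`. -/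
def rmul (a : Fin 4 → K) : (Fin 4 → K) →ₗ[K] (Fin 4 → K) where
  toFun v := vmul v a
  map_add' v w := add_vmul v w a
  map_smul' c v := smul_vmul c v a

/-- Transposition of two-by-two matrices. -/
def transp : (Fin 4 → K) →ₗ[K] (Fin 4 → K) where
  toFun v := ![v 0, v 2, v 1, v 3]
  map_add' v w := by apply vec4_ext <;> simp
  map_smul' c v := by apply vec4_ext <;> simp

variable {σ}

theorem isSim_lmul {a : Fin 4 → K} (ha : tau σ a = a) (ha0 : formQ a ≠ 0) :
    IsSim σ (lmul a) where
  comm v := by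
    change tau σ (vmul a v) = vmul a (tau σ v)
    rw [tau_vmul, ha]
  sim := ⟨formQ a, ha0, fun v => formQ_vmul a v⟩

theorem isSim_rmul {a : Fin 4 → K} (ha : tau σ a = a) (ha0 : formQ a ≠ 0) :
    IsSim σ (rmul a) where
  comm v := by
    change tau σ (vmul v a) = vmul (tau σ v) a
    rw [tau_vmul, ha]
  sim := ⟨formQ a, ha0, fun v => by rw [mul_comm]; exact formQ_vmul v a⟩

theorem isSim_transp : IsSim σ transp where
  comm v := by apply vec4_ext <;> simp [tau, transp]
  sim := ⟨1, one_ne_zero, fun v => by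
    simp [formQ, transp]
    ring⟩

theorem IsSim.comp {f g : (Fin 4 → K) →ₗ[K] (Fin 4 → K)} (hf : IsSim σ f) (hg : IsSim σ g) :
    IsSim σ (f ∘ₗ g) where
  comm v := by simp only [LinearMap.comp_apply, hf.comm, hg.comm]
  sim := by
    obtain ⟨k, hk, hk'⟩ := hf.sim
    obtain ⟨l, hl, hl'⟩ := hg.sim
    exact ⟨k * l, mul_ne_zero hk hl, fun v => by
      rw [LinearMap.comp_apply, hk', hl', mul_assoc]⟩

/-- Similitudes are injective because the polar form of `formQ` is nondegenerate. -/
theorem IsSim.injective {f : (Fin 4 → K) →ₗ[K] (Fin 4 → K)} (hf : IsSim σ f) :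
    Function.Injective f := by
  obtain ⟨k, hk, hk'⟩ := hf.sim
  rw [injective_iff_map_eq_zero]
  intro v hv
  refine eq_zero_of_polarQ fun w => ?_
  have h1 : k * polarQ v w = polarQ (f v) (f w) := by
    rw [polarQ_eq, polarQ_eq, ← map_add, hk', hk', hk']
    ring
  have h2 : k * polarQ v w = 0 := by
    rw [h1, hv]
    simp [polarQ]
  exact (mul_eq_zero.1 h2).resolve_left hk

theorem IsSim.inSigma_iff {f : (Fin 4 → K) →ₗ[K] (Fin 4 → K)} (hf : IsSim σ f) (v : Fin 4 → K) :
    InSigma σ (f v) ↔ InSigma σ v := by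
  constructor
  · rintro ⟨c, hc, h⟩
    refine ⟨c, hc, hf.injective ?_⟩
    rw [← hf.comm, map_smul, h]
  · rintro ⟨c, hc, h⟩
    exact ⟨c, hc, by rw [← map_smul, hf.comm, h]⟩

end Algebra

section

variable {q : ℕ} {K : Type*} [Field K] [Finite K] {σ : K →+* K}

namespace IsConj

/-- The Hermitian form is the polar form of `formQ` evaluated at a vector and its image under
`tau`. -/
theorem formH_eq (h : IsConj q σ) (v : Fin 4 → K) : formH q v = polarQ v (tau σ v) := by
  simp [formH, polarQ, tau, h.pow]
  ring

theorem tau_tau (h : IsConj q σ) (v : Fin 4 → K) : tau σ (tau σ v) = v := by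
  apply vec4_ext <;> simp [tau, h.conj_conj]

theorem formH_smul (h : IsConj q σ) (c : K) (v : Fin 4 → K) :
    formH q (c • v) = c * σ c * formH q v := by
  rw [h.formH_eq, h.formH_eq, tau_smul, polarQ_smul_smul]

theorem conj_formH (h : IsConj q σ) (v : Fin 4 → K) : σ (formH q v) = formH q v := by
  rw [h.formH_eq]
  simp [polarQ, tau, h.conj_conj]
  ring

/-- The identity behind both the position of the points with respect to the lines of the
subgeometry and the singularity of the tensors: the points of the subgeometry on the line joining
`v` to `tau v` are spanned by the vectors `z v + tau (z v)`, and the right hand side is a form in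
`z` whose zeros are governed by its discriminant `formH ^ 2 - 4 N(formQ)`. -/
theorem formQ_smul_add_tau (h : IsConj q σ) (v : Fin 4 → K) (z : K) :
    formQ (z • v + tau σ (z • v)) =
      formQ v * z ^ 2 + formH q v * (z * σ z) + σ (formQ v) * σ z ^ 2 := by
  rw [formQ_add, formQ_tau, ← h.formH_eq, formQ_smul, h.formH_smul, map_mul, map_pow]
  ring

/-- A similitude multiplies `formH` by the same factor as `formQ`. -/
theorem formH_sim (h : IsConj q σ) {f : (Fin 4 → K) →ₗ[K] (Fin 4 → K)} (hf : IsSim σ f) {k : K}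
    (hk : ∀ v, formQ (f v) = k * formQ v) (v : Fin 4 → K) : formH q (f v) = k * formH q v := by
  rw [h.formH_eq, h.formH_eq, polarQ_eq, polarQ_eq, hf.comm, ← map_add, hk, hk, hk]
  ring

theorem tau_fixed (h : IsConj q σ) (v : Fin 4 → K) : tau σ (v + tau σ v) = v + tau σ v := by
  rw [tau_add, h.tau_tau, add_comm]

theorem fixed_formQ {v : Fin 4 → K} (hv : tau σ v = v) : σ (formQ v) = formQ v := by
  rw [← formQ_tau, hv]

theorem formH_of_tau_eq (h : IsConj q σ) {v : Fin 4 → K} (hv : tau σ v = v) :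
    formH q v = 2 * formQ v := by
  rw [h.formH_eq, hv]
  simp only [polarQ, formQ]
  ring

/-- If two vectors `u` with `u + tau u = 1` have the same determinant and neither is a scalar,
then they are conjugate by a Dickson matrix. With `w = (x, x ^ q)` a cyclic vector of the matrix `u`
and `w'` one of `u'`, the conjugating matrix takes `w` and `u w` to `w'` and `u' w'`. -/
theorem exists_conjugator (h : IsConj q σ) {u u' : Fin 4 → K} (hu : u + tau σ u = ![1, 0, 0, 1])
    (hu' : u' + tau σ u' = ![1, 0, 0, 1]) (hQ : formQ u = formQ u') (hn : ¬ InSigma σ u)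
    (hn' : ¬ InSigma σ u') :
    ∃ p : Fin 4 → K, tau σ p = p ∧ formQ p ≠ 0 ∧ vmul p u = vmul u' p := by
  -- the matrix with columns `w` and `u w`
  let P : (Fin 4 → K) → K → (Fin 4 → K) := fun u x =>
    ![x, u 0 * x + u 1 * σ x, σ x, u 2 * x + u 3 * σ x]
  have hcoord : ∀ u : Fin 4 → K, u + tau σ u = ![1, 0, 0, 1] →
      u 2 = -σ (u 1) ∧ u 3 = 1 - σ (u 0) := by
    intro u hu
    have h2 := congrFun hu 2
    have h3 := congrFun hu 3
    simp [tau] at h2 h3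
    exact ⟨eq_neg_of_add_eq_zero_left h2, eq_sub_of_add_eq h3⟩
  have hex : ∀ u : Fin 4 → K, u + tau σ u = ![1, 0, 0, 1] → ¬ InSigma σ u →
      ∃ x, formQ (P u x) ≠ 0 := by
    intro u hu hn
    obtain ⟨h2, h3⟩ := hcoord u hu
    by_contra! hc
    obtain ⟨-, hb, hc⟩ := h.coeff_eq_zero (a := u 2) (b := u 3 - u 0) (c := -u 1) (fun x _ => by
      rw [← hc x]
      simp [formQ, P]
      ring)
    have h1 : u 1 = 0 := by simpa using hc
    have h2' : u 2 = 0 := by simp [h2, h1]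
    have hu0 : u = u 0 • ![1, 0, 0, 1] := by
      apply vec4_ext <;> simp [h1, h2', sub_eq_zero.1 hb]
    apply hn
    rw [hu0]
    by_cases h0 : u 0 = 0
    · exact ⟨1, one_ne_zero, by simp [h0, tau]⟩
    · rw [inSigma_smul σ h0]
      exact inSigma_of_tau_eq σ (by apply vec4_ext <;> simp [tau])
  have htau : ∀ u : Fin 4 → K, u + tau σ u = ![1, 0, 0, 1] → ∀ x,
      tau σ (P u x) = vmul (P u x) ![1, 1, -1, 0] := by
    intro u hu x
    obtain ⟨h2, h3⟩ := hcoord u hu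
    apply vec4_ext <;> simp [tau, P, vmul, h2, h3, h.conj_conj] <;> ring
  obtain ⟨x, hx⟩ := hex u hu hn
  obtain ⟨x', hx'⟩ := hex u' hu' hn'
  -- the companion matrix of `u` and of `u'`
  have hcomp : ∀ u x, vmul (vadj (P u x)) u =
      vmul ![0, -formQ u, 1, u 0 + u 3] (vadj (P u x)) := by
    intro u x
    apply vec4_ext <;> simp [vadj, P, vmul, formQ] <;> ring
  have hcomp' : ∀ u x, vmul u (P u x) = vmul (P u x) ![0, -formQ u, 1, u 0 + u 3] := by
    intro u x
    apply vec4_ext <;> simp [P, vmul, formQ] <;> ring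
  have htr : u 0 + u 3 = u' 0 + u' 3 := by
    have key : ∀ u : Fin 4 → K, u + tau σ u = ![1, 0, 0, 1] →
        u 0 + u 3 = 1 + (formQ u - σ (formQ u)) := by
      intro u hu
      obtain ⟨h2, h3⟩ := hcoord u hu
      simp only [formQ, h2, h3, map_sub, map_mul, map_neg, map_one, h.conj_conj]
      ring
    rw [key u hu, key u' hu', hQ]
  refine ⟨vmul (P u' x') (vadj (P u x)), ?_, ?_, ?_⟩
  · rw [tau_vmul, tau_vadj, htau u hu, htau u' hu', vadj_vmul, vmul_assoc]
    congr 1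
    rw [← vmul_assoc]
    apply vec4_ext <;> simp [vmul, vadj]
  · rw [formQ_vmul, formQ_vadj]
    exact mul_ne_zero hx' hx
  · rw [vmul_assoc, hcomp, ← vmul_assoc u', hcomp', hQ, htr, vmul_assoc]

end IsConj
end

/-! ### The group `G` and the similitudes -/

section

variable {q : ℕ} {K : Type*} [Field K] [Finite K] {σ : K →+* K}

/-- The pure tensor `(x, x ^ q) ⊗ (y, y ^ q)`, a singular Dickson matrix. -/
def pureTensor (σ : K →+* K) (x y : K) : Fin 4 → K := ![x * y, x * σ y, σ x * y, σ x * σ y]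

theorem formQ_pureTensor (x y : K) : formQ (pureTensor σ x y) = 0 := by
  simp [formQ, pureTensor]
  ring

/-- The values of a pair of forms agree, up to the scalars by which `formQ` and `formH` change when
a similitude is applied and when the representative of a point is changed. -/
def SameClass (q : ℕ) (σ : K →+* K) (v w : Fin 4 → K) : Prop :=
  ∃ c k : K, c ≠ 0 ∧ k ≠ 0 ∧ σ k = k ∧ formQ w = c ^ 2 * k * formQ v ∧
    formH q w = c * σ c * k * formH q v ∧ (InSigma σ v ↔ InSigma σ w)

theorem exists_rep_eq_smul (v : Fin 4 → K) (hv : v ≠ 0) :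
    ∃ c : K, c ≠ 0 ∧ (Projectivization.mk K v hv).rep = c • v := by
  obtain ⟨a, ha⟩ := Projectivization.exists_smul_eq_mk_rep K v hv
  exact ⟨a, a.ne_zero, ha.symm⟩

theorem mk_smul_eq (v : Fin 4 → K) (hv : v ≠ 0) {c : K} (hcv : c • v ≠ 0) :
    Projectivization.mk K (c • v) hcv = Projectivization.mk K v hv := by
  rw [Projectivization.mk_eq_mk_iff']
  exact ⟨c, rfl⟩

namespace IsConj

theorem tau_pureTensor (h : IsConj q σ) (x y : K) :
    tau σ (pureTensor σ x y) = pureTensor σ x y := by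
  apply vec4_ext <;> simp [tau, pureTensor, h.conj_conj]

theorem mk_mem_quadric (v : Fin 4 → K) (hv : v ≠ 0) :
    Projectivization.mk K v hv ∈ quadric K ↔ formQ v = 0 := by
  obtain ⟨c, hc, h1⟩ := exists_rep_eq_smul v hv
  change formQ (Projectivization.mk K v hv).rep = 0 ↔ _
  rw [h1, formQ_smul]
  simp [hc]

theorem mk_mem_hermitian (h : IsConj q σ) (v : Fin 4 → K) (hv : v ≠ 0) :
    Projectivization.mk K v hv ∈ hermitian q K ↔ formH q v = 0 := by
  obtain ⟨c, hc, h1⟩ := exists_rep_eq_smul v hv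
  change formH q (Projectivization.mk K v hv).rep = 0 ↔ _
  rw [h1, h.formH_smul]
  simp [hc]

theorem mk_mem_subgeometry (h : IsConj q σ) (v : Fin 4 → K) (hv : v ≠ 0) :
    Projectivization.mk K v hv ∈ subgeometry q K ↔ InSigma σ v := by
  constructor
  · rintro ⟨w, hw, hvw, h2, h3⟩
    obtain ⟨c, hc⟩ := (Projectivization.mk_eq_mk_iff' K v w hv hw).1 hvw
    rw [← h.pow] at h2 h3
    have hc0 : c ≠ 0 := by
      rintro rfl
      simp at hc
      exact hv hc.symm
    rw [← hc, inSigma_smul σ hc0]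
    apply inSigma_of_tau_eq
    apply vec4_ext <;> simp [tau, h2, h3, h.conj_conj]
  · rintro ⟨c, hc, ht⟩
    refine ⟨c • v, smul_ne_zero hc hv, (mk_smul_eq v hv _).symm, ?_, ?_⟩
    · rw [← h.pow]
      exact (congrFun ht 2).symm
    · rw [← h.pow]
      exact (congrFun ht 3).symm

theorem mk_mem_subquadric (h : IsConj q σ) (v : Fin 4 → K) (hv : v ≠ 0) :
    Projectivization.mk K v hv ∈ subquadric q K ↔ formQ v = 0 ∧ InSigma σ v := by
  rw [subquadric, Set.mem_inter_iff, mk_mem_quadric, h.mk_mem_subgeometry]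

/-- Every similitude induces an element of `G`. -/
theorem exists_mem_groupG (h : IsConj q σ) {f : (Fin 4 → K) →ₗ[K] (Fin 4 → K)}
    (hf : IsSim σ f) : ∃ g ∈ groupG q K, ∀ v (hv : v ≠ 0) (hv' : f v ≠ 0),
      g • Projectivization.mk K v hv = Projectivization.mk K (f v) hv' := by
  have hdet : IsUnit (LinearMap.toMatrix' f) := by
    have hu : IsUnit f :=
      (LinearMap.isUnit_iff_ker_eq_bot f).2 (LinearMap.ker_eq_bot.2 hf.injective)
    exact hu.map LinearMap.toMatrixAlgEquiv'
  obtain ⟨g, hg⟩ := hdet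
  have hgv : ∀ v, g • v = f v := by
    intro v
    rw [Units.smul_def, hg]
    exact LinearMap.toMatrix'_mulVec f v
  have hmk : ∀ v (hv : v ≠ 0) (hv' : f v ≠ 0), (Matrix.ProjGenLinGroup.mk g : PGL(4, K)) •
      Projectivization.mk K v hv = Projectivization.mk K (f v) hv' := by
    intro v hv hv'
    rw [Projectivization.PGL.mk_smul_mk]
    congr 1
    exact hgv v
  refine ⟨Matrix.ProjGenLinGroup.mk g, ?_, hmk⟩
  rw [groupG, MulAction.mem_stabilizer_set]
  intro P
  induction P using Projectivization.ind with | _ v hv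
  have hv' : f v ≠ 0 := fun h0 => hv (hf.injective (by rw [h0, map_zero]))
  obtain ⟨k, hk, hk'⟩ := hf.sim
  rw [hmk v hv hv', h.mk_mem_subquadric, h.mk_mem_subquadric, hf.inSigma_iff, hk']
  simp [hk]

/-- A linear map which sends the pure tensors to multiples of fixed vectors of `tau` commutes with
`tau` up to a scalar. -/
theorem exists_smul_comm (h : IsConj q σ) {f : (Fin 4 → K) →ₗ[K] (Fin 4 → K)}
    (hf : Function.Injective f)
    (hS : ∀ x y, x ≠ 0 → y ≠ 0 → InSigma σ (f (pureTensor σ x y))) :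
    ∃ c : K, c ≠ 0 ∧ ∀ v, tau σ ((c • f) v) = (c • f) (tau σ v) := by
  obtain ⟨w, hw0, hw⟩ := h.exists_conj_eq_neg
  have h2 := h.two_ne_zero
  have hμ : ∀ x y, x ≠ 0 → y ≠ 0 →
      ∃ m : K, tau σ (f (pureTensor σ x y)) = m • f (pureTensor σ x y) := by
    intro x y hx hy
    obtain ⟨c, hc, ht⟩ := hS x y hx hy
    refine ⟨c / σ c, ?_⟩
    rw [tau_smul] at ht
    have hc' := h.conj_ne_zero hc
    rw [div_eq_inv_mul, mul_smul, ← ht, smul_smul, inv_mul_cancel₀ hc', one_smul]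
  have h1w : 1 + w ≠ 0 := by
    intro h0
    have h3 := congrArg σ h0
    rw [map_add, hw, map_one, map_zero] at h3
    apply h2
    linear_combination h0 + h3
  -- four pure tensors that form a basis, and their sum, which is a pure tensor again
  obtain ⟨m0, e0⟩ := hμ 1 1 one_ne_zero one_ne_zero
  obtain ⟨m1, e1⟩ := hμ w 1 hw0 one_ne_zero
  obtain ⟨m2, e2⟩ := hμ 1 w one_ne_zero hw0
  obtain ⟨m3, e3⟩ := hμ w w hw0 hw0
  obtain ⟨m, em⟩ := hμ (1 + w) (1 + w) h1w h1w
  have hsum : pureTensor σ (1 + w) (1 + w) = pureTensor σ 1 1 + pureTensor σ w 1 +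
      pureTensor σ 1 w + pureTensor σ w w := by
    apply vec4_ext <;> simp [pureTensor] <;> ring
  have hd : (m - m0) • pureTensor σ 1 1 + (m - m1) • pureTensor σ w 1 +
      (m - m2) • pureTensor σ 1 w + (m - m3) • pureTensor σ w w = 0 := by
    apply hf
    simp only [hsum, map_add, tau_add, e0, e1, e2, e3] at em
    simp only [map_add, map_smul, map_zero]
    linear_combination (norm := module) -em
  have d0 := congrFun hd 0
  have d1 := congrFun hd 1
  have d2 := congrFun hd 2
  have d3 := congrFun hd 3
  simp [pureTensor, hw] at d0 d1 d2 d3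
  have h4 := h.four_ne_zero
  have hm0 : m0 = m := by
    have : 4 * (m - m0) = 0 := by linear_combination d0 + d1 + d2 + d3
    exact (sub_eq_zero.1 ((mul_eq_zero.1 this).resolve_left h4)).symm
  have hm1 : m1 = m := by
    have : (4 * w) * (m - m1) = 0 := by linear_combination d0 + d1 - d2 - d3
    exact (sub_eq_zero.1 ((mul_eq_zero.1 this).resolve_left (mul_ne_zero h4 hw0))).symm
  have hm2 : m2 = m := by
    have : (4 * w) * (m - m2) = 0 := by linear_combination d0 - d1 + d2 - d3
    exact (sub_eq_zero.1 ((mul_eq_zero.1 this).resolve_left (mul_ne_zero h4 hw0))).symm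
  have hm3 : m3 = m := by
    have : (4 * w * w) * (m - m3) = 0 := by linear_combination d0 - d1 - d2 + d3
    exact (sub_eq_zero.1 ((mul_eq_zero.1 this).resolve_left
      (mul_ne_zero (mul_ne_zero h4 hw0) hw0))).symm
  rw [hm0] at e0
  rw [hm1] at e1
  rw [hm2] at e2
  rw [hm3] at e3
  have hexp : ∀ v : Fin 4 → K, ∃ k0 k1 k2 k3 : K, v = k0 • pureTensor σ 1 1 +
      k1 • pureTensor σ w 1 + k2 • pureTensor σ 1 w + k3 • pureTensor σ w w := by
    intro v
    refine ⟨(v 0 + v 1 + v 2 + v 3) / 4, (v 0 + v 1 - v 2 - v 3) / (4 * w),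
      (v 0 - v 1 + v 2 - v 3) / (4 * w), (v 0 - v 1 - v 2 + v 3) / (4 * w * w), ?_⟩
    apply vec4_ext <;> simp [pureTensor, hw] <;> field_simp <;> ring
  have htau : ∀ v, tau σ (f v) = m • f (tau σ v) := by
    intro v
    obtain ⟨k0, k1, k2, k3, rfl⟩ := hexp v
    simp only [map_add, map_smul, tau_add, tau_smul, e0, e1, e2, e3, h.tau_pureTensor, smul_add]
    simp only [smul_comm m]
  -- the factor `m` has norm one since `tau` is an involution, and is absorbed by a scalar
  have hmm : σ m * σ (σ m) = 1 := by
    have h5 := h.tau_tau (f (pureTensor σ 1 1))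
    rw [e0, tau_smul, e0, smul_smul] at h5
    have h6 : f (pureTensor σ 1 1) ≠ 0 := by
      intro h0
      have h7 : pureTensor σ (1 : K) 1 = 0 := hf (by rw [h0, map_zero])
      have := congrFun h7 0
      simp [pureTensor] at this
    have h7 : (σ m * m - 1) • f (pureTensor σ 1 1) = 0 := by
      rw [sub_smul, h5, one_smul, sub_self]
    rw [h.conj_conj]
    exact sub_eq_zero.1 ((smul_eq_zero.1 h7).resolve_right h6)
  obtain ⟨c, hc, hc'⟩ := h.exists_conj_eq_mul hmm
  refine ⟨c, hc, fun v => ?_⟩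
  rw [h.conj_conj] at hmm
  rw [LinearMap.smul_apply, LinearMap.smul_apply, tau_smul, htau, smul_smul, hc']
  congr 1
  linear_combination c * hmm

/-- A linear map which sends the pure tensors to singular vectors is a similitude: the quadratic
forms vanishing on the subquadric are the multiples of `formQ`. -/
theorem formQ_map_eq (h : IsConj q σ) {f : (Fin 4 → K) →ₗ[K] (Fin 4 → K)}
    (hS : ∀ x y, x ≠ 0 → y ≠ 0 → formQ (f (pureTensor σ x y)) = 0) :
    ∃ k, ∀ v, formQ (f v) = k * formQ v := by
  set a0 := f ![1, 0, 0, 0] with ha0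
  set a1 := f ![0, 1, 0, 0] with ha1
  set a2 := f ![0, 0, 1, 0] with ha2
  set a3 := f ![0, 0, 0, 1] with ha3
  have hfv : ∀ v, f v = v 0 • a0 + v 1 • a1 + v 2 • a2 + v 3 • a3 := by
    intro v
    rw [ha0, ha1, ha2, ha3, ← map_smul, ← map_smul, ← map_smul, ← map_smul, ← map_add, ← map_add,
      ← map_add]
    congr 1
    apply vec4_ext <;> simp
  have hQ : ∀ v, formQ (f v) = v 0 ^ 2 * formQ a0 + v 1 ^ 2 * formQ a1 + v 2 ^ 2 * formQ a2 +
      v 3 ^ 2 * formQ a3 + v 0 * v 1 * polarQ a0 a1 + v 0 * v 2 * polarQ a0 a2 +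
      v 0 * v 3 * polarQ a0 a3 + v 1 * v 2 * polarQ a1 a2 + v 1 * v 3 * polarQ a1 a3 +
      v 2 * v 3 * polarQ a2 a3 := by
    intro v
    rw [hfv]
    simp only [formQ, polarQ, Pi.add_apply, Pi.smul_apply, smul_eq_mul]
    ring
  have hx : ∀ y, y ≠ 0 →
      formQ a0 * y ^ 2 + polarQ a0 a1 * (y * σ y) + formQ a1 * σ y ^ 2 = 0 ∧
      polarQ a0 a2 * y ^ 2 + (polarQ a0 a3 + polarQ a1 a2) * (y * σ y) +
        polarQ a1 a3 * σ y ^ 2 = 0 ∧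
      formQ a2 * y ^ 2 + polarQ a2 a3 * (y * σ y) + formQ a3 * σ y ^ 2 = 0 := by
    intro y hy
    refine h.coeff_eq_zero fun x hx => ?_
    rw [← hS x y hx hy, hQ (pureTensor σ x y)]
    simp [pureTensor]
    ring
  obtain ⟨h00, h01, h11⟩ := h.coeff_eq_zero fun y hy => (hx y hy).1
  obtain ⟨h02, h03, h13⟩ := h.coeff_eq_zero fun y hy => (hx y hy).2.1
  obtain ⟨h22, h23, h33⟩ := h.coeff_eq_zero fun y hy => (hx y hy).2.2
  refine ⟨polarQ a0 a3, fun v => ?_⟩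
  rw [hQ, h00, h01, h11, h02, h13, h22, h23, h33, formQ]
  linear_combination v 1 * v 2 * h03

/-- The elements of `G` are induced by similitudes. -/
theorem exists_isSim_of_mem (h : IsConj q σ) {g : PGL(4, K)} (hg : g ∈ groupG q K) :
    ∃ f : (Fin 4 → K) →ₗ[K] (Fin 4 → K), IsSim σ f ∧ ∀ v (hv : v ≠ 0) (hv' : f v ≠ 0),
      g • Projectivization.mk K v hv = Projectivization.mk K (f v) hv' := by
  induction g using Matrix.ProjGenLinGroup.induction_on with | mk g =>
  set f : (Fin 4 → K) →ₗ[K] (Fin 4 → K) := Matrix.mulVecLin (g : Matrix (Fin 4) (Fin 4) K)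
    with hfdef
  have hfg : ∀ v, f v = g • v := fun v => rfl
  have hinj : Function.Injective f := fun v w hvw => by
    rw [hfg, hfg] at hvw
    exact smul_left_cancel g hvw
  have hS : ∀ x y, x ≠ 0 → y ≠ 0 →
      formQ (f (pureTensor σ x y)) = 0 ∧ InSigma σ (f (pureTensor σ x y)) := by
    intro x y hx hy
    have hs : pureTensor σ x y ≠ 0 := by
      intro h0
      have := congrFun h0 0
      simp [pureTensor, hx, hy] at this
    have h1 : Projectivization.mk K _ hs ∈ subquadric q K := (h.mk_mem_subquadric _ _).2
      ⟨formQ_pureTensor x y, inSigma_of_tau_eq σ (h.tau_pureTensor x y)⟩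
    have h2 := (MulAction.mem_stabilizer_set.1 hg _).2 h1
    rw [Projectivization.PGL.mk_smul_mk, h.mk_mem_subquadric] at h2
    exact h2
  obtain ⟨k, hk⟩ := h.formQ_map_eq fun x y hx hy => (hS x y hx hy).1
  obtain ⟨c, hc, hcf⟩ := h.exists_smul_comm hinj fun x y hx hy => (hS x y hx hy).2
  refine ⟨c • f, ⟨hcf, c ^ 2 * k, mul_ne_zero (pow_ne_zero 2 hc) ?_, fun v => ?_⟩, ?_⟩
  · rintro rfl
    have h1 := hk (g⁻¹ • ![1, 0, 0, 1])
    rw [hfg, smul_inv_smul] at h1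
    simp [formQ] at h1
  · rw [LinearMap.smul_apply, formQ_smul, hk, mul_assoc]
  · intro v hv hv'
    rw [Projectivization.PGL.mk_smul_mk]
    exact (mk_smul_eq (f v) (fun h0 => hv (hinj (by rw [h0, map_zero]))) hv').symm

theorem sameClass_of_isSim (h : IsConj q σ) {f : (Fin 4 → K) →ₗ[K] (Fin 4 → K)}
    (hf : IsSim σ f) (v : Fin 4 → K) : SameClass q σ v (f v) := by
  obtain ⟨k, hk, hk'⟩ := hf.sim
  refine ⟨1, k, one_ne_zero, hk, ?_, ?_, ?_, (hf.inSigma_iff v).symm⟩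
  · have h1 : tau σ (f ![1, 0, 0, 1]) = f ![1, 0, 0, 1] := by
      rw [hf.comm]
      congr 1
      apply vec4_ext <;> simp [tau]
    have h2 := fixed_formQ h1
    rw [hk'] at h2
    simpa [formQ] using h2
  · rw [hk']
    ring
  · rw [h.formH_sim hf hk', map_one]
    ring

theorem sameClass_smul_right (h : IsConj q σ) {v w : Fin 4 → K} {c : K} (hc : c ≠ 0) :
    SameClass q σ v (c • w) ↔ SameClass q σ v w := by
  have hc' := h.conj_ne_zero hc
  constructor
  · rintro ⟨d, k, hd, hk, hk', h1, h2, h3⟩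
    rw [formQ_smul] at h1
    rw [h.formH_smul] at h2
    refine ⟨d / c, k, div_ne_zero hd hc, hk, hk', ?_, ?_, by rw [h3, inSigma_smul σ hc]⟩
    · field_simp
      linear_combination h1
    · rw [map_div₀]
      field_simp
      linear_combination h2
  · rintro ⟨d, k, hd, hk, hk', h1, h2, h3⟩
    refine ⟨d * c, k, mul_ne_zero hd hc, hk, hk', ?_, ?_, by rw [h3, inSigma_smul σ hc]⟩
    · rw [formQ_smul, h1]
      ring
    · rw [h.formH_smul, h2, map_mul]
      ring

end IsConj
end

/-! ### The orbits of `G` are determined by the two forms -/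

section

variable {q : ℕ} {K : Type*} [Field K] [Finite K] {σ : K →+* K}

namespace IsConj

theorem mem_orbit_of_isSim (h : IsConj q σ) {f : (Fin 4 → K) →ₗ[K] (Fin 4 → K)}
    (hf : IsSim σ f) {v w : Fin 4 → K} (hv : v ≠ 0) (hw : w ≠ 0) {c : K} (hc : c ≠ 0)
    (hfv : f v = c • w) :
    Projectivization.mk K w hw ∈ MulAction.orbit (groupG q K) (Projectivization.mk K v hv) := by
  obtain ⟨g, hg, hg'⟩ := h.exists_mem_groupG hf
  refine ⟨⟨g, hg⟩, ?_⟩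
  have hv' : f v ≠ 0 := by
    rw [hfv]
    exact smul_ne_zero hc hw
  change g • Projectivization.mk K v hv = _
  rw [hg' v hv hv']
  simp only [hfv]
  exact mk_smul_eq w hw _

theorem isSim_diag_left (h : IsConj q σ) {a : K} (ha : a ≠ 0) :
    IsSim σ (lmul ![a, 0, 0, σ a]) :=
  isSim_lmul (by apply vec4_ext <;> simp [tau, h.conj_conj]) (by simp [formQ, ha])

theorem isSim_diag_right (h : IsConj q σ) {a : K} (ha : a ≠ 0) :
    IsSim σ (rmul ![a, 0, 0, σ a]) :=
  isSim_rmul (by apply vec4_ext <;> simp [tau, h.conj_conj]) (by simp [formQ, ha])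

/-- The nonzero singular Dickson matrices are the pure tensors. -/
theorem eq_pureTensor (h : IsConj q σ) {v : Fin 4 → K} (hv : v ≠ 0) (ht : tau σ v = v)
    (hQ : formQ v = 0) : ∃ x y, x ≠ 0 ∧ y ≠ 0 ∧ v = pureTensor σ x y := by
  have h2 : σ (v 1) = v 2 := congrFun ht 2
  have h3 : σ (v 0) = v 3 := congrFun ht 3
  have hN : v 0 * σ (v 0) - v 1 * σ (v 1) = 0 := by rw [h2, h3]; exact hQ
  have h0 : v 0 ≠ 0 := by
    intro h0
    have h1 : v 1 = 0 := by simpa [h0] using hN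
    apply hv
    apply vec4_ext <;> simp [h0, h1, ← h2, ← h3]
  have h0' := h.conj_ne_zero h0
  obtain ⟨y, hy, hy'⟩ := h.exists_conj_eq_mul (x := v 1 / v 0) (by
    rw [map_div₀]
    field_simp
    linear_combination -hN)
  have h1 : v 1 = v 0 / y * σ y := by
    rw [hy']
    field_simp
  have hy2 := h.conj_ne_zero hy
  refine ⟨v 0 / y, y, div_ne_zero h0 hy, hy, ?_⟩
  apply vec4_ext
  · simp [pureTensor, hy]
  · simpa [pureTensor] using h1
  · rw [← h2, h1]
    simp [pureTensor, h.conj_conj]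
  · simp [pureTensor, ← h3, hy]

/-- The points of the subgeometry off the quadric are related by multiplication by Dickson
matrices, and those on the quadric by diagonal Dickson matrices on both sides. -/
theorem exists_isSim_of_fixed (h : IsConj q σ) {v w : Fin 4 → K} (hv : v ≠ 0) (hw : w ≠ 0)
    (htv : tau σ v = v) (htw : tau σ w = w) (hQ : formQ v = 0 ↔ formQ w = 0) :
    ∃ f, IsSim σ f ∧ ∃ c : K, c ≠ 0 ∧ f v = c • w := by
  by_cases h0 : formQ v = 0
  · obtain ⟨x, y, hx, hy, rfl⟩ := h.eq_pureTensor hv htv h0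
    obtain ⟨x', y', hx', hy', rfl⟩ := h.eq_pureTensor hw htw (hQ.1 h0)
    refine ⟨_, (h.isSim_diag_left (div_ne_zero hx' hx)).comp
      (h.isSim_diag_right (div_ne_zero hy' hy)), 1, one_ne_zero, ?_⟩
    have hsx := h.conj_ne_zero hx
    have hsy := h.conj_ne_zero hy
    apply vec4_ext <;> simp [lmul, rmul, vmul, pureTensor] <;> field_simp
  · have h1 : formQ w ≠ 0 := fun h1 => h0 (hQ.2 h1)
    refine ⟨_, (isSim_lmul htw h1).comp (isSim_lmul (a := vadj v) (by rw [tau_vadj, htv])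
      (by rwa [formQ_vadj])), formQ v, h0, ?_⟩
    apply vec4_ext <;> simp [lmul, vmul, vadj, formQ] <;> ring

/-- Up to transposition, a point on an extended generator is the image of one fixed point: its
row space is spanned by the first row of an invertible Dickson matrix, and its column space
by a vector `(x, x ^ q)`. -/
theorem exists_isSim_generator (h : IsConj q σ) {v : Fin 4 → K} (hv : v ≠ 0)
    (hQ : formQ v = 0) (hH : formH q v = 0) (hS : ¬ InSigma σ v) :
    ∃ f, IsSim σ f ∧ f ![1, 0, 1, 0] = v := by
  -- the case of two proportional rows with a factor of norm one
  have key : ∀ v : Fin 4 → K, ¬ InSigma σ v → ∀ t, t * σ t = 1 → v 2 = t * v 0 →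
      v 3 = t * v 1 → ∃ f, IsSim σ f ∧ f ![1, 0, 1, 0] = v := by
    intro v hS t ht h2 h3
    obtain ⟨x, hx, hx'⟩ := h.exists_conj_eq_mul ht
    have hN : v 0 * σ (v 0) - v 1 * σ (v 1) ≠ 0 := by
      intro hN
      apply hS
      by_cases h0 : v 0 = 0
      · have h1 : v 1 = 0 := by simpa [h0] using hN
        exact inSigma_of_tau_eq σ (by
          apply vec4_ext <;> simp [tau, h0, h1, h2, h3])
      · have h0' := h.conj_ne_zero h0
        obtain ⟨y, hy, hy'⟩ := h.exists_conj_eq_mul (x := v 1 / v 0) (by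
          rw [map_div₀]
          field_simp
          linear_combination -hN)
        refine ⟨x * y / v 0, div_ne_zero (mul_ne_zero hx hy) h0, ?_⟩
        have : (x * y / v 0) • v = pureTensor σ x y := by
          apply vec4_ext <;> simp [pureTensor, h2, h3, hx', hy'] <;> field_simp
        rw [this, h.tau_pureTensor]
    have hxs := h.conj_ne_zero hx
    refine ⟨_, (h.isSim_diag_left hx).comp (isSim_rmul
      (a := ![v 0 / x, v 1 / x, σ (v 1 / x), σ (v 0 / x)]) ?_ ?_), ?_⟩
    · apply vec4_ext <;> simp [tau, h.conj_conj]
    · intro h0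
      apply hN
      simp [formQ] at h0
      field_simp at h0
      simpa using h0
    · apply vec4_ext <;> simp [lmul, rmul, vmul, h2, h3, hx'] <;> field_simp
  rw [h.formH_eq] at hH
  by_cases hr : v 0 = 0 ∧ v 1 = 0
  · obtain ⟨h0, h1⟩ := hr
    have hN : v 3 * σ (v 3) - v 2 * σ (v 2) = 0 := by
      simp [polarQ, tau, h0, h1] at hH
      linear_combination hH
    have h2 : v 2 ≠ 0 := by
      intro h2
      have h3 : v 3 = 0 := by simpa [h2] using hN
      apply hv
      apply vec4_ext <;> simp [h0, h1, h2, h3]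
    have h2' := h.conj_ne_zero h2
    obtain ⟨f, hf, hfv⟩ := key (transp v) (by rwa [isSim_transp.inSigma_iff]) (v 3 / v 2) (by
      rw [map_div₀]
      field_simp
      linear_combination hN) (by simp [transp, h0, h1]) (by simp [transp, h2])
    exact ⟨_, isSim_transp.comp hf, by
      rw [LinearMap.comp_apply, hfv]
      apply vec4_ext <;> simp [transp]⟩
  · -- the second row is a multiple of the first one
    obtain ⟨t, h2, h3⟩ : ∃ t, v 2 = t * v 0 ∧ v 3 = t * v 1 := by
      simp only [formQ] at hQ
      by_cases h0 : v 0 = 0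
      · have h1 : v 1 ≠ 0 := fun h1 => hr ⟨h0, h1⟩
        refine ⟨v 3 / v 1, ?_, by field_simp⟩
        rw [h0, zero_mul, zero_sub, neg_eq_zero] at hQ
        rw [h0, mul_zero]
        exact (mul_eq_zero.1 hQ).resolve_left h1
      · refine ⟨v 2 / v 0, by field_simp, ?_⟩
        field_simp
        linear_combination hQ
    have hprod : (1 - t * σ t) * (v 0 * σ (v 0) - v 1 * σ (v 1)) = 0 := by
      simp only [polarQ, tau, h2, h3] at hH
      simp at hH
      linear_combination hH
    rcases mul_eq_zero.1 hprod with ht | hN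
    · exact key v hS t (by linear_combination -ht) h2 h3
    · have h0 : v 0 ≠ 0 := by
        intro h0
        exact hr ⟨h0, by simpa [h0] using hN⟩
      have h0' := h.conj_ne_zero h0
      obtain ⟨f, hf, hfv⟩ := key (transp v) (by rwa [isSim_transp.inSigma_iff]) (v 1 / v 0) (by
        rw [map_div₀]
        field_simp
        linear_combination -hN) (by simp [transp, h0]) (by
          simp [transp, h3, h2]
          field_simp)
      exact ⟨_, isSim_transp.comp hf, by
        rw [LinearMap.comp_apply, hfv]
        apply vec4_ext <;> simp [transp]⟩

/-- Two vectors off the subgeometry with the same values of the two forms, not both zero, are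
related by a similitude. After scaling, `v + tau v` is an invertible Dickson matrix, and
dividing by it reduces the claim to conjugacy. -/
theorem exists_isSim_of_eq (h : IsConj q σ) {v w : Fin 4 → K} (hv : ¬ InSigma σ v)
    (hw : ¬ InSigma σ w) (hQ : formQ v = formQ w) (hH : formH q v = formH q w)
    (h0 : formQ v ≠ 0 ∨ formH q v ≠ 0) :
    ∃ f, IsSim σ f ∧ ∃ c : K, c ≠ 0 ∧ f v = c • w := by
  obtain ⟨z, hz, hz'⟩ : ∃ z : K, z ≠ 0 ∧ formQ (z • v + tau σ (z • v)) ≠ 0 := by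
    by_contra! hc
    obtain ⟨h1, h2, -⟩ := h.coeff_eq_zero fun z hz =>
      (h.formQ_smul_add_tau v z).symm.trans (hc z hz)
    rcases h0 with h0 | h0
    · exact h0 h1
    · exact h0 h2
  have hzw : formQ (z • v + tau σ (z • v)) = formQ (z • w + tau σ (z • w)) := by
    rw [h.formQ_smul_add_tau, h.formQ_smul_add_tau, hQ, hH]
  have hquot : ∀ v, formQ (z • v + tau σ (z • v)) ≠ 0 → ¬ InSigma σ v → ∃ x u,
      tau σ x = x ∧ formQ x = formQ (z • v + tau σ (z • v)) ∧ z • v = vmul x u ∧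
      u + tau σ u = ![1, 0, 0, 1] ∧ ¬ InSigma σ u := by
    intro v ha hv
    set x := z • v + tau σ (z • v) with hx
    have hxt : tau σ x = x := h.tau_fixed _
    set u := (formQ x)⁻¹ • vmul (vadj x) (z • v) with hu
    have hxu : z • v = vmul x u := by
      rw [hu, vmul_smul, vmul_vadj_vmul, smul_smul, inv_mul_cancel₀ ha, one_smul]
    refine ⟨x, u, hxt, rfl, hxu, ?_, ?_⟩
    · have h1 : σ (formQ x)⁻¹ = (formQ x)⁻¹ := by rw [map_inv₀, fixed_formQ hxt]
      rw [hu, tau_smul, h1, tau_vmul, tau_vadj, hxt, ← smul_add, ← vmul_add, ← hx]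
      apply vec4_ext <;> simp [vmul, vadj] <;> field_simp <;> simp [formQ] <;> ring
    · rw [← inSigma_smul σ hz, hxu] at hv
      exact fun h1 => hv (((isSim_lmul hxt ha).inSigma_iff u).2 h1)
  obtain ⟨x, u, hxt, hxa, hxu, hu, hun⟩ := hquot v hz' hv
  obtain ⟨x', u', hxt', hxa', hxu', hu', hun'⟩ := hquot w (hzw ▸ hz') hw
  have hx0 : formQ x ≠ 0 := hxa ▸ hz'
  have hxx : formQ x' = formQ x := by rw [hxa, hxa', hzw]
  have huu : formQ u = formQ u' := by
    have h1 : formQ x * formQ u = formQ x * formQ u' := by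
      rw [← formQ_vmul, ← hxu, ← hxx, ← formQ_vmul, ← hxu', formQ_smul, formQ_smul, hQ]
    exact mul_left_cancel₀ hx0 h1
  obtain ⟨p, hp, hp0, hpu⟩ := h.exists_conjugator hu hu' huu hun hun'
  refine ⟨_, (isSim_lmul hxt' (hxx ▸ hx0)).comp ((isSim_lmul hp hp0).comp
    ((isSim_lmul (a := vadj x) (by rw [tau_vadj, hxt]) (by rwa [formQ_vadj])).comp
      (isSim_rmul (a := vadj p) (by rw [tau_vadj, hp]) (by rwa [formQ_vadj])))),
    formQ x * formQ p, mul_ne_zero hx0 hp0, ?_⟩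
  -- clear the factor `z` by linearity
  have hfz : ∀ f : (Fin 4 → K) →ₗ[K] (Fin 4 → K), f (z • v) = (formQ x * formQ p) • (z • w) →
      f v = (formQ x * formQ p) • w := by
    intro f hf
    rw [map_smul, smul_comm] at hf
    exact smul_right_injective _ hz hf
  apply hfz
  change vmul x' (vmul p (vmul (vadj x) (vmul (z • v) (vadj p)))) = _
  rw [hxu, vmul_assoc, vadj_vmul_vmul, vmul_smul, vmul_smul, ← vmul_assoc p, hpu, vmul_assoc,
    vmul_vmul_vadj, vmul_smul, hxu', smul_smul]

/-- The orbits of `G` are the classes of points on which the two forms agree up to scalars. -/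
theorem mem_orbit_iff (h : IsConj q σ) {v w : Fin 4 → K} (hv : v ≠ 0) (hw : w ≠ 0) :
    Projectivization.mk K w hw ∈ MulAction.orbit (groupG q K) (Projectivization.mk K v hv) ↔
      SameClass q σ v w := by
  constructor
  · rintro ⟨⟨g, hg⟩, hgv⟩
    obtain ⟨f, hf, hf'⟩ := h.exists_isSim_of_mem hg
    change g • Projectivization.mk K v hv = _ at hgv
    have hv' : f v ≠ 0 := fun h0 => hv (hf.injective (by rw [h0, map_zero]))
    rw [hf' v hv hv'] at hgv
    obtain ⟨c, hc⟩ := (Projectivization.mk_eq_mk_iff' K _ _ hv' hw).1 hgv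
    have hc0 : c ≠ 0 := by
      rintro rfl
      rw [zero_smul] at hc
      exact hv' hc.symm
    rw [← h.sameClass_smul_right hc0, hc]
    exact h.sameClass_of_isSim hf v
  · rintro ⟨c, k, hc, hk, hk', hQ, hH, hS⟩
    have hc' := h.conj_ne_zero hc
    by_cases hSv : InSigma σ v
    · obtain ⟨a, ha, hav⟩ := id hSv
      obtain ⟨b, hb, hbw⟩ := hS.1 hSv
      have hQ0 : formQ (a • v) = 0 ↔ formQ (b • w) = 0 := by
        rw [formQ_smul, formQ_smul, hQ]
        simp [ha, hb, hc, hk]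
      obtain ⟨f, hf, d, hd, hfd⟩ := h.exists_isSim_of_fixed (smul_ne_zero ha hv)
        (smul_ne_zero hb hw) hav hbw hQ0
      have h1 := h.mem_orbit_of_isSim hf (smul_ne_zero ha hv) (smul_ne_zero hb hw) hd hfd
      rwa [mk_smul_eq v hv, mk_smul_eq w hw] at h1
    have hSw : ¬ InSigma σ w := fun h1 => hSv (hS.2 h1)
    by_cases h0 : formQ v = 0 ∧ formH q v = 0
    · obtain ⟨f, hf, hfv⟩ := h.exists_isSim_generator hv h0.1 h0.2 hSv
      obtain ⟨f', hf', hfw⟩ := h.exists_isSim_generator hw (by rw [hQ, h0.1, mul_zero])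
        (by rw [hH, h0.2, mul_zero]) hSw
      have he : (![1, 0, 1, 0] : Fin 4 → K) ≠ 0 := fun he => by
        have := congrFun he 0
        simp at this
      have h1 := h.mem_orbit_of_isSim hf he hv one_ne_zero (by rw [hfv, one_smul])
      have h2 := h.mem_orbit_of_isSim hf' he hw one_ne_zero (by rw [hfw, one_smul])
      rw [← MulAction.orbit_eq_iff] at h1 h2 ⊢
      rw [h1, h2]
    -- a Dickson matrix of determinant `k`
    obtain ⟨a, ha⟩ := h.exists_norm_eq hk'
    have ha0 : a ≠ 0 := by
      rintro rfl
      simp at ha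
      exact hk ha.symm
    have hsim := h.isSim_diag_left ha0
    have hdet : ∀ v, formQ (lmul ![a, 0, 0, σ a] v) = k * formQ v := by
      intro v
      rw [← ha]
      refine (formQ_vmul _ _).trans ?_
      simp [formQ]
    obtain ⟨f, hf, d, hd, hfd⟩ := h.exists_isSim_of_eq (v := lmul ![a, 0, 0, σ a] (c • v)) (w := w)
      (by rwa [hsim.inSigma_iff, inSigma_smul σ hc]) hSw
      (by rw [hdet, formQ_smul, hQ]; ring)
      (by rw [h.formH_sim hsim hdet, h.formH_smul, hH]; ring)
      (by
        rw [hdet, formQ_smul, h.formH_sim hsim hdet, h.formH_smul]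
        by_contra! hcon
        apply h0
        simpa [hc, hk] using hcon)
    have h1 := h.mem_orbit_of_isSim (hf.comp hsim) (smul_ne_zero hc hv) hw hd hfd
    rwa [mk_smul_eq v hv] at h1

end IsConj
end

/-! ### Extended lines of the subgeometry -/

section

variable {q : ℕ} {K : Type*} [Field K] [Finite K] {σ : K →+* K}

theorem mk_mem_pointsOn {L : Submodule K (Fin 4 → K)} {v : Fin 4 → K} {hv : v ≠ 0} :
    Projectivization.mk K v hv ∈ pointsOn L ↔ v ∈ L := by
  change (Projectivization.mk K v hv).submodule ≤ L ↔ _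
  rw [Projectivization.submodule_mk, Submodule.span_singleton_le_iff_mem]

/-- The line joining the point spanned by `v` to its conjugate. -/
def joinTau (σ : K →+* K) (v : Fin 4 → K) : Submodule K (Fin 4 → K) :=
  Submodule.span K {v, tau σ v}

theorem mem_joinTau {v x : Fin 4 → K} :
    x ∈ joinTau σ v ↔ ∃ a b : K, a • v + b • tau σ v = x :=
  Submodule.mem_span_pair

namespace IsConj

/-- A vector `v` off the subgeometry is linearly independent of `tau v`. -/
theorem eq_zero_of_add_tau (h : IsConj q σ) {v : Fin 4 → K} (hS : ¬ InSigma σ v) {a b : K}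
    (hab : a • v + b • tau σ v = 0) : a = 0 ∧ b = 0 := by
  have hv : v ≠ 0 := by
    rintro rfl
    exact hS (inSigma_of_tau_eq σ (by apply vec4_ext <;> simp [tau]))
  by_cases hb : b = 0
  · rw [hb, zero_smul, add_zero] at hab
    exact ⟨(smul_eq_zero.1 hab).resolve_right hv, hb⟩
  exfalso
  obtain ⟨m, hm⟩ : ∃ m : K, tau σ v = m • v := by
    refine ⟨-(b⁻¹ * a), ?_⟩
    rw [neg_smul, mul_smul, eq_neg_of_add_eq_zero_left hab, smul_neg, neg_neg, smul_smul,
      inv_mul_cancel₀ hb, one_smul]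
  have hmm : σ m * m = 1 := by
    have h1 := h.tau_tau v
    rw [hm, tau_smul, hm, smul_smul] at h1
    have h2 : (σ m * m - 1) • v = 0 := by rw [sub_smul, h1, one_smul, sub_self]
    exact sub_eq_zero.1 ((smul_eq_zero.1 h2).resolve_right hv)
  obtain ⟨c, hc, hc'⟩ := h.exists_conj_eq_mul (x := σ m) (by rw [h.conj_conj, hmm])
  apply hS
  refine ⟨c, hc, ?_⟩
  rw [tau_smul, hm, hc', smul_smul]
  congr 1
  linear_combination c * hmm

theorem add_tau_ne_zero (h : IsConj q σ) {v : Fin 4 → K} (hS : ¬ InSigma σ v) {z : K}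
    (hz : z ≠ 0) : z • v + tau σ (z • v) ≠ 0 := by
  intro h0
  rw [tau_smul] at h0
  exact hz (h.eq_zero_of_add_tau hS h0).1

theorem finrank_joinTau (h : IsConj q σ) {v : Fin 4 → K} (hS : ¬ InSigma σ v) :
    Module.finrank K (joinTau σ v) = 2 := by
  have hli : LinearIndependent K ![v, tau σ v] := by
    rw [LinearIndependent.pair_iff]
    intro a b hab
    exact h.eq_zero_of_add_tau hS hab
  have := finrank_span_eq_card hli
  rw [Matrix.range_cons_cons_empty] at this
  exact this.trans (by simp)

/-- The points of the subgeometry on the line joining a point to its conjugate. -/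
theorem mem_joinTau_subgeometry (h : IsConj q σ) {v : Fin 4 → K} (hS : ¬ InSigma σ v)
    (P : PG3 K) : P ∈ pointsOn (joinTau σ v) ∩ subgeometry q K ↔
      ∃ (z : K) (hz : z ≠ 0), P = Projectivization.mk K _ (h.add_tau_ne_zero hS hz) := by
  induction P using Projectivization.ind with | _ x hx
  rw [Set.mem_inter_iff, mk_mem_pointsOn, h.mk_mem_subgeometry]
  constructor
  · rintro ⟨hxL, c, hc, hcx⟩
    obtain ⟨a, b, hab⟩ := mem_joinTau.1 ((joinTau σ v).smul_mem c hxL)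
    have h1 : (a - σ b) • v + (b - σ a) • tau σ v = 0 := by
      have h2 := hcx
      rw [← hab, tau_add, tau_smul, tau_smul, h.tau_tau] at h2
      rw [sub_smul, sub_smul]
      linear_combination (norm := module) -h2
    have hb : b = σ a := sub_eq_zero.1 (h.eq_zero_of_add_tau hS h1).2
    have ha : a ≠ 0 := by
      rintro rfl
      rw [hb, map_zero, zero_smul, zero_smul, add_zero] at hab
      exact smul_ne_zero hc hx hab.symm
    refine ⟨a, ha, ?_⟩
    rw [Projectivization.mk_eq_mk_iff']
    refine ⟨c⁻¹, ?_⟩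
    rw [tau_smul, ← hb, hab, smul_smul, inv_mul_cancel₀ hc, one_smul]
  · rintro ⟨z, hz, hP⟩
    rw [← mk_mem_pointsOn (hv := hx), ← h.mk_mem_subgeometry x hx, hP, mk_mem_pointsOn,
      h.mk_mem_subgeometry]
    refine ⟨mem_joinTau.2 ⟨z, σ z, by rw [tau_smul]⟩, inSigma_of_tau_eq σ (h.tau_fixed _)⟩

theorem mk_add_tau_eq_iff (h : IsConj q σ) {v : Fin 4 → K} (hS : ¬ InSigma σ v) {z z' : K}
    (hz : z ≠ 0) (hz' : z' ≠ 0) :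
    Projectivization.mk K _ (h.add_tau_ne_zero hS hz) =
      Projectivization.mk K _ (h.add_tau_ne_zero hS hz') ↔ z * σ z' = z' * σ z := by
  rw [Projectivization.mk_eq_mk_iff']
  constructor
  · rintro ⟨c, hc⟩
    rw [tau_smul, tau_smul] at hc
    have h1 : (c * z' - z) • v + (c * σ z' - σ z) • tau σ v = 0 := by
      linear_combination (norm := module) hc
    obtain ⟨h2, h3⟩ := h.eq_zero_of_add_tau hS h1
    linear_combination (-σ z') * h2 + z' * h3
  · intro he
    refine ⟨z / z', ?_⟩
    have h1 : z / z' * σ z' = σ z := by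
      field_simp
      exact he
    rw [tau_smul, tau_smul, smul_add, smul_smul, smul_smul, h1, div_mul_cancel₀ z hz']

theorem isSigmaLine_joinTau (h : IsConj q σ) {v : Fin 4 → K} (hS : ¬ InSigma σ v) :
    IsSigmaLine q (joinTau σ v) := by
  obtain ⟨w, hw0, hw⟩ := h.exists_conj_eq_neg
  refine ⟨h.finrank_joinTau hS, _, (h.mem_joinTau_subgeometry hS _).2 ⟨1, one_ne_zero, rfl⟩, _,
    (h.mem_joinTau_subgeometry hS _).2 ⟨w, hw0, rfl⟩, ?_⟩
  rw [Ne, h.mk_add_tau_eq_iff hS one_ne_zero hw0, hw, map_one]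
  intro h1
  exact mul_ne_zero h.two_ne_zero hw0 (by linear_combination -h1)

/-- A point off the subgeometry lies on at most one extended line of the subgeometry. -/
theorem eq_joinTau (h : IsConj q σ) {v : Fin 4 → K} (hS : ¬ InSigma σ v)
    {L : Submodule K (Fin 4 → K)} (hL : IsSigmaLine q L) (hv : v ∈ L) : L = joinTau σ v := by
  obtain ⟨hL2, P, ⟨hPL, hP⟩, P', ⟨hPL', hP'⟩, hne⟩ := hL
  induction P using Projectivization.ind with | _ x hx
  induction P' using Projectivization.ind with | _ y hy
  rw [mk_mem_pointsOn] at hPL hPL'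
  obtain ⟨a, ha, hax⟩ := (h.mk_mem_subgeometry _ _).1 hP
  obtain ⟨b, hb, hby⟩ := (h.mk_mem_subgeometry _ _).1 hP'
  have hli : LinearIndependent K ![a • x, b • y] := by
    rw [LinearIndependent.pair_iff' (smul_ne_zero ha hx)]
    intro c hc
    apply hne
    rw [← mk_smul_eq x hx (smul_ne_zero ha hx), ← mk_smul_eq y hy (smul_ne_zero hb hy), eq_comm,
      Projectivization.mk_eq_mk_iff']
    exact ⟨c, hc⟩
  have hspan : Submodule.span K {a • x, b • y} = L := by
    apply Submodule.eq_of_le_of_finrank_eq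
    · rw [Submodule.span_le]
      rintro _ (rfl | rfl)
      · exact L.smul_mem a hPL
      · exact L.smul_mem b hPL'
    · have := finrank_span_eq_card hli
      rw [Matrix.range_cons_cons_empty] at this
      rw [this, hL2]
      simp
  have htv : tau σ v ∈ L := by
    rw [← hspan] at hv ⊢
    obtain ⟨c, d, hcd⟩ := Submodule.mem_span_pair.1 hv
    refine Submodule.mem_span_pair.2 ⟨σ c, σ d, ?_⟩
    rw [← hcd, tau_add, tau_smul σ c, tau_smul σ d, hax, hby]
  symm
  apply Submodule.eq_of_le_of_finrank_eq
  · rw [joinTau, Submodule.span_le]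
    rintro _ (rfl | rfl)
    · exact hv
    · exact htv
  · rw [h.finrank_joinTau hS, hL2]

theorem mk_add_tau_mem_subquadric (h : IsConj q σ) {v : Fin 4 → K} (hS : ¬ InSigma σ v) {z : K}
    (hz : z ≠ 0) : Projectivization.mk K _ (h.add_tau_ne_zero hS hz) ∈ subquadric q K ↔
      formQ v * z ^ 2 + formH q v * (z * σ z) + σ (formQ v) * σ z ^ 2 = 0 := by
  rw [h.mk_mem_subquadric, h.formQ_smul_add_tau, and_iff_left]
  exact inSigma_of_tau_eq σ (h.tau_fixed _)

/-- A point lies on an extended generator if and only if the form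
`z ↦ formQ (z v + tau (z v))` vanishes identically. -/
theorem mk_mem_setT (h : IsConj q σ) (v : Fin 4 → K) (hv : v ≠ 0) :
    Projectivization.mk K v hv ∈ setT q K ↔ formQ v = 0 ∧ formH q v = 0 ∧ ¬ InSigma σ v := by
  constructor
  · rintro ⟨⟨L, ⟨hL, hLQ⟩, hvL⟩, hnQ⟩
    have hS : ¬ InSigma σ v := fun hS =>
      hnQ (hLQ ⟨hvL, (h.mk_mem_subgeometry v hv).2 hS⟩)
    rw [h.eq_joinTau hS hL (mk_mem_pointsOn.1 hvL)] at hLQ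
    obtain ⟨h1, h2, -⟩ := h.coeff_eq_zero fun z hz =>
      (h.mk_add_tau_mem_subquadric hS hz).1 (hLQ ((h.mem_joinTau_subgeometry hS _).2 ⟨z, hz, rfl⟩))
    exact ⟨h1, h2, hS⟩
  · rintro ⟨hQ, hH, hS⟩
    refine ⟨⟨joinTau σ v, ⟨h.isSigmaLine_joinTau hS, ?_⟩, ?_⟩, ?_⟩
    · intro P hP
      obtain ⟨z, hz, rfl⟩ := (h.mem_joinTau_subgeometry hS _).1 hP
      rw [h.mk_add_tau_mem_subquadric hS hz, hQ, hH]
      simp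
    · rw [mk_mem_pointsOn]
      exact Submodule.subset_span (by simp)
    · rw [h.mk_mem_subquadric]
      exact fun h1 => hS h1.2

/-- A point lies on an extended tangent line if and only if the form `z ↦ formQ (z v + tau (z v))`
has one zero up to scalars from the subfield, that is, if it is nonzero and its discriminant
vanishes. -/
theorem mk_mem_setDTilde (h : IsConj q σ) (v : Fin 4 → K) (hv : v ≠ 0) :
    Projectivization.mk K v hv ∈ setDTilde q K ↔
      formH q v ≠ 0 ∧ formH q v ^ 2 = 4 * (formQ v * σ (formQ v)) ∧ ¬ InSigma σ v := by
  have h2 := h.two_ne_zero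
  constructor
  · rintro ⟨⟨L, ⟨hL, R, hR⟩, hvL⟩, hnS⟩
    have hS : ¬ InSigma σ v := fun hS => hnS ((h.mk_mem_subgeometry v hv).2 hS)
    rw [h.eq_joinTau hS hL (mk_mem_pointsOn.1 hvL)] at hR
    have hroot : ∀ z (hz : z ≠ 0), formQ v * z ^ 2 + formH q v * (z * σ z) +
        σ (formQ v) * σ z ^ 2 = 0 → R = Projectivization.mk K _ (h.add_tau_ne_zero hS hz) := by
      intro z hz h0
      symm
      rw [← Set.mem_singleton_iff, ← hR]
      exact ⟨((h.mem_joinTau_subgeometry hS _).2 ⟨z, hz, rfl⟩).1,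
        (h.mk_add_tau_mem_subquadric hS hz).2 h0⟩
    have hRm : R ∈ pointsOn (joinTau σ v) ∩ subquadric q K := by
      rw [hR]
      rfl
    obtain ⟨z, hz, hRz⟩ := (h.mem_joinTau_subgeometry hS R).1 ⟨hRm.1, hRm.2.2⟩
    have h0 := (h.mk_add_tau_mem_subquadric hS hz).1 (hRz ▸ hRm.2)
    have hsz := h.conj_ne_zero hz
    by_cases hQ : formQ v = 0
    · exfalso
      have hH : formH q v = 0 := by simpa [hQ, hz] using h0
      obtain ⟨w, hw0, hw⟩ := h.exists_conj_eq_neg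
      have h3 := (hroot 1 one_ne_zero (by simp [hQ, hH])).symm.trans
        (hroot w hw0 (by simp [hQ, hH]))
      rw [h.mk_add_tau_eq_iff hS one_ne_zero hw0, hw, map_one] at h3
      exact mul_ne_zero h2 hw0 (by linear_combination -h3)
    · -- the second root of the quadratic equation for `σ z / z` has norm one as well
      have hsQ := h.conj_ne_zero hQ
      obtain ⟨z', hz', hsz'⟩ := h.exists_conj_eq_mul
        (x := formQ v * z / (σ (formQ v) * σ z)) (by
          rw [map_div₀, map_mul, map_mul, h.conj_conj, h.conj_conj]
          field_simp)
      have h3 := (hroot z hz h0).symm.trans (hroot z' hz' (by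
        rw [hsz']
        field_simp
        linear_combination (formQ v * z' ^ 2) * h0))
      rw [h.mk_add_tau_eq_iff hS hz hz', hsz'] at h3
      field_simp at h3
      have h4 : formH q v * σ z = -2 * formQ v * z := by
        have h5 : z * (formH q v * σ z + 2 * formQ v * z) = 0 := by
          linear_combination h0 + h3
        linear_combination (mul_eq_zero.1 h5).resolve_left hz
      refine ⟨?_, ?_, hS⟩
      · intro hH
        rw [hH, zero_mul] at h4
        exact mul_ne_zero (mul_ne_zero (neg_ne_zero.2 h2) hQ) hz h4.symm
      · have h6 : σ z ^ 2 * (formH q v ^ 2 - 4 * (formQ v * σ (formQ v))) = 0 := by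
          linear_combination (formH q v * σ z - 2 * formQ v * z) * h4 + 4 * formQ v * h3
        exact sub_eq_zero.1 ((mul_eq_zero.1 h6).resolve_left (pow_ne_zero 2 hsz))
  · rintro ⟨hH, hd, hS⟩
    have hQ : formQ v ≠ 0 := by
      intro hQ
      rw [hQ] at hd
      apply hH
      simpa using hd
    have hsQ := h.conj_ne_zero hQ
    have hsH := h.conj_formH v
    obtain ⟨z, hz, hsz⟩ := h.exists_conj_eq_mul
      (x := -formH q v / (2 * σ (formQ v))) (by
        rw [map_div₀, map_mul, map_neg, h.conj_conj, hsH, map_ofNat]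
        field_simp
        linear_combination hd)
    refine ⟨⟨joinTau σ v, ⟨h.isSigmaLine_joinTau hS,
      Projectivization.mk K _ (h.add_tau_ne_zero hS hz), ?_⟩, ?_⟩, ?_⟩
    · ext P
      rw [Set.mem_singleton_iff]
      constructor
      · rintro ⟨hPL, hPQ⟩
        obtain ⟨z', hz', rfl⟩ := (h.mem_joinTau_subgeometry hS P).1 ⟨hPL, hPQ.2⟩
        rw [h.mk_add_tau_mem_subquadric hS hz'] at hPQ
        rw [h.mk_add_tau_eq_iff hS hz' hz, hsz]
        have h3 : (2 * σ (formQ v) * σ z' + formH q v * z') ^ 2 = 0 := by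
          linear_combination 4 * σ (formQ v) * hPQ + z' ^ 2 * hd
        have h4 := (pow_eq_zero_iff (by norm_num)).1 h3
        field_simp
        linear_combination -h4
      · rintro rfl
        refine ⟨((h.mem_joinTau_subgeometry hS _).2 ⟨z, hz, rfl⟩).1,
          (h.mk_add_tau_mem_subquadric hS hz).2 ?_⟩
        rw [hsz]
        field_simp
        linear_combination (-z ^ 2) * hd
    · rw [mk_mem_pointsOn]
      exact Submodule.subset_span (by simp)
    · rw [h.mk_mem_subgeometry]
      exact hS

end IsConj
end

/-! ### Equations of the sets in the list -/

section

variable {q : ℕ} {K : Type*} [Field K] [Finite K] {σ : K →+* K}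

namespace IsConj

theorem contraction_smul (h : IsConj q σ) (c : K) (v : Fin 4 → K) (z x : K) :
    contraction q (c • v) z x = contraction q v (c * z) x := by
  simp only [contraction, ← h.pow, Pi.smul_apply, smul_eq_mul, map_mul]
  ring

/-- The contraction by `z` is singular if and only if its two coefficients have equal norms, and
the difference of these norms is the value at `z` of the form `formQ (z • v + tau (z • v))`. -/
theorem exists_contraction_eq_zero_iff (h : IsConj q σ) (v : Fin 4 → K) (z : K) :
    (∃ x, x ≠ 0 ∧ contraction q v z x = 0) ↔
      formQ v * z ^ 2 + formH q v * (z * σ z) + σ (formQ v) * σ z ^ 2 = 0 := by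
  set a := v 0 * z + σ (v 3) * σ z with ha
  set b := v 2 * z + σ (v 1) * σ z with hb
  have hc : ∀ x, contraction q v z x = a * x + b * σ x := by
    intro x
    simp only [contraction, ← h.pow, ha, hb]
  have hN : formQ v * z ^ 2 + formH q v * (z * σ z) + σ (formQ v) * σ z ^ 2 =
      a * σ a - b * σ b := by
    rw [h.formH_eq]
    simp only [formQ, polarQ, tau, ha, hb, map_add, map_sub, map_mul, h.conj_conj]
    simp
    ring
  rw [hN]
  simp only [hc]
  constructor
  · rintro ⟨x, hx, h0⟩
    have hsx := h.conj_ne_zero hx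
    have h1 := congrArg σ h0
    simp only [map_add, map_mul, map_zero, h.conj_conj] at h1
    have h2 : (x * σ x) * (a * σ a - b * σ b) = 0 := by
      linear_combination (σ a * σ x) * h0 - b * σ x * h1
    exact (mul_eq_zero.1 h2).resolve_left (mul_ne_zero hx hsx)
  · intro h0
    by_cases hb0 : b = 0
    · have ha0 : a = 0 := by simpa [hb0] using h0
      exact ⟨1, one_ne_zero, by simp [ha0, hb0]⟩
    · have hsb := h.conj_ne_zero hb0
      obtain ⟨x, hx, hsx⟩ := h.exists_conj_eq_mul (x := -(a / b)) (by
        rw [map_neg, map_div₀]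
        field_simp
        linear_combination h0)
      refine ⟨x, hx, ?_⟩
      rw [hsx]
      field_simp
      ring

theorem isNonsingularPoint_mk (h : IsConj q σ) (v : Fin 4 → K) (hv : v ≠ 0) :
    IsNonsingularPoint q (Projectivization.mk K v hv) ↔ ∀ z, z ≠ 0 →
      formQ v * z ^ 2 + formH q v * (z * σ z) + σ (formQ v) * σ z ^ 2 ≠ 0 := by
  obtain ⟨c, hc, hrep⟩ := exists_rep_eq_smul v hv
  simp only [IsNonsingularPoint, hrep, h.contraction_smul]
  constructor
  · intro H z hz h0
    obtain ⟨x, hx, hx'⟩ := (h.exists_contraction_eq_zero_iff v z).2 h0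
    refine H (z / c) x (div_ne_zero hz hc) hx ?_
    rwa [mul_div_cancel₀ z hc]
  · intro H z x hz hx h0
    exact H (c * z) (mul_ne_zero hc hz) ((h.exists_contraction_eq_zero_iff v _).1 ⟨x, hx, h0⟩)

/-- With `t = σ z / z`, of norm one, the form is a quadratic polynomial in `t`, whose roots have
norm one if and only if its discriminant is zero or a nonsquare of the subfield. -/
theorem forall_ne_zero_iff_isNonzeroSquareFq (h : IsConj q σ) {a b : K} (ha : a ≠ 0)
    (hb : σ b = b) : (∀ z, z ≠ 0 → a * z ^ 2 + b * (z * σ z) + σ a * σ z ^ 2 ≠ 0) ↔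
      IsNonzeroSquareFq q (b ^ 2 - 4 * (a * σ a)) := by
  have h2 := h.two_ne_zero
  have hsa := h.conj_ne_zero ha
  rw [h.isNonzeroSquareFq_iff]
  constructor
  · intro H
    have hd : σ (b ^ 2 - 4 * (a * σ a)) = b ^ 2 - 4 * (a * σ a) := by
      simp only [map_sub, map_pow, map_mul, hb, map_ofNat, h.conj_conj]
      ring
    obtain ⟨s, hs⟩ := h.isSquare_of_fixed hd
    by_contra hcon
    -- the square root of a discriminant that is zero or a nonsquare is negated by `σ`
    have hss : σ s = -s := by
      have h3 : (σ s - s) * (σ s + s) = 0 := by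
        have h4 := hd
        rw [hs, map_mul] at h4
        linear_combination h4
      rcases mul_eq_zero.1 h3 with h4 | h4
      · have hs0 : s = 0 := by
          by_contra hs0
          exact hcon ⟨s, sub_eq_zero.1 h4, hs0, by rw [hs]; ring⟩
        simp [hs0]
      · exact eq_neg_of_add_eq_zero_left h4
    obtain ⟨z, hz, hsz⟩ := h.exists_conj_eq_mul (x := (s - b) / (2 * σ a)) (by
      rw [map_div₀, map_mul, map_sub, h.conj_conj, hss, hb, map_ofNat]
      field_simp
      linear_combination hs)
    apply H z hz
    rw [hsz]
    field_simp
    linear_combination -z ^ 2 * hs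
  · rintro ⟨s, hs, hs0, hd⟩ z hz h0
    have hsz := h.conj_ne_zero hz
    -- a root with a square root `s` of the discriminant in the subfield does not have norm one
    have key : ∀ s, σ s = s → s ≠ 0 → b ^ 2 - 4 * (a * σ a) = s ^ 2 →
        2 * σ a * σ z + b * z = s * z → False := by
      intro s hs hs0 hd h1
      have h3 := congrArg σ h1
      simp only [map_add, map_mul, map_ofNat, h.conj_conj, hs, hb] at h3
      have h4 : (z * σ z) * (2 * s * (s - b)) = 0 := by
        linear_combination (-(s - b) * σ z) * h1 - 2 * σ a * σ z * h3 - (z * σ z) * hd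
      have h5 : s = b := by
        have h6 := (mul_eq_zero.1 h4).resolve_left (mul_ne_zero hz hsz)
        exact sub_eq_zero.1 ((mul_eq_zero.1 h6).resolve_left (mul_ne_zero h2 hs0))
      rw [h5] at h1
      exact mul_ne_zero (mul_ne_zero h2 hsa) hsz (by linear_combination h1)
    have h3 : (2 * σ a * σ z + b * z - s * z) * (2 * σ a * σ z + b * z - -s * z) = 0 := by
      linear_combination 4 * σ a * h0 + z ^ 2 * hd
    rcases mul_eq_zero.1 h3 with h4 | h4
    · exact key s hs hs0 hd (sub_eq_zero.1 h4)
    · exact key (-s) (by rw [map_neg, hs]) (neg_ne_zero.2 hs0) (by rw [hd]; ring)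
        (sub_eq_zero.1 h4)

theorem mk_mem_sigmaTilde (h : IsConj q σ) (v : Fin 4 → K) (hv : v ≠ 0) :
    Projectivization.mk K v hv ∈ sigmaTilde q K ↔ InSigma σ v ∧ formQ v ≠ 0 := by
  rw [sigmaTilde, Set.mem_sdiff, h.mk_mem_subgeometry, h.mk_mem_subquadric]
  tauto

theorem mk_mem_quadricTilde (h : IsConj q σ) (v : Fin 4 → K) (hv : v ≠ 0) :
    Projectivization.mk K v hv ∈ quadricTilde q K ↔ formQ v = 0 ∧ formH q v ≠ 0 := by
  rw [quadricTilde, Set.mem_sdiff, mk_mem_quadric, h.mk_mem_hermitian]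

theorem mk_mem_setH1 (h : IsConj q σ) (v : Fin 4 → K) (hv : v ≠ 0) :
    Projectivization.mk K v hv ∈ setH1 q K ↔ formH q v = 0 ∧ formQ v ≠ 0 ∧
      IsNonzeroSquareFq q (-4 * (formQ v * σ (formQ v))) := by
  change _ ∧ _ ↔ _
  rw [h.mk_mem_hermitian, h.isNonsingularPoint_mk]
  refine and_congr_right fun hH => ?_
  by_cases hQ : formQ v = 0
  · simp only [hQ, hH, ne_eq, not_true_eq_false, false_and, iff_false]
    intro H
    exact H 1 one_ne_zero (by simp)
  · rw [h.forall_ne_zero_iff_isNonzeroSquareFq hQ (h.conj_formH v), hH]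
    simp [hQ]

theorem mk_mem_setH2 (h : IsConj q σ) (v : Fin 4 → K) (hv : v ≠ 0) :
    Projectivization.mk K v hv ∈ setH2 q K ↔ formH q v = 0 ∧ formQ v ≠ 0 ∧
      ¬ IsNonzeroSquareFq q (-4 * (formQ v * σ (formQ v))) := by
  change _ ∧ _ ∧ _ ↔ _
  rw [h.mk_mem_hermitian, h.isNonsingularPoint_mk, mk_mem_quadric]
  refine and_congr_right fun hH => and_congr_right fun hQ => ?_
  rw [h.forall_ne_zero_iff_isNonzeroSquareFq hQ (h.conj_formH v), hH]
  simp

/-- The equations of `S_ξ` and `S_{-ξ}` multiply to an equation in the square of `formH` and the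
norm of `formQ`, because `formQ ^ (q + 1)` is this norm. -/
theorem mk_mem_surfaceTilde_union (h : IsConj q σ) (ξ : K) (v : Fin 4 → K) (hv : v ≠ 0) :
    Projectivization.mk K v hv ∈ surfaceTilde q ξ ∪ surfaceTilde q (-ξ) ↔ formH q v ≠ 0 ∧
      formH q v ^ 2 = 4 * ξ ^ 2 * (formQ v * σ (formQ v)) := by
  obtain ⟨m, hm⟩ := h.odd
  have hm' : (q + 1) / 2 = m + 1 := by omega
  have hpow : ∀ c : K, (c ^ ((q + 1) / 2)) ^ 2 = c * σ c := by
    intro c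
    rw [← pow_mul, h.pow, ← pow_succ', hm', hm]
    ring
  have hsurf : ∀ ξ : K, Projectivization.mk K v hv ∈ surface q ξ ↔
      formH q (Projectivization.mk K v hv).rep -
        2 * ξ * formQ (Projectivization.mk K v hv).rep ^ ((q + 1) / 2) = 0 := fun _ => Iff.rfl
  simp only [surfaceTilde, Set.mem_union, Set.mem_sdiff, h.mk_mem_hermitian, hsurf]
  obtain ⟨c, hc, hrep⟩ := exists_rep_eq_smul v hv
  have hsc := h.conj_ne_zero hc
  rw [hrep, h.formH_smul, formQ_smul, ← or_and_right, and_comm]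
  refine and_congr_right fun hH => ?_
  rw [← mul_eq_zero, mul_pow, pow_right_comm, hpow]
  have : (c * σ c * formH q v - 2 * ξ * (c * σ c * formQ v ^ ((q + 1) / 2))) *
      (c * σ c * formH q v - 2 * -ξ * (c * σ c * formQ v ^ ((q + 1) / 2))) =
      (c * σ c) ^ 2 * (formH q v ^ 2 - 4 * ξ ^ 2 * (formQ v * σ (formQ v))) := by
    rw [← hpow (formQ v)]
    ring
  rw [this, mul_eq_zero, or_iff_right (pow_ne_zero 2 (mul_ne_zero hc hsc)), sub_eq_zero]

theorem formH_sq_of_inSigma (h : IsConj q σ) {v : Fin 4 → K} (hS : InSigma σ v) :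
    formH q v ^ 2 = 4 * (formQ v * σ (formQ v)) := by
  obtain ⟨c, hc, ht⟩ := hS
  have h1 := h.formH_of_tau_eq ht
  have h2 := fixed_formQ ht
  rw [h.formH_smul, formQ_smul] at h1
  rw [formQ_smul, map_mul, map_pow] at h2
  have hsc := h.conj_ne_zero hc
  have h3 : (c * σ c) ^ 2 * (formH q v ^ 2 - 4 * (formQ v * σ (formQ v))) = 0 := by
    linear_combination (c * σ c * formH q v + 2 * c ^ 2 * formQ v) * h1 - 4 * c ^ 2 * formQ v * h2
  exact sub_eq_zero.1 ((mul_eq_zero.1 h3).resolve_left (pow_ne_zero 2 (mul_ne_zero hc hsc)))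

end IsConj

namespace SameClass

theorem formQ_eq_zero_iff {v w : Fin 4 → K} (hvw : SameClass q σ v w) :
    formQ w = 0 ↔ formQ v = 0 := by
  obtain ⟨c, k, hc, hk, -, hQ, -⟩ := hvw
  rw [hQ]
  simp [hc, hk]

theorem formH_eq_zero_iff {v w : Fin 4 → K} (hvw : SameClass q σ v w) :
    formH q w = 0 ↔ formH q v = 0 := by
  obtain ⟨c, k, hc, hk, -, -, hH, -⟩ := hvw
  rw [hH]
  simp [hc, hk]

theorem inSigma_iff {v w : Fin 4 → K} (hvw : SameClass q σ v w) :
    InSigma σ w ↔ InSigma σ v := by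
  obtain ⟨c, k, -, -, -, -, -, hS⟩ := hvw
  exact hS.symm

/-- Within a class, `formH` and the norm of `formQ` are scaled by `r` and `r ^ 2`. -/
theorem exists_scale (h : IsConj q σ) {v w : Fin 4 → K} (hvw : SameClass q σ v w) :
    ∃ r, r ≠ 0 ∧ σ r = r ∧ formH q w = r * formH q v ∧
      formQ w * σ (formQ w) = r ^ 2 * (formQ v * σ (formQ v)) := by
  obtain ⟨c, k, hc, hk, hk', hQ, hH, -⟩ := hvw
  refine ⟨c * σ c * k, mul_ne_zero (mul_ne_zero hc (h.conj_ne_zero hc)) hk, ?_, hH, ?_⟩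
  · rw [map_mul, h.norm_fixed, hk']
  · rw [hQ, map_mul, map_mul, map_pow, hk']
    ring

end SameClass

/-- A set of points that contains, with a point, exactly the points of its orbit. -/
def IsOrbitLike (q : ℕ) (S : Set (PG3 K)) : Prop :=
  ∀ P ∈ S, MulAction.orbit (groupG q K) P = S

namespace IsConj

theorem isNonzeroSquareFq_scale (h : IsConj q σ) {x r : K} (hr : σ r = r) (hr0 : r ≠ 0) :
    IsNonzeroSquareFq q (r ^ 2 * x) ↔ IsNonzeroSquareFq q x := by
  rw [h.isNonzeroSquareFq_iff, h.isNonzeroSquareFq_iff]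
  constructor
  · rintro ⟨t, ht, ht0, he⟩
    refine ⟨t / r, by rw [map_div₀, ht, hr], div_ne_zero ht0 hr0, ?_⟩
    field_simp
    linear_combination he
  · rintro ⟨t, ht, ht0, rfl⟩
    exact ⟨r * t, by rw [map_mul, ht, hr], mul_ne_zero hr0 ht0, by ring⟩

/-- If `formH` does not vanish, then the class is determined by the quotient of `formH ^ 2` and
the norm of `formQ`. The norm of the quotient of the two values of `formQ` is a square, so this
quotient is the square of some `c`; the norm of `c` then is the quotient of the values of `formH` up
to a sign, which is adjusted by an element whose conjugate is its negative. -/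
theorem sameClass_of_formH_ne_zero (h : IsConj q σ) {v w : Fin 4 → K} (hv : formH q v ≠ 0)
    (hw : formH q w ≠ 0) (hS : InSigma σ v ↔ InSigma σ w)
    (hn : formH q v ^ 2 * (formQ w * σ (formQ w)) = formH q w ^ 2 * (formQ v * σ (formQ v))) :
    SameClass q σ v w := by
  set r := formH q w / formH q v with hrdef
  have hr0 : r ≠ 0 := div_ne_zero hw hv
  have hr : σ r = r := by rw [hrdef, map_div₀, h.conj_formH, h.conj_formH]
  have hH : formH q w = r * formH q v := by rw [hrdef, div_mul_cancel₀ _ hv]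
  have hN : formQ w * σ (formQ w) = r ^ 2 * (formQ v * σ (formQ v)) := by
    rw [hrdef]
    field_simp
    linear_combination hn
  by_cases hQ : formQ v = 0
  · have hQw : formQ w = 0 := by
      rw [hQ] at hN
      simpa using hN
    exact ⟨1, r, one_ne_zero, hr0, hr, by simp [hQ, hQw], by rw [hH, map_one]; ring, hS⟩
  have hsQ := h.conj_ne_zero hQ
  have hsq : formQ w / formQ v * σ (formQ w / formQ v) = r ^ 2 := by
    rw [map_div₀]
    field_simp
    linear_combination hN
  obtain ⟨c, hc⟩ := (h.isSquare_iff_norm _).2 ⟨r, hr, hsq⟩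
  have hQc : formQ w = c ^ 2 * formQ v := by
    rw [sq, ← hc, div_mul_cancel₀ _ hQ]
  have hcc : (c * σ c - r) * (c * σ c + r) = 0 := by
    rw [hc, map_mul] at hsq
    linear_combination hsq
  have hc0 : c ≠ 0 := by
    rintro rfl
    rw [zero_mul, zero_sub, zero_add, mul_eq_zero, neg_eq_zero, or_self] at hcc
    exact hr0 hcc
  rcases mul_eq_zero.1 hcc with h1 | h1
  · refine ⟨c, 1, hc0, one_ne_zero, map_one σ, by rw [hQc, mul_one], ?_, hS⟩
    rw [hH]
    linear_combination -formH q v * h1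
  · obtain ⟨e, he0, he⟩ := h.exists_conj_eq_neg
    refine ⟨c * e, (e ^ 2)⁻¹, mul_ne_zero hc0 he0, inv_ne_zero (pow_ne_zero 2 he0), ?_, ?_, ?_, hS⟩
    · rw [map_inv₀, map_pow, he, neg_sq]
    · rw [hQc]
      field_simp
    · rw [hH, map_mul, he]
      field_simp
      linear_combination h1

/-- If `formH` vanishes and `formQ` does not, then the class is determined by the quadratic
character of minus four times the norm of `formQ`. -/
theorem sameClass_of_formH_eq_zero (h : IsConj q σ) {v w : Fin 4 → K} (hv : formH q v = 0)
    (hw : formH q w = 0) (hQv : formQ v ≠ 0) (hQw : formQ w ≠ 0)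
    (hS : InSigma σ v ↔ InSigma σ w)
    (hn : IsNonzeroSquareFq q (-4 * (formQ v * σ (formQ v))) ↔
      IsNonzeroSquareFq q (-4 * (formQ w * σ (formQ w)))) : SameClass q σ v w := by
  have h2 := h.two_ne_zero
  -- with `-4` the norm of `m`, the hypothesis compares `m * formQ` at the two vectors
  obtain ⟨m, hm⟩ := h.exists_norm_eq (a := -4) (by rw [map_neg, map_ofNat])
  have hm0 : m ≠ 0 := by
    rintro rfl
    apply mul_ne_zero h2 h2
    rw [zero_mul] at hm
    linear_combination hm
  have key : ∀ x, x ≠ 0 → (IsNonzeroSquareFq q (-4 * (x * σ x)) ↔ IsSquare (m * x)) := by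
    intro x hx
    have hmx := mul_ne_zero hm0 hx
    have he : m * x * σ (m * x) = -4 * (x * σ x) := by
      rw [map_mul, ← hm]
      ring
    rw [h.isSquare_iff_norm, he, h.isNonzeroSquareFq_iff]
    constructor
    · rintro ⟨t, ht, -, he⟩
      exact ⟨t, ht, he⟩
    · rintro ⟨t, ht, he'⟩
      refine ⟨t, ht, ?_, he'⟩
      rintro rfl
      rw [← he] at he'
      have := mul_ne_zero hmx (h.conj_ne_zero hmx)
      apply this
      simpa using he'
  rw [key _ hQv, key _ hQw] at hn
  have hsq : IsSquare (formQ w / formQ v) := by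
    have he : formQ w / formQ v = m * formQ w / (m * formQ v) := by field_simp
    rw [he]
    by_cases h1 : IsSquare (m * formQ v)
    · exact (hn.1 h1).div h1
    · exact h.isSquare_div_of_not_isSquare (fun h3 => h1 (hn.2 h3)) h1
  obtain ⟨c, hc⟩ := hsq
  have hQc : formQ w = c ^ 2 * formQ v := by
    rw [sq, ← hc, div_mul_cancel₀ _ hQv]
  refine ⟨c, 1, ?_, one_ne_zero, map_one σ, by rw [hQc, mul_one], by rw [hv, hw, mul_zero], hS⟩
  rintro rfl
  apply hQw
  simpa using hQc

/-- A set of points is an orbit if the condition describing it is preserved within classes and the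
vectors satisfying it form a single class. -/
theorem isOrbitLike_of (h : IsConj q σ) {S : Set (PG3 K)} {p : (Fin 4 → K) → Prop}
    (hS : ∀ v hv, Projectivization.mk K v hv ∈ S ↔ p v)
    (h1 : ∀ v w, w ≠ 0 → p v → SameClass q σ v w → p w)
    (h2 : ∀ v w, p v → p w → SameClass q σ v w) : IsOrbitLike q S := by
  intro P hP
  induction P using Projectivization.ind with | _ v hv
  ext P'
  induction P' using Projectivization.ind with | _ w hw
  rw [h.mem_orbit_iff hv hw, hS]
  rw [hS] at hP
  exact ⟨h1 v w hw hP, h2 v w hP⟩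

theorem isOrbitLike_subquadric (h : IsConj q σ) : IsOrbitLike q (subquadric q K) := by
  refine h.isOrbitLike_of h.mk_mem_subquadric ?_ ?_
  · rintro v w - hv hvw
    rwa [hvw.formQ_eq_zero_iff, hvw.inSigma_iff]
  · intro v w hv hw
    have hHv := h.formH_sq_of_inSigma hv.2
    have hHw := h.formH_sq_of_inSigma hw.2
    rw [hv.1] at hHv
    rw [hw.1] at hHw
    refine ⟨1, 1, one_ne_zero, one_ne_zero, map_one σ, by rw [hv.1, hw.1, mul_zero], ?_,
      iff_of_true hv.2 hw.2⟩
    have h1 : formH q v = 0 := by simpa using hHv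
    have h2 : formH q w = 0 := by simpa using hHw
    rw [h1, h2, mul_zero]

theorem isOrbitLike_setT (h : IsConj q σ) : IsOrbitLike q (setT q K) := by
  refine h.isOrbitLike_of h.mk_mem_setT ?_ ?_
  · rintro v w - hv hvw
    rwa [hvw.formQ_eq_zero_iff, hvw.formH_eq_zero_iff, hvw.inSigma_iff]
  · intro v w hv hw
    exact ⟨1, 1, one_ne_zero, one_ne_zero, map_one σ, by rw [hv.1, hw.1, mul_zero],
      by rw [hv.2.1, hw.2.1, mul_zero], iff_of_false hv.2.2 hw.2.2⟩

theorem formH_ne_zero_of_inSigma (h : IsConj q σ) {v : Fin 4 → K} (hS : InSigma σ v)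
    (hQ : formQ v ≠ 0) : formH q v ≠ 0 := by
  intro hH
  have h1 := h.formH_sq_of_inSigma hS
  have h2 := h.two_ne_zero
  rw [hH] at h1
  apply mul_ne_zero (mul_ne_zero h2 h2) (mul_ne_zero hQ (h.conj_ne_zero hQ))
  linear_combination -h1

theorem isOrbitLike_sigmaTilde (h : IsConj q σ) : IsOrbitLike q (sigmaTilde q K) := by
  refine h.isOrbitLike_of h.mk_mem_sigmaTilde ?_ ?_
  · rintro v w - hv hvw
    rwa [Ne, hvw.formQ_eq_zero_iff, hvw.inSigma_iff]
  · intro v w hv hw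
    refine h.sameClass_of_formH_ne_zero (h.formH_ne_zero_of_inSigma hv.1 hv.2)
      (h.formH_ne_zero_of_inSigma hw.1 hw.2) (iff_of_true hv.1 hw.1) ?_
    rw [h.formH_sq_of_inSigma hv.1, h.formH_sq_of_inSigma hw.1]
    ring

theorem not_inSigma_of_ne (h : IsConj q σ) {v : Fin 4 → K}
    (hv : formH q v ^ 2 ≠ 4 * (formQ v * σ (formQ v))) : ¬ InSigma σ v :=
  fun hS => hv (h.formH_sq_of_inSigma hS)

theorem isOrbitLike_quadricTilde (h : IsConj q σ) : IsOrbitLike q (quadricTilde q K) := by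
  refine h.isOrbitLike_of h.mk_mem_quadricTilde ?_ ?_
  · rintro v w - hv hvw
    rwa [Ne, hvw.formQ_eq_zero_iff, hvw.formH_eq_zero_iff]
  · intro v w hv hw
    refine h.sameClass_of_formH_ne_zero hv.2 hw.2 (iff_of_false ?_ ?_) ?_
    · apply h.not_inSigma_of_ne
      simp [hv.1, hv.2]
    · apply h.not_inSigma_of_ne
      simp [hw.1, hw.2]
    · rw [hv.1, hw.1]
      simp

theorem isOrbitLike_setDTilde (h : IsConj q σ) : IsOrbitLike q (setDTilde q K) := by
  refine h.isOrbitLike_of h.mk_mem_setDTilde ?_ ?_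
  · rintro v w - hv hvw
    rw [Ne, hvw.formH_eq_zero_iff, hvw.inSigma_iff]
    obtain ⟨r, -, -, hH, hN⟩ := hvw.exists_scale h
    refine ⟨hv.1, ?_, hv.2.2⟩
    rw [hH, hN]
    linear_combination r ^ 2 * hv.2.1
  · intro v w hv hw
    refine h.sameClass_of_formH_ne_zero hv.1 hw.1 (iff_of_false hv.2.2 hw.2.2) ?_
    rw [hv.2.1, hw.2.1]
    ring

theorem not_inSigma_of_formH_eq_zero (h : IsConj q σ) {v : Fin 4 → K} (hH : formH q v = 0)
    (hQ : formQ v ≠ 0) : ¬ InSigma σ v :=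
  fun hS => h.formH_ne_zero_of_inSigma hS hQ hH

theorem isNonzeroSquareFq_congr (h : IsConj q σ) {v w : Fin 4 → K} (hvw : SameClass q σ v w) :
    IsNonzeroSquareFq q (-4 * (formQ w * σ (formQ w))) ↔
      IsNonzeroSquareFq q (-4 * (formQ v * σ (formQ v))) := by
  obtain ⟨r, hr0, hr, -, hN⟩ := hvw.exists_scale h
  rw [hN, ← h.isNonzeroSquareFq_scale hr hr0 (x := -4 * (formQ v * σ (formQ v))), mul_left_comm]

theorem isOrbitLike_setH1 (h : IsConj q σ) : IsOrbitLike q (setH1 q K) := by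
  refine h.isOrbitLike_of h.mk_mem_setH1 ?_ ?_
  · rintro v w - hv hvw
    rwa [Ne, hvw.formH_eq_zero_iff, hvw.formQ_eq_zero_iff, h.isNonzeroSquareFq_congr hvw]
  · intro v w hv hw
    exact h.sameClass_of_formH_eq_zero hv.1 hw.1 hv.2.1 hw.2.1
      (iff_of_false (h.not_inSigma_of_formH_eq_zero hv.1 hv.2.1)
        (h.not_inSigma_of_formH_eq_zero hw.1 hw.2.1)) (iff_of_true hv.2.2 hw.2.2)

theorem isOrbitLike_setH2 (h : IsConj q σ) : IsOrbitLike q (setH2 q K) := by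
  refine h.isOrbitLike_of h.mk_mem_setH2 ?_ ?_
  · rintro v w - hv hvw
    rwa [Ne, hvw.formH_eq_zero_iff, hvw.formQ_eq_zero_iff, h.isNonzeroSquareFq_congr hvw]
  · intro v w hv hw
    exact h.sameClass_of_formH_eq_zero hv.1 hw.1 hv.2.1 hw.2.1
      (iff_of_false (h.not_inSigma_of_formH_eq_zero hv.1 hv.2.1)
        (h.not_inSigma_of_formH_eq_zero hw.1 hw.2.1)) (iff_of_false hv.2.2 hw.2.2)

theorem isOrbitLike_surfaceTilde_union (h : IsConj q σ) {ξ : K} (hξ : ξ ^ 2 ≠ 1) :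
    IsOrbitLike q (surfaceTilde q ξ ∪ surfaceTilde q (-ξ)) := by
  have h2 := h.two_ne_zero
  refine h.isOrbitLike_of (h.mk_mem_surfaceTilde_union ξ) ?_ ?_
  · rintro v w - hv hvw
    rw [Ne, hvw.formH_eq_zero_iff]
    obtain ⟨r, -, -, hH, hN⟩ := hvw.exists_scale h
    refine ⟨hv.1, ?_⟩
    rw [hH, hN]
    linear_combination r ^ 2 * hv.2
  · have key : ∀ v : Fin 4 → K, formH q v ≠ 0 ∧
        formH q v ^ 2 = 4 * ξ ^ 2 * (formQ v * σ (formQ v)) → ¬ InSigma σ v := by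
      rintro v ⟨hH, hv⟩
      apply h.not_inSigma_of_ne
      intro h1
      apply hξ
      have h3 : formH q v ^ 2 * (ξ ^ 2 - 1) = 0 := by linear_combination ξ ^ 2 * h1 - hv
      exact sub_eq_zero.1 ((mul_eq_zero.1 h3).resolve_left (pow_ne_zero 2 hH))
    intro v w hv hw
    refine h.sameClass_of_formH_ne_zero hv.1 hw.1 (iff_of_false (key v hv) (key w hw)) ?_
    rw [hv.2, hw.2]
    ring

end IsConj
end

/-! ### Counting vectors with given values of the two forms -/

section

variable {q : ℕ} {K : Type*} [Field K] [Finite K] {σ : K →+* K}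

namespace IsConj

/-- Every point is spanned by `q ^ 2 - 1` vectors. -/
theorem ncard_vectors (h : IsConj q σ) {S : Set (PG3 K)} {p : (Fin 4 → K) → Prop}
    (hS : ∀ v hv, Projectivization.mk K v hv ∈ S ↔ p v) :
    {v | v ≠ 0 ∧ p v}.ncard = S.ncard * (q ^ 2 - 1) := by
  classical
  have he : (![1, 0, 0, 0] : Fin 4 → K) ≠ 0 := fun he => by
    have := congrFun he 0
    simp at this
  refine ncard_eq_ncard_mul_of_fibers (fun v => if hv : v ≠ 0 then Projectivization.mk K v hv else
    Projectivization.mk K _ he) _ ?_ ?_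
  · rintro v ⟨hv, hp⟩
    rw [dif_pos hv, hS]
    exact hp
  · intro P hP
    rw [← h.card_ne_zero_set]
    refine ncard_eq_of_bij (fun c : K => c • P.rep)
      (smul_left_injective K P.rep_nonzero) ?_ ?_
    · intro c
      constructor
      · rintro ⟨⟨hc, -⟩, -⟩ rfl
        exact hc (zero_smul K _)
      · intro hc
        have hv : c • P.rep ≠ 0 := smul_ne_zero hc P.rep_nonzero
        have hmk : Projectivization.mk K (c • P.rep) hv = P := by
          rw [mk_smul_eq P.rep P.rep_nonzero, P.mk_rep]
        refine ⟨⟨hv, ?_⟩, ?_⟩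
        · rw [← hS _ hv, hmk]
          exact hP
        · rw [dif_pos hv, hmk]
    · rintro v ⟨⟨hv, -⟩, hvP⟩
      rw [dif_pos hv] at hvP
      obtain ⟨c, -, hc⟩ := exists_rep_eq_smul v hv
      have hc0 : c ≠ 0 := by
        rintro rfl
        rw [zero_smul] at hc
        exact Projectivization.rep_nonzero _ hc
      refine ⟨c⁻¹, ?_⟩
      rw [← hvP, hc, smul_smul, inv_mul_cancel₀ hc0, one_smul]

/-- The number of Dickson matrices of a given nonzero determinant. -/
theorem ncard_fixed_formQ (h : IsConj q σ) {a : K} (ha : σ a = a) (ha0 : a ≠ 0) :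
    {v | tau σ v = v ∧ formQ v = a}.ncard = (q + 1) * (q ^ 2 - q) := by
  have hcoord : ∀ v : Fin 4 → K, tau σ v = v → v = ![v 0, v 1, σ (v 1), σ (v 0)] := by
    intro v hv
    apply vec4_ext
    · simp
    · simp
    · exact (congrFun hv 2).symm
    · exact (congrFun hv 3).symm
  have hfib : ∀ (r : K → Prop) (y : K), r y →
      {v | v ∈ {v | (tau σ v = v ∧ formQ v = a) ∧ r (v 1)} ∧ v 1 = y}.ncard =
        {x : K | x * σ x = a + y * σ y}.ncard := by
    intro r y hy
    refine ncard_eq_of_bij (fun x => ![x, y, σ y, σ x]) ?_ ?_ ?_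
    · intro x x' hx
      exact congrFun hx 0
    · intro x
      constructor
      · rintro ⟨⟨⟨-, hQ⟩, -⟩, -⟩
        simp only [formQ] at hQ
        simp at hQ
        change x * σ x = _
        linear_combination hQ
      · intro hx
        have hx : x * σ x = a + y * σ y := hx
        refine ⟨⟨⟨?_, ?_⟩, hy⟩, rfl⟩
        · apply vec4_ext <;> simp [tau, h.conj_conj]
        · simp [formQ, hx]
    · rintro v ⟨⟨⟨hv, -⟩, -⟩, rfl⟩
      exact ⟨v 0, (hcoord v hv).symm⟩
  have hsplit : {v | tau σ v = v ∧ formQ v = a} =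
      {v | (tau σ v = v ∧ formQ v = a) ∧ v 1 * σ (v 1) = -a} ∪
      {v | (tau σ v = v ∧ formQ v = a) ∧ ¬ v 1 * σ (v 1) = -a} := by
    ext v
    simp only [Set.mem_ofPred_eq, Set.mem_union]
    tauto
  have hdisj : Disjoint {v | (tau σ v = v ∧ formQ v = a) ∧ v 1 * σ (v 1) = -a}
      {v | (tau σ v = v ∧ formQ v = a) ∧ ¬ v 1 * σ (v 1) = -a} := by
    rw [Set.disjoint_left]
    exact fun v hv hv' => hv'.2 hv.2
  -- the first coordinate has norm `a + y * σ y`, which vanishes for `q + 1` values of `y`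
  have hna : {y : K | y * σ y = -a}.ncard = q + 1 :=
    h.ncard_norm_eq (by rw [map_neg, ha]) (neg_ne_zero.2 ha0)
  have hna' : {y : K | ¬ y * σ y = -a}.ncard = q ^ 2 - (q + 1) := by
    rw [← hna, ← h.card, ← Set.ncard_compl]
    rfl
  rw [hsplit, Set.ncard_union_eq hdisj,
    ncard_eq_ncard_mul_of_fibers (t := {y : K | y * σ y = -a}) (fun v : Fin 4 → K => v 1) 1
      (fun v hv => hv.2)
      (fun y hy => by
        rw [hfib (fun y => y * σ y = -a) y hy]
        have hy : y * σ y = -a := hy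
        rw [hy, add_neg_cancel, h.ncard_norm_eq_zero]),
    ncard_eq_ncard_mul_of_fibers (t := {y : K | ¬ y * σ y = -a}) (fun v : Fin 4 → K => v 1)
      (q + 1) (fun v hv => hv.2) (fun y hy => by
        rw [hfib (fun y => ¬ y * σ y = -a) y hy]
        apply h.ncard_norm_eq
        · rw [map_add, ha, h.norm_fixed]
        · intro h0
          exact hy (eq_neg_of_add_eq_zero_right h0)), hna, hna']
  have h3 := h.three_le
  obtain ⟨m, rfl⟩ : ∃ m, q = m + 3 := ⟨q - 3, by omega⟩
  have e1 : (m + 3) ^ 2 - (m + 3 + 1) = m ^ 2 + 5 * m + 5 := by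
    rw [Nat.sub_eq_of_eq_add]
    ring
  have e2 : (m + 3) ^ 2 - (m + 3) = m ^ 2 + 5 * m + 6 := by
    rw [Nat.sub_eq_of_eq_add]
    ring
  rw [e1, e2]
  ring

/-- The number of vectors `u` with `u + tau u = 1` and `formQ u = e` in terms of the number of roots
in the subfield of a quadratic polynomial. The first coordinate of `u` is `e + r` for some `r` in
the subfield, and the value of the polynomial at `r` is the norm of the second coordinate. -/
theorem ncard_add_tau_eq_one (h : IsConj q σ) (e : K) :
    {u | u + tau σ u = ![1, 0, 0, 1] ∧ formQ u = e}.ncard =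
      {r : K | σ r = r ∧ r ^ 2 + (e + σ e - 1) * r + e * σ e = 0}.ncard +
      (q - {r : K | σ r = r ∧ r ^ 2 + (e + σ e - 1) * r + e * σ e = 0}.ncard) * (q + 1) := by
  set g : K → K := fun r => r ^ 2 + (e + σ e - 1) * r + e * σ e with hg
  have hcoord : ∀ u : Fin 4 → K, u + tau σ u = ![1, 0, 0, 1] →
      u = ![u 0, u 1, -σ (u 1), 1 - σ (u 0)] := by
    intro u hu
    have h2 := congrFun hu 2
    have h3 := congrFun hu 3
    simp [tau] at h2 h3
    apply vec4_ext
    · simp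
    · simp
    · exact eq_neg_of_add_eq_zero_left h2
    · exact eq_sub_of_add_eq h3
  have hr : ∀ u : Fin 4 → K, u + tau σ u = ![1, 0, 0, 1] → formQ u = e →
      σ (u 0 - e) = u 0 - e := by
    intro u hu hQ
    rw [hcoord u hu] at hQ
    simp [formQ] at hQ
    rw [← hQ]
    simp [h.conj_conj]
    ring
  have hfib : ∀ (p : K → Prop) (r : K), σ r = r → p r →
      {u | u ∈ {u | (u + tau σ u = ![1, 0, 0, 1] ∧ formQ u = e) ∧ p (u 0 - e)} ∧
        u 0 - e = r}.ncard = {y : K | y * σ y = g r}.ncard := by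
    intro p r hrr hpr
    have hQ : ∀ y, formQ ![e + r, y, -σ y, 1 - σ (e + r)] = e - g r + y * σ y := by
      intro y
      simp [formQ, hg, hrr]
      ring
    refine ncard_eq_of_bij (fun y => ![e + r, y, -σ y, 1 - σ (e + r)]) ?_ ?_ ?_
    · intro y y' hy
      exact congrFun hy 1
    · intro y
      constructor
      · rintro ⟨⟨⟨-, h1⟩, -⟩, -⟩
        rw [hQ] at h1
        change y * σ y = g r
        linear_combination h1
      · intro hy
        have hy : y * σ y = g r := hy
        refine ⟨⟨⟨?_, ?_⟩, ?_⟩, ?_⟩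
        · apply vec4_ext <;> simp [tau, h.conj_conj]
        · rw [hQ, hy]
          ring
        · simpa using hpr
        · simp
    · rintro u ⟨⟨⟨hu, -⟩, -⟩, rfl⟩
      refine ⟨u 1, ?_⟩
      conv_rhs => rw [hcoord u hu]
      simp
  have hsplit : {u | u + tau σ u = ![1, 0, 0, 1] ∧ formQ u = e} =
      {u | (u + tau σ u = ![1, 0, 0, 1] ∧ formQ u = e) ∧ g (u 0 - e) = 0} ∪
      {u | (u + tau σ u = ![1, 0, 0, 1] ∧ formQ u = e) ∧ ¬ g (u 0 - e) = 0} := by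
    ext v
    simp only [Set.mem_ofPred_eq, Set.mem_union]
    tauto
  have hdisj : Disjoint {u | (u + tau σ u = ![1, 0, 0, 1] ∧ formQ u = e) ∧ g (u 0 - e) = 0}
      {u | (u + tau σ u = ![1, 0, 0, 1] ∧ formQ u = e) ∧ ¬ g (u 0 - e) = 0} := by
    rw [Set.disjoint_left]
    exact fun v hv hv' => hv'.2 hv.2
  have hcompl : {r : K | σ r = r ∧ ¬ g r = 0}.ncard =
      q - {r : K | σ r = r ∧ g r = 0}.ncard := by
    have : {r : K | σ r = r ∧ ¬ g r = 0} = {r : K | σ r = r} \ {r : K | σ r = r ∧ g r = 0} := by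
      ext r
      simp only [Set.mem_ofPred_eq, Set.mem_sdiff]
      tauto
    rw [this, Set.ncard_sdiff (fun r hr => hr.1), h.ncard_fixed]
  rw [hsplit, Set.ncard_union_eq hdisj,
    ncard_eq_ncard_mul_of_fibers (t := {r : K | σ r = r ∧ g r = 0}) (fun u => u 0 - e) 1
      (fun u hu => ⟨hr u hu.1.1 hu.1.2, hu.2⟩)
      (fun r hr => by
        rw [hfib (fun r => g r = 0) r hr.1 hr.2, hr.2, h.ncard_norm_eq_zero]),
    ncard_eq_ncard_mul_of_fibers (t := {r : K | σ r = r ∧ ¬ g r = 0}) (fun u => u 0 - e) (q + 1)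
      (fun u hu => ⟨hr u hu.1.1 hu.1.2, hu.2⟩) (fun r hr => by
        rw [hfib (fun r => ¬ g r = 0) r hr.1 hr.2]
        refine h.ncard_norm_eq ?_ hr.2
        simp only [hg, map_add, map_sub, map_mul, map_pow, map_one, h.conj_conj, hr.1]
        ring), hcompl, mul_one]

/-- The roots of a monic quadratic polynomial correspond to the square roots of its discriminant. -/
theorem ncard_roots (h : IsConj q σ) {b c d t : K} (hb : σ b = b) (ht : σ t = t) (ht0 : t ≠ 0)
    (hd : d = t ^ 2 * (b ^ 2 - 4 * c)) :
    {r : K | σ r = r ∧ r ^ 2 + b * r + c = 0}.ncard = {s : K | σ s = s ∧ s ^ 2 = d}.ncard := by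
  have h2 := h.two_ne_zero
  symm
  refine ncard_eq_of_bij (fun r => t * (2 * r + b)) ?_ ?_ ?_
  · intro r r' hr
    have h1 := mul_left_cancel₀ ht0 hr
    exact mul_left_cancel₀ h2 (add_right_cancel h1)
  · intro r
    constructor
    · rintro ⟨h1, h3⟩
      constructor
      · simp only [map_mul, map_add, ht, hb, map_ofNat] at h1
        exact mul_left_cancel₀ h2 (add_right_cancel (mul_left_cancel₀ ht0 h1))
      · have h4 : (t ^ 2 * (2 * 2)) * (r ^ 2 + b * r + c) = 0 := by linear_combination h3 + hd
        exact (mul_eq_zero.1 h4).resolve_left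
          (mul_ne_zero (pow_ne_zero 2 ht0) (mul_ne_zero h2 h2))
    · rintro ⟨h1, h3⟩
      constructor
      · simp only [map_mul, map_add, ht, hb, map_ofNat, h1]
      · linear_combination 4 * t ^ 2 * h3 - hd
  · intro s _
    exact ⟨(s / t - b) / 2, by field_simp; ring⟩

/-- The number of vectors with given values of the two forms, not both zero, in terms of the number
of square roots of the discriminant. For a suitable `z` the vector `x = z v + tau (z v)` is an
invertible Dickson matrix of a given determinant, and `u = x⁻¹ z v` satisfies `u + tau u = 1`. -/
theorem ncard_formQ_formH (h : IsConj q σ) {a b : K} (hb : σ b = b) (hab : a ≠ 0 ∨ b ≠ 0) :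
    {v | formQ v = a ∧ formH q v = b}.ncard = (q + 1) * (q ^ 2 - q) *
      ({s : K | σ s = s ∧ s ^ 2 = b ^ 2 - 4 * (a * σ a)}.ncard +
      (q - {s : K | σ s = s ∧ s ^ 2 = b ^ 2 - 4 * (a * σ a)}.ncard) * (q + 1)) := by
  obtain ⟨z, hz, hA⟩ : ∃ z : K, z ≠ 0 ∧ a * z ^ 2 + b * (z * σ z) + σ a * σ z ^ 2 ≠ 0 := by
    by_contra! hc
    obtain ⟨h1, h2, -⟩ := h.coeff_eq_zero hc
    rcases hab with h0 | h0
    · exact h0 h1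
    · exact h0 h2
  have hsz := h.conj_ne_zero hz
  set A := a * z ^ 2 + b * (z * σ z) + σ a * σ z ^ 2 with hAdef
  have hAf : σ A = A := by
    simp only [hAdef, map_add, map_mul, map_pow, h.conj_conj, hb]
    ring
  set e := z ^ 2 * a / A with he
  have hse : σ e = σ z ^ 2 * σ a / A := by rw [he, map_div₀, map_mul, map_pow, hAf]
  have hroots := h.ncard_roots (b := e + σ e - 1) (c := e * σ e)
    (d := b ^ 2 - 4 * (a * σ a)) (t := A / (z * σ z))
    (by simp only [map_add, map_sub, map_one, h.conj_conj]; ring)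
    (by rw [map_div₀, hAf, h.norm_fixed]) (div_ne_zero hA (mul_ne_zero hz hsz)) (by
      have h1 : e + σ e - 1 = -(b * (z * σ z)) / A := by
        rw [hse, he]
        field_simp
        rw [hAdef]
        ring
      rw [h1, hse, he]
      field_simp)
  rw [← hroots, ← h.ncard_add_tau_eq_one e, ← h.ncard_fixed_formQ hAf hA]
  refine ncard_eq_ncard_mul_of_fibers (fun v => z • v + tau σ (z • v)) _ ?_ ?_
  · rintro v ⟨hQ, hH⟩
    refine ⟨h.tau_fixed _, ?_⟩
    rw [h.formQ_smul_add_tau, hQ, hH]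
  · rintro x ⟨hx, hxA⟩
    have hinj : Function.Injective (vmul x) :=
      (isSim_lmul hx (by rwa [hxA])).injective
    have hsum : ∀ u, z • z⁻¹ • vmul x u + tau σ (z • z⁻¹ • vmul x u) = vmul x (u + tau σ u) := by
      intro u
      rw [smul_smul, mul_inv_cancel₀ hz, one_smul, tau_vmul, hx, vmul_add]
    have hone : vmul x ![1, 0, 0, 1] = x := by
      apply vec4_ext <;> simp [vmul]
    have hQu : ∀ u, formQ (z⁻¹ • vmul x u) = z⁻¹ ^ 2 * (A * formQ u) := by
      intro u
      rw [formQ_smul, formQ_vmul, hxA]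
    refine ncard_eq_of_bij (fun u => z⁻¹ • vmul x u) ?_ ?_ ?_
    · intro u u' huu
      exact hinj (smul_right_injective _ (inv_ne_zero hz) huu)
    · intro u
      constructor
      · rintro ⟨⟨hQ, -⟩, hux⟩
        refine ⟨hinj ?_, ?_⟩
        · rw [← hsum, hone]
          exact hux
        · rw [hQu] at hQ
          rw [he, ← hQ]
          field_simp
      · rintro ⟨hu, hQ⟩
        have hQ' : formQ (z⁻¹ • vmul x u) = a := by
          rw [hQu, hQ, he]
          field_simp
        have hx' : z • z⁻¹ • vmul x u + tau σ (z • z⁻¹ • vmul x u) = x := by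
          rw [hsum, hu, hone]
        refine ⟨⟨hQ', ?_⟩, hx'⟩
        have h1 := h.formQ_smul_add_tau (z⁻¹ • vmul x u) z
        rw [hx', hxA, hQ', hAdef] at h1
        have h3 : z * σ z * (formH q (z⁻¹ • vmul x u) - b) = 0 := by linear_combination -h1
        exact sub_eq_zero.1 ((mul_eq_zero.1 h3).resolve_left (mul_ne_zero hz hsz))
    · intro v _
      refine ⟨A⁻¹ • vmul (vadj x) (z • v), ?_⟩
      rw [vmul_smul, vmul_vadj_vmul, hxA, smul_smul, smul_smul, smul_smul]
      have h1 : z⁻¹ * (A⁻¹ * A) * z = 1 := by field_simp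
      rw [← mul_assoc] at h1
      rw [h1, one_smul]

/-- The size of a set of points given by a set `W` of values of the two forms. -/
theorem ncard_points (h : IsConj q σ) {S : Set (PG3 K)} {W : Set (K × K)} (n : ℕ)
    (hS : ∀ v hv, Projectivization.mk K v hv ∈ S ↔ (formQ v, formH q v) ∈ W)
    (hfix : ∀ p ∈ W, σ p.2 = p.2) (h0 : ∀ p ∈ W, p.1 ≠ 0 ∨ p.2 ≠ 0)
    (hn : ∀ p ∈ W, {s : K | σ s = s ∧ s ^ 2 = p.2 ^ 2 - 4 * (p.1 * σ p.1)}.ncard = n) :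
    S.ncard * (q ^ 2 - 1) = W.ncard * ((q + 1) * (q ^ 2 - q) * (n + (q - n) * (q + 1))) := by
  rw [← h.ncard_vectors hS]
  refine ncard_eq_ncard_mul_of_fibers (fun v => (formQ v, formH q v)) _ (fun v hv => hv.2) ?_
  rintro ⟨a, b⟩ hp
  rw [← hn _ hp, ← h.ncard_formQ_formH (hfix _ hp) (h0 _ hp)]
  congr 1
  ext v
  constructor
  · rintro ⟨-, hv⟩
    exact Prod.mk.inj hv
  · rintro ⟨rfl, rfl⟩
    refine ⟨⟨?_, hp⟩, rfl⟩
    rintro rfl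
    rcases h0 _ hp with h1 | h1
    · exact h1 (by simp [formQ])
    · exact h1 (by simp [formH])

theorem ncard_sqrt_zero (σ : K →+* K) : {s : K | σ s = s ∧ s ^ 2 = 0}.ncard = 1 := by
  have : {s : K | σ s = s ∧ s ^ 2 = 0} = {0} := by
    ext s
    simp only [Set.mem_ofPred_eq, Set.mem_singleton_iff]
    constructor
    · rintro ⟨-, hs⟩
      simpa using hs
    · rintro rfl
      simp
  rw [this, Set.ncard_singleton]

theorem ncard_sqrt_of_isNonzeroSquareFq (h : IsConj q σ) {d : K} (hd : IsNonzeroSquareFq q d) :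
    {s : K | σ s = s ∧ s ^ 2 = d}.ncard = 2 := by
  obtain ⟨t, ht, ht0, rfl⟩ := h.isNonzeroSquareFq_iff.1 hd
  have : {s : K | σ s = s ∧ s ^ 2 = t ^ 2} = {t, -t} := by
    ext a
    simp only [Set.mem_ofPred_eq, Set.mem_insert_iff, Set.mem_singleton_iff,
      sq_eq_sq_iff_eq_or_eq_neg]
    constructor
    · exact fun h' => h'.2
    · rintro (rfl | rfl)
      · simp [ht]
      · simp [ht]
  rw [this, Set.ncard_pair]
  intro h2
  apply mul_ne_zero h.two_ne_zero ht0
  linear_combination h2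

theorem ncard_sqrt_of_isNonsquareFq (h : IsConj q σ) {d : K} (hd : IsNonsquareFq q d) :
    {s : K | σ s = s ∧ s ^ 2 = d}.ncard = 0 := by
  rw [Set.ncard_eq_zero, Set.eq_empty_iff_forall_notMem]
  rintro s ⟨hs, hsd⟩
  exact (h.isNonsquareFq_iff.1 hd).2 ⟨s, hs, hsd.symm⟩

end IsConj
end

/-! ### Sizes of the sets in the list -/

section

variable {q : ℕ} {K : Type*} [Field K] [Finite K] {σ : K →+* K}

namespace IsConj

/-- Factorisations, free of subtraction, of the numbers that occur in the counts. -/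
theorem exists_arith (h : IsConj q σ) : ∃ k, q = 2 * k + 3 ∧ q - 1 = 2 * k + 2 ∧
    q ^ 2 - 1 = (2 * k + 2) * (2 * k + 4) ∧ q ^ 2 - q = (2 * k + 3) * (2 * k + 2) ∧
    q ^ 3 - q = (2 * k + 2) * (2 * k + 3) * (2 * k + 4) ∧ q - 2 = 2 * k + 1 ∧
    q ^ 4 - 2 * q ^ 3 + q ^ 2 = (2 * k + 3) ^ 2 * (2 * k + 2) ^ 2 := by
  have h3 := h.three_le
  obtain ⟨m, hm⟩ := h.odd
  obtain ⟨k, rfl⟩ : ∃ k, m = k + 1 := ⟨m - 1, by omega⟩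
  obtain rfl : q = 2 * k + 3 := by omega
  refine ⟨k, rfl, by omega, ?_, ?_, ?_, by omega, ?_⟩
  · rw [Nat.sub_eq_of_eq_add]
    ring
  · rw [Nat.sub_eq_of_eq_add]
    ring
  · rw [Nat.sub_eq_of_eq_add]
    ring
  · have : (2 * k + 3) ^ 4 - 2 * (2 * k + 3) ^ 3 = (2 * k + 3) ^ 3 * (2 * k + 1) := by
      rw [Nat.sub_eq_of_eq_add]
      ring
    rw [this]
    ring

/-- Every point of the subgeometry is spanned by `q - 1` fixed vectors of `tau`. -/
theorem ncard_fixed_vectors (h : IsConj q σ) {S : Set (PG3 K)} {p : (Fin 4 → K) → Prop}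
    (hS : ∀ v hv, Projectivization.mk K v hv ∈ S ↔ InSigma σ v ∧ p v)
    (hp : ∀ (c : K) v, c ≠ 0 → (p (c • v) ↔ p v)) :
    {v | tau σ v = v ∧ v ≠ 0 ∧ p v}.ncard = S.ncard * (q - 1) := by
  classical
  have he : (![1, 0, 0, 0] : Fin 4 → K) ≠ 0 := fun he => by
    have := congrFun he 0
    simp at this
  refine ncard_eq_ncard_mul_of_fibers (fun v => if hv : v ≠ 0 then Projectivization.mk K v hv else
    Projectivization.mk K _ he) _ ?_ ?_
  · rintro v ⟨ht, hv, hpv⟩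
    rw [dif_pos hv, hS]
    exact ⟨inSigma_of_tau_eq σ ht, hpv⟩
  · intro P hP
    induction P using Projectivization.ind with | _ v hv
    obtain ⟨⟨a, ha, hav⟩, hpv⟩ := (hS v hv).1 hP
    have hw := smul_ne_zero ha hv
    rw [← h.ncard_fixed_ne_zero, ← mk_smul_eq v hv hw]
    rw [← hp a v ha] at hpv
    generalize a • v = w at hw hpv hav
    refine ncard_eq_of_bij (fun c : K => c • w) (smul_left_injective K hw) ?_ ?_
    · intro c
      constructor
      · rintro ⟨⟨hct, hc, -⟩, -⟩
        have hc0 : c ≠ 0 := by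
          rintro rfl
          exact hc (zero_smul K _)
        rw [tau_smul, hav] at hct
        exact ⟨smul_left_injective K hw hct, hc0⟩
      · rintro ⟨hc, hc0⟩
        have hcw := smul_ne_zero hc0 hw
        refine ⟨⟨by rw [tau_smul, hav, hc], hcw, (hp c w hc0).2 hpv⟩, ?_⟩
        rw [dif_pos hcw, mk_smul_eq w hw]
    · rintro x ⟨⟨-, hx, -⟩, hxw⟩
      rw [dif_pos hx] at hxw
      exact (Projectivization.mk_eq_mk_iff' K _ _ hx hw).1 hxw

theorem ncard_sigmaTilde (h : IsConj q σ) : (sigmaTilde q K).ncard = q ^ 3 - q := by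
  have h1 := h.ncard_fixed_vectors (p := fun v => formQ v ≠ 0) h.mk_mem_sigmaTilde
    (fun c v hc => by simp [formQ_smul, hc])
  have h2 : {v : Fin 4 → K | tau σ v = v ∧ v ≠ 0 ∧ formQ v ≠ 0}.ncard =
      {a : K | σ a = a ∧ a ≠ 0}.ncard * ((q + 1) * (q ^ 2 - q)) := by
    refine ncard_eq_ncard_mul_of_fibers formQ _ (fun v hv => ⟨fixed_formQ hv.1, hv.2.2⟩) ?_
    rintro a ⟨ha, ha0⟩
    rw [← h.ncard_fixed_formQ ha ha0]
    congr 1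
    ext v
    constructor
    · rintro ⟨⟨ht, -⟩, hQ⟩
      exact ⟨ht, hQ⟩
    · rintro ⟨ht, rfl⟩
      refine ⟨⟨ht, ?_, ha0⟩, rfl⟩
      rintro rfl
      exact ha0 (by simp [formQ])
  rw [h1, h.ncard_fixed_ne_zero] at h2
  obtain ⟨k, hk, e1, e2, e3, e4, e5, e6⟩ := h.exists_arith
  rw [e1, e3] at h2
  rw [e4]
  apply Nat.eq_of_mul_eq_mul_right (show 0 < 2 * k + 2 by omega)
  rw [h2, hk]
  ring

theorem ncard_subquadric (h : IsConj q σ) : (subquadric q K).ncard = (q + 1) ^ 2 := by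
  have h1 := h.ncard_fixed_vectors (S := subquadric q K) (p := fun v => formQ v = 0)
    (fun v hv => by rw [h.mk_mem_subquadric, and_comm]) (fun c v hc => by simp [formQ_smul, hc])
  have h2 : {v : Fin 4 → K | tau σ v = v ∧ v ≠ 0 ∧ formQ v = 0}.ncard =
      {a : K | a ≠ 0}.ncard * (q + 1) := by
    have hcoord : ∀ v : Fin 4 → K, tau σ v = v → v = ![v 0, v 1, σ (v 1), σ (v 0)] := by
      intro v hv
      apply vec4_ext
      · simp
      · simp
      · exact (congrFun hv 2).symm
      · exact (congrFun hv 3).symm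
    refine ncard_eq_ncard_mul_of_fibers (fun v => v 0) _ ?_ ?_
    · rintro v ⟨ht, hv, hQ⟩ h0
      apply hv
      have h0 : v 0 = 0 := h0
      rw [hcoord v ht] at hQ ⊢
      have h1 : v 1 = 0 := by simpa [formQ, h0] using hQ
      apply vec4_ext <;> simp [h0, h1]
    · intro x hx
      have hx : x ≠ 0 := hx
      rw [← h.ncard_norm_eq (h.norm_fixed x) (mul_ne_zero hx (h.conj_ne_zero hx))]
      refine ncard_eq_of_bij (fun y => ![x, y, σ y, σ x]) ?_ ?_ ?_
      · intro y y' hy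
        exact congrFun hy 1
      · intro y
        constructor
        · rintro ⟨⟨-, -, hQ⟩, -⟩
          simp [formQ] at hQ
          change y * σ y = x * σ x
          linear_combination -hQ
        · intro hy
          have hy : y * σ y = x * σ x := hy
          refine ⟨⟨?_, ?_, ?_⟩, rfl⟩
          · apply vec4_ext <;> simp [tau, h.conj_conj]
          · intro h0
            exact hx (congrFun h0 0)
          · simp [formQ, hy]
      · rintro v ⟨⟨ht, -⟩, rfl⟩
        exact ⟨v 1, (hcoord v ht).symm⟩
  rw [h1, h.card_ne_zero_set] at h2
  obtain ⟨k, hk, e1, e2, e3, e4, e5, e6⟩ := h.exists_arith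
  rw [e1, e2] at h2
  apply Nat.eq_of_mul_eq_mul_right (show 0 < 2 * k + 2 by omega)
  rw [h2, hk]
  ring

theorem ncard_quadricTilde (h : IsConj q σ) :
    (quadricTilde q K).ncard = q ^ 4 - 2 * q ^ 3 + q ^ 2 := by
  have h1 := h.ncard_points (S := quadricTilde q K)
    (W := {p | p.1 = 0 ∧ σ p.2 = p.2 ∧ p.2 ≠ 0}) 2
    (fun v hv => by
      rw [h.mk_mem_quadricTilde]
      simp [h.conj_formH v])
    (fun p hp => hp.2.1) (fun p hp => Or.inr hp.2.2)
    (fun p hp => h.ncard_sqrt_of_isNonzeroSquareFq (h.isNonzeroSquareFq_iff.2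
      ⟨p.2, hp.2.1, hp.2.2, by rw [hp.1]; simp⟩))
  have h2 : {p : K × K | p.1 = 0 ∧ σ p.2 = p.2 ∧ p.2 ≠ 0}.ncard = q - 1 := by
    rw [← h.ncard_fixed_ne_zero]
    refine ncard_eq_of_bij (fun b => (0, b)) (fun b b' hb => (Prod.mk.inj hb).2)
      (fun b => ⟨fun hb => hb.2, fun hb => ⟨rfl, hb⟩⟩) ?_
    rintro ⟨a, b⟩ ⟨rfl, -⟩
    exact ⟨b, rfl⟩
  obtain ⟨k, hk, e1, e2, e3, e4, e5, e6⟩ := h.exists_arith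
  rw [h2, e1, e2, e3, e5] at h1
  rw [e6]
  apply Nat.eq_of_mul_eq_mul_right (show 0 < (2 * k + 2) * (2 * k + 4) by positivity)
  rw [h1, hk]
  ring

/-- The values of `formQ` for which the discriminant `-4 N(formQ)` satisfies a condition. -/
theorem ncard_formH_zero (h : IsConj q σ) {R : K → Prop} (hR : ∀ d, R d → σ d = d ∧ d ≠ 0) :
    {p : K × K | p.2 = 0 ∧ R (-4 * (p.1 * σ p.1))}.ncard = {d | R d}.ncard * (q + 1) := by
  have h2 := h.two_ne_zero
  have h4 := h.four_ne_zero
  refine ncard_eq_ncard_mul_of_fibers (fun p => -4 * (p.1 * σ p.1)) _ (fun p hp => hp.2) ?_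
  intro d hd
  obtain ⟨hd1, hd0⟩ := hR d hd
  rw [← h.ncard_norm_eq (a := -d / 4) (by rw [map_div₀, map_neg, hd1, map_ofNat])
    (div_ne_zero (neg_ne_zero.2 hd0) h4)]
  have he : ∀ a, a * σ a = -d / 4 ↔ -4 * (a * σ a) = d := by
    intro a
    rw [eq_div_iff h4]
    constructor
    · intro h1
      linear_combination -h1
    · intro h1
      linear_combination -h1
  refine ncard_eq_of_bij (fun a => (a, 0)) (fun b b' hb => (Prod.mk.inj hb).1) ?_ ?_
  · intro a
    constructor
    · rintro ⟨-, h1⟩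
      exact (he a).2 h1
    · intro h1
      have h1 := (he a).1 h1
      refine ⟨⟨rfl, ?_⟩, h1⟩
      change R (-4 * (a * σ a))
      rwa [h1]
  · rintro ⟨a, b⟩ ⟨⟨h1, -⟩, -⟩
    have h1 : b = 0 := h1
    exact ⟨a, by rw [h1]⟩

theorem isNonzeroSquareFq_fixed (h : IsConj q σ) {d : K} (hd : IsNonzeroSquareFq q d) :
    σ d = d ∧ d ≠ 0 := by
  obtain ⟨t, ht, ht0, rfl⟩ := h.isNonzeroSquareFq_iff.1 hd
  exact ⟨by rw [map_pow, ht], pow_ne_zero 2 ht0⟩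

theorem isNonsquareFq_fixed (h : IsConj q σ) {d : K} (hd : IsNonsquareFq q d) :
    σ d = d ∧ d ≠ 0 := by
  obtain ⟨h1, h2⟩ := h.isNonsquareFq_iff.1 hd
  refine ⟨h1, ?_⟩
  rintro rfl
  exact h2 ⟨0, by simp⟩

theorem isNonsquareFq_iff_not (h : IsConj q σ) {d : K} (hd : σ d = d) (hd0 : d ≠ 0) :
    IsNonsquareFq q d ↔ ¬ IsNonzeroSquareFq q d := by
  rw [h.isNonsquareFq_iff, h.isNonzeroSquareFq_iff, and_iff_right hd, not_iff_not]
  constructor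
  · rintro ⟨t, ht, rfl⟩
    exact ⟨t, ht, by rintro rfl; simp at hd0, rfl⟩
  · rintro ⟨t, ht, -, he⟩
    exact ⟨t, ht, he⟩

theorem ncard_setH1 (h : IsConj q σ) :
    (setH1 q K).ncard = (q + 1) * (q - 1) ^ 2 * q ^ 2 / 2 := by
  have h1 := h.ncard_points (S := setH1 q K)
    (W := {p | p.2 = 0 ∧ IsNonzeroSquareFq q (-4 * (p.1 * σ p.1))}) 2
    (fun v hv => by
      rw [h.mk_mem_setH1]
      change _ ↔ _ ∧ _
      refine and_congr_right fun _ => and_iff_right_of_imp fun h1 h0 => ?_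
      apply (h.isNonzeroSquareFq_fixed h1).2
      rw [h0]
      simp)
    (fun p hp => by rw [hp.1, map_zero])
    (fun p hp => Or.inl fun h0 => (h.isNonzeroSquareFq_fixed hp.2).2 (by rw [h0]; simp))
    (fun p hp => h.ncard_sqrt_of_isNonzeroSquareFq (by
      have := hp.2
      rw [hp.1]
      convert this using 1
      ring))
  rw [h.ncard_formH_zero fun d hd => h.isNonzeroSquareFq_fixed hd, h.ncard_isNonzeroSquareFq] at h1
  obtain ⟨k, hk, e1, e2, e3, e4, e5, e6⟩ := h.exists_arith
  have e7 : (q - 1) / 2 = k + 1 := by omega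
  rw [e7, e2, e3, e5, hk] at h1
  symm
  rw [e1, hk]
  apply Nat.div_eq_of_eq_mul_right (by norm_num)
  apply Nat.eq_of_mul_eq_mul_right (show 0 < (2 * k + 2) * (2 * k + 4) by positivity)
  rw [mul_assoc 2, h1]
  ring

theorem ncard_setH2 (h : IsConj q σ) :
    (setH2 q K).ncard = (q - 1) * q ^ 2 * (q + 1) ^ 2 / 2 := by
  have h1 := h.ncard_points (S := setH2 q K)
    (W := {p | p.2 = 0 ∧ IsNonsquareFq q (-4 * (p.1 * σ p.1))}) 0
    (fun v hv => by
      rw [h.mk_mem_setH2]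
      change _ ↔ _ ∧ _
      refine and_congr_right fun _ => ?_
      have h2 := h.two_ne_zero
      have hf : σ (-4 * (formQ v * σ (formQ v))) = -4 * (formQ v * σ (formQ v)) := by
        rw [map_mul, h.norm_fixed, map_neg, map_ofNat]
      constructor
      · rintro ⟨hQ, hn⟩
        refine (h.isNonsquareFq_iff_not hf ?_).2 hn
        have : (-4 : K) = -(2 * 2) := by norm_num
        rw [this]
        exact mul_ne_zero (neg_ne_zero.2 (mul_ne_zero h2 h2)) (mul_ne_zero hQ (h.conj_ne_zero hQ))
      · intro hn
        have h0 := (h.isNonsquareFq_fixed hn).2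
        exact ⟨fun hQ => h0 (by rw [hQ]; simp), (h.isNonsquareFq_iff_not hf h0).1 hn⟩)
    (fun p hp => by rw [hp.1, map_zero])
    (fun p hp => Or.inl fun h0 => (h.isNonsquareFq_fixed hp.2).2 (by rw [h0]; simp))
    (fun p hp => h.ncard_sqrt_of_isNonsquareFq (by
      have := hp.2
      rw [hp.1]
      convert this using 1
      ring))
  rw [h.ncard_formH_zero fun d hd => h.isNonsquareFq_fixed hd, h.ncard_isNonsquareFq] at h1
  obtain ⟨k, hk, e1, e2, e3, e4, e5, e6⟩ := h.exists_arith
  have e7 : (q - 1) / 2 = k + 1 := by omega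
  rw [e7, e2, e3, hk] at h1
  symm
  rw [e1, hk]
  apply Nat.div_eq_of_eq_mul_right (by norm_num)
  apply Nat.eq_of_mul_eq_mul_right (show 0 < (2 * k + 2) * (2 * k + 4) by positivity)
  rw [mul_assoc 2, h1, Nat.sub_zero]
  ring

/-- The size of `S̃_ξ ∪ S̃_{-ξ}`, where `n` is the number of square roots in the subfield of the
discriminant, which is `1 - 1 / ξ ^ 2` times the square of the value of `formH`. -/
theorem ncard_surface_union (h : IsConj q σ) {ξ : K} (hξ0 : ξ ≠ 0) (hξ : σ (ξ ^ 2) = ξ ^ 2)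
    (n : ℕ) (hn : ∀ b, σ b = b → b ≠ 0 →
      {s : K | σ s = s ∧ s ^ 2 = b ^ 2 * (1 - 1 / ξ ^ 2)}.ncard = n) :
    (surfaceTilde q ξ ∪ surfaceTilde q (-ξ)).ncard =
      (q + 1) * (q ^ 2 - q) * (n + (q - n) * (q + 1)) := by
  have h2 := h.two_ne_zero
  have h4 := h.four_ne_zero
  have h1 := h.ncard_points (S := surfaceTilde q ξ ∪ surfaceTilde q (-ξ))
    (W := {p | (σ p.2 = p.2 ∧ p.2 ≠ 0) ∧ p.2 ^ 2 = 4 * ξ ^ 2 * (p.1 * σ p.1)}) n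
    (fun v hv => by
      rw [h.mk_mem_surfaceTilde_union]
      change _ ↔ (_ ∧ _) ∧ _
      rw [and_iff_right (h.conj_formH v)])
    (fun p hp => hp.1.1) (fun p hp => Or.inr hp.1.2) (fun p hp => by
      rw [← hn p.2 hp.1.1 hp.1.2]
      congr! 5
      field_simp
      linear_combination hp.2)
  have h3 : {p : K × K | (σ p.2 = p.2 ∧ p.2 ≠ 0) ∧ p.2 ^ 2 = 4 * ξ ^ 2 * (p.1 * σ p.1)}.ncard =
      {b : K | σ b = b ∧ b ≠ 0}.ncard * (q + 1) := by
    refine ncard_eq_ncard_mul_of_fibers (fun p => p.2) _ (fun p hp => hp.1) ?_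
    rintro b ⟨hb, hb0⟩
    have h5 : 4 * ξ ^ 2 ≠ 0 := mul_ne_zero h4 (pow_ne_zero 2 hξ0)
    rw [← h.ncard_norm_eq (a := b ^ 2 / (4 * ξ ^ 2))
      (by rw [map_div₀, map_mul, hξ, map_pow, hb, map_ofNat])
      (div_ne_zero (pow_ne_zero 2 hb0) h5)]
    refine ncard_eq_of_bij (fun a => (a, b)) (fun b b' hb => (Prod.mk.inj hb).1) ?_ ?_
    · intro a
      constructor
      · rintro ⟨⟨-, h6⟩, -⟩
        change a * σ a = b ^ 2 / (4 * ξ ^ 2)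
        rw [eq_div_iff h5]
        linear_combination -h6
      · intro h6
        have h6 : a * σ a = b ^ 2 / (4 * ξ ^ 2) := h6
        rw [eq_div_iff h5] at h6
        refine ⟨⟨⟨hb, hb0⟩, ?_⟩, rfl⟩
        change b ^ 2 = 4 * ξ ^ 2 * (a * σ a)
        linear_combination -h6
    · rintro ⟨a, b'⟩ ⟨-, rfl⟩
      exact ⟨a, rfl⟩
  rw [h3, h.ncard_fixed_ne_zero] at h1
  obtain ⟨k, hk, e1, e2, e3, e4, e5, e6⟩ := h.exists_arith
  have e8 : (q - 1) * (q + 1) = q ^ 2 - 1 := by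
    rw [e1, e2, hk]
  rw [e8, mul_comm (q ^ 2 - 1)] at h1
  exact Nat.eq_of_mul_eq_mul_right (by rw [e2]; positivity) h1

theorem conj_sq_of_conj_sub {ξ : K} (hξ : σ (1 - 1 / ξ ^ 2) = 1 - 1 / ξ ^ 2) :
    σ (ξ ^ 2) = ξ ^ 2 := by
  rw [map_sub, map_div₀, map_one] at hξ
  have h1 := sub_right_injective hξ
  rw [one_div, one_div] at h1
  exact inv_injective h1

theorem ncard_surface_of_isNonzeroSquareFq (h : IsConj q σ) {ξ : K} (hξ0 : ξ ≠ 0)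
    (hξ : IsNonzeroSquareFq q (1 - 1 / ξ ^ 2)) :
    (surfaceTilde q ξ ∪ surfaceTilde q (-ξ)).ncard = (q + 1) * (q - 1) ^ 2 * q ^ 2 := by
  rw [h.ncard_surface_union hξ0 (conj_sq_of_conj_sub (h.isNonzeroSquareFq_fixed hξ).1) 2
    fun b hb hb0 => h.ncard_sqrt_of_isNonzeroSquareFq ((h.isNonzeroSquareFq_scale hb hb0).2 hξ)]
  obtain ⟨k, hk, e1, e2, e3, e4, e5, e6⟩ := h.exists_arith
  rw [e1, e3, e5, hk]
  ring

theorem ncard_surface_of_isNonsquareFq (h : IsConj q σ) {ξ : K} (hξ0 : ξ ≠ 0)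
    (hξ : IsNonsquareFq q (1 - 1 / ξ ^ 2)) :
    (surfaceTilde q ξ ∪ surfaceTilde q (-ξ)).ncard = (q - 1) * q ^ 2 * (q + 1) ^ 2 := by
  obtain ⟨h1, h2⟩ := h.isNonsquareFq_fixed hξ
  rw [h.ncard_surface_union hξ0 (conj_sq_of_conj_sub h1) 0 fun b hb hb0 =>
    h.ncard_sqrt_of_isNonsquareFq ((h.isNonsquareFq_iff_not (by rw [map_mul, h1, map_pow, hb])
      (mul_ne_zero (pow_ne_zero 2 hb0) h2)).2 (by
        rw [h.isNonzeroSquareFq_scale hb hb0]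
        exact (h.isNonsquareFq_iff_not h1 h2).1 hξ))]
  obtain ⟨k, hk, e1, e2, e3, e4, e5, e6⟩ := h.exists_arith
  rw [e1, e3, hk, Nat.sub_zero]
  ring

/-- The set `S̃_1 ∪ S̃_{-1}` is the disjoint union of `Σ̃` and `𝒟̃`. -/
theorem ncard_setDTilde (h : IsConj q σ) : (setDTilde q K).ncard = q * (q ^ 2 - 1) ^ 2 := by
  have h1 := h.ncard_surface_union (ξ := 1) one_ne_zero (by simp) 1 fun b _ _ => by
    rw [← ncard_sqrt_zero σ]
    simp
  have h2 : surfaceTilde q (1 : K) ∪ surfaceTilde q (-1) = sigmaTilde q K ∪ setDTilde q K := by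
    ext P
    induction P using Projectivization.ind with | _ v hv
    rw [h.mk_mem_surfaceTilde_union, Set.mem_union, h.mk_mem_sigmaTilde, h.mk_mem_setDTilde]
    constructor
    · rintro ⟨hH, he⟩
      by_cases hS : InSigma σ v
      · left
        refine ⟨hS, fun hQ => hH ?_⟩
        rw [hQ] at he
        simpa using he
      · right
        refine ⟨hH, ?_, hS⟩
        linear_combination he
    · rintro (⟨hS, hQ⟩ | ⟨hH, he, -⟩)
      · refine ⟨h.formH_ne_zero_of_inSigma hS hQ, ?_⟩
        linear_combination h.formH_sq_of_inSigma hS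
      · exact ⟨hH, by linear_combination he⟩
  have h3 : Disjoint (sigmaTilde q K) (setDTilde q K) := by
    rw [Set.disjoint_left]
    intro P
    induction P using Projectivization.ind with | _ v hv
    rw [h.mk_mem_sigmaTilde, h.mk_mem_setDTilde]
    exact fun h1 h2 => h2.2.2 h1.1
  rw [h2, Set.ncard_union_eq h3, h.ncard_sigmaTilde] at h1
  obtain ⟨k, hk, e1, e2, e3, e4, e5, e6⟩ := h.exists_arith
  rw [e1, e3, e4, hk] at h1
  rw [e2, hk]
  have h5 : (2 * k + 3) * ((2 * k + 2) * (2 * k + 4)) ^ 2 +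
      (2 * k + 2) * (2 * k + 3) * (2 * k + 4) =
      (2 * k + 3 + 1) * ((2 * k + 3) * (2 * k + 2)) * (1 + (2 * k + 2) * (2 * k + 3 + 1)) := by
    ring
  omega

theorem ncard_formQ_eq_zero (h : IsConj q σ) :
    {v : Fin 4 → K | v ≠ 0 ∧ formQ v = 0}.ncard = ((q ^ 2) ^ 2 - 1) * (q ^ 2 + 1) := by
  have hsplit : {v : Fin 4 → K | v ≠ 0 ∧ formQ v = 0} =
      {v | formQ v = 0 ∧ (v 0, v 1) ≠ 0} ∪ {v | (v 2, v 3) ≠ 0 ∧ (v 0, v 1) = 0} := by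
    ext v
    simp only [Set.mem_ofPred_eq, Set.mem_union]
    constructor
    · rintro ⟨hv, hQ⟩
      by_cases h0 : (v 0, v 1) = 0
      · right
        refine ⟨fun h1 => hv ?_, h0⟩
        simp only [Prod.mk_eq_zero] at h0 h1
        apply vec4_ext <;> simp [h0, h1]
      · exact Or.inl ⟨hQ, h0⟩
    · rintro (⟨hQ, h0⟩ | ⟨h1, h0⟩)
      · exact ⟨by rintro rfl; exact h0 rfl, hQ⟩
      · refine ⟨by rintro rfl; exact h1 rfl, ?_⟩
        simp only [Prod.mk_eq_zero] at h0
        simp [formQ, h0]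
  have hdisj : Disjoint {v : Fin 4 → K | formQ v = 0 ∧ (v 0, v 1) ≠ 0}
      {v | (v 2, v 3) ≠ 0 ∧ (v 0, v 1) = 0} := by
    rw [Set.disjoint_left]
    exact fun v hv hv' => hv.2 hv'.2
  have hcard : {p : K × K | p ≠ 0}.ncard = (q ^ 2) ^ 2 - 1 := by
    rw [ncard_ne_zero, Nat.card_prod, h.card, sq (q ^ 2)]
  have h1 : {v : Fin 4 → K | (v 2, v 3) ≠ 0 ∧ (v 0, v 1) = 0}.ncard = (q ^ 2) ^ 2 - 1 := by
    rw [← hcard]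
    refine (ncard_eq_ncard_mul_of_fibers (t := {p : K × K | p ≠ 0}) (fun v => (v 2, v 3)) 1
      (fun v hv => hv.1) ?_).trans (mul_one _)
    rintro ⟨a, b⟩ hp
    rw [Set.ncard_eq_one]
    refine ⟨![0, 0, a, b], ?_⟩
    ext v
    constructor
    · rintro ⟨⟨-, h0⟩, h1⟩
      simp only [Prod.mk_eq_zero, Prod.mk.injEq] at h0 h1
      apply vec4_ext <;> simp [h0, h1]
    · rintro rfl
      exact ⟨⟨hp, by simp⟩, by simp⟩
  have h2 : {v : Fin 4 → K | formQ v = 0 ∧ (v 0, v 1) ≠ 0}.ncard =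
      {p : K × K | p ≠ 0}.ncard * q ^ 2 := by
    refine ncard_eq_ncard_mul_of_fibers (fun v : Fin 4 → K => (v 0, v 1)) _
      (fun v hv => hv.2) ?_
    rintro ⟨a, b⟩ hp
    have hp : (a, b) ≠ 0 := hp
    rw [← h.card, ← Set.ncard_univ]
    -- the second row is a multiple of the nonzero first row
    refine ncard_eq_of_bij (fun t : K => ![a, b, t * a, t * b]) ?_ ?_ ?_
    · intro t t' htt
      have h2 := congrFun htt 2
      have h3 := congrFun htt 3
      simp at h2 h3
      rcases h2 with h2 | h2
      · exact h2
      · rcases h3 with h3 | h3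
        · exact h3
        · exact absurd (by rw [h2, h3]; rfl) hp
    · intro t
      refine iff_of_true ⟨⟨?_, hp⟩, rfl⟩ (Set.mem_univ t)
      simp [formQ]
      ring
    · rintro v ⟨⟨hQ, -⟩, hab⟩
      obtain ⟨rfl, rfl⟩ := Prod.mk.inj hab
      simp only [formQ] at hQ
      by_cases h0 : v 0 = 0
      · have h1 : v 1 ≠ 0 := fun h1 => hp (by rw [h0, h1]; rfl)
        have h2 : v 2 = 0 := by
          rw [h0, zero_mul, zero_sub, neg_eq_zero] at hQ
          exact (mul_eq_zero.1 hQ).resolve_left h1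
        exact ⟨v 3 / v 1, by apply vec4_ext <;> simp [h0, h1, h2]⟩
      · refine ⟨v 2 / v 0, ?_⟩
        apply vec4_ext
        · simp
        · simp
        · simp [h0]
        · simp
          field_simp
          linear_combination -hQ
  rw [hsplit, Set.ncard_union_eq hdisj, h1, h2, hcard]
  ring

theorem ncard_quadric (h : IsConj q σ) : (quadric K).ncard = (q ^ 2 + 1) ^ 2 := by
  have h1 := h.ncard_vectors (S := quadric K) mk_mem_quadric
  rw [h.ncard_formQ_eq_zero] at h1
  have h2 : (q ^ 2) ^ 2 - 1 = (q ^ 2 + 1) * (q ^ 2 - 1) := by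
    have := Nat.sq_sub_sq (q ^ 2) 1
    simpa using this
  obtain ⟨k, hk, e1, e2, e3, e4, e5, e6⟩ := h.exists_arith
  apply Nat.eq_of_mul_eq_mul_right (show 0 < q ^ 2 - 1 by rw [e2]; positivity)
  rw [← h1, h2]
  ring

/-- The quadric is the disjoint union of `𝒬₀`, `𝒯` and `𝒬̃`. -/
theorem ncard_setT (h : IsConj q σ) : (setT q K).ncard = 2 * (q + 1) * (q ^ 2 - q) := by
  have h1 : quadric K = (subquadric q K ∪ setT q K) ∪ quadricTilde q K := by
    ext P
    induction P using Projectivization.ind with | _ v hv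
    rw [Set.mem_union, Set.mem_union, h.mk_mem_subquadric, h.mk_mem_setT, h.mk_mem_quadricTilde,
      mk_mem_quadric]
    have h2 : formQ v = 0 → InSigma σ v → formH q v = 0 := by
      intro hQ hS
      have := h.formH_sq_of_inSigma hS
      rw [hQ] at this
      simpa using this
    tauto
  have h2 : Disjoint (subquadric q K) (setT q K) := by
    rw [Set.disjoint_left]
    intro P
    induction P using Projectivization.ind with | _ v hv
    rw [h.mk_mem_subquadric, h.mk_mem_setT]
    tauto
  have h3 : Disjoint (subquadric q K ∪ setT q K) (quadricTilde q K) := by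
    rw [Set.disjoint_left]
    intro P
    induction P using Projectivization.ind with | _ v hv
    rw [Set.mem_union, h.mk_mem_subquadric, h.mk_mem_setT, h.mk_mem_quadricTilde]
    rintro (⟨hQ, hS⟩ | ⟨-, hH, -⟩) ⟨-, hH'⟩
    · have := h.formH_sq_of_inSigma hS
      rw [hQ] at this
      exact hH' (by simpa using this)
    · exact hH' hH
  have h4 := congrArg Set.ncard h1
  rw [Set.ncard_union_eq h3, Set.ncard_union_eq h2, h.ncard_quadric, h.ncard_subquadric,
    h.ncard_quadricTilde] at h4
  obtain ⟨k, hk, e1, e2, e3, e4, e5, e6⟩ := h.exists_arith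
  rw [e6, hk] at h4
  rw [e3, hk]
  have h5 : ((2 * k + 3) ^ 2 + 1) ^ 2 = (2 * k + 3 + 1) ^ 2 +
      2 * (2 * k + 3 + 1) * ((2 * k + 3) * (2 * k + 2)) + (2 * k + 3) ^ 2 * (2 * k + 2) ^ 2 := by
    ring
  omega

end IsConj
end

/-! ### Completeness and distinctness -/

section

variable {q : ℕ} {K : Type*} [Field K] [Finite K] {σ : K →+* K}

open Classical in
/-- A label of points which takes different values on the sets in the list of orbits, except that
all members of either of the two families of surfaces share one label. -/
noncomputable def label (q : ℕ) (σ : K →+* K) (v : Fin 4 → K) : ℕ :=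
  if formQ v = 0 then
    if formH q v = 0 then if InSigma σ v then 0 else 2
    else 3
  else if formH q v = 0 then
    if IsNonzeroSquareFq q (-4 * (formQ v * σ (formQ v))) then 5 else 6
  else if InSigma σ v then 1
  else if formH q v ^ 2 = 4 * (formQ v * σ (formQ v)) then 4
  else if IsNonzeroSquareFq q (formH q v ^ 2 - 4 * (formQ v * σ (formQ v))) then 7 else 8

/-- The set `A` is nonempty, and its points have the label `i`. -/
def HasLabel (q : ℕ) (σ : K →+* K) (A : Set (PG3 K)) (i : ℕ) : Prop :=
  A.Nonempty ∧ ∀ v hv, Projectivization.mk K v hv ∈ A → label q σ v = i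

theorem HasLabel.eq {A : Set (PG3 K)} {i j : ℕ} (hi : HasLabel q σ A i)
    (hj : HasLabel q σ A j) : i = j := by
  obtain ⟨⟨P, hP⟩, hi⟩ := hi
  induction P using Projectivization.ind with | _ v hv
  rw [← hi v hv hP, ← hj.2 v hv hP]

/-- The seven orbits outside the two families. -/
def sevenOrbits (q : ℕ) (K : Type*) [Field K] : Fin 7 → Set (PG3 K) :=
  ![subquadric q K, sigmaTilde q K, setT q K, quadricTilde q K, setDTilde q K, setH1 q K,
    setH2 q K]

theorem range_sevenOrbits : Set.range (sevenOrbits q K) =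
    {subquadric q K, sigmaTilde q K, setT q K, quadricTilde q K, setDTilde q K, setH1 q K,
      setH2 q K} := by
  simp only [sevenOrbits, Matrix.range_cons, Matrix.range_empty, Set.union_empty,
    Set.singleton_union]

namespace IsConj

theorem nonempty_of_ncard_eq {A : Set (PG3 K)} {n : ℕ} (hA : A.ncard = n) (hn : 0 < n) :
    A.Nonempty := by
  rwa [← Set.ncard_pos, hA]

theorem hasLabel_subquadric (h : IsConj q σ) : HasLabel q σ (subquadric q K) 0 := by
  refine ⟨nonempty_of_ncard_eq h.ncard_subquadric (by positivity), fun v hv hP => ?_⟩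
  obtain ⟨hQ, hS⟩ := (h.mk_mem_subquadric v hv).1 hP
  have hH : formH q v = 0 := by
    have := h.formH_sq_of_inSigma hS
    rw [hQ] at this
    simpa using this
  simp [label, hQ, hH, hS]

theorem hasLabel_sigmaTilde (h : IsConj q σ) : HasLabel q σ (sigmaTilde q K) 1 := by
  obtain ⟨k, hk, e1, e2, e3, e4, e5, e6⟩ := h.exists_arith
  refine ⟨nonempty_of_ncard_eq (h.ncard_sigmaTilde.trans e4) (by positivity), fun v hv hP => ?_⟩
  obtain ⟨hS, hQ⟩ := (h.mk_mem_sigmaTilde v hv).1 hP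
  simp [label, hQ, hS, h.formH_ne_zero_of_inSigma hS hQ]

theorem hasLabel_setT (h : IsConj q σ) : HasLabel q σ (setT q K) 2 := by
  obtain ⟨k, hk, e1, e2, e3, e4, e5, e6⟩ := h.exists_arith
  refine ⟨nonempty_of_ncard_eq h.ncard_setT (by rw [e3]; positivity), fun v hv hP => ?_⟩
  obtain ⟨hQ, hH, hS⟩ := (h.mk_mem_setT v hv).1 hP
  simp [label, hQ, hS, hH]

theorem hasLabel_quadricTilde (h : IsConj q σ) : HasLabel q σ (quadricTilde q K) 3 := by
  obtain ⟨k, hk, e1, e2, e3, e4, e5, e6⟩ := h.exists_arith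
  refine ⟨nonempty_of_ncard_eq (h.ncard_quadricTilde.trans e6) (by positivity), fun v hv hP => ?_⟩
  obtain ⟨hQ, hH⟩ := (h.mk_mem_quadricTilde v hv).1 hP
  simp [label, hQ, hH]

theorem formQ_ne_zero_of_sq_eq {v : Fin 4 → K} {c : K} (hH : formH q v ≠ 0)
    (he : formH q v ^ 2 = c * (formQ v * σ (formQ v))) : formQ v ≠ 0 := by
  intro hQ
  rw [hQ] at he
  exact hH (by simpa using he)

theorem hasLabel_setDTilde (h : IsConj q σ) : HasLabel q σ (setDTilde q K) 4 := by
  obtain ⟨k, hk, e1, e2, e3, e4, e5, e6⟩ := h.exists_arith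
  refine ⟨nonempty_of_ncard_eq h.ncard_setDTilde (by rw [e2, hk]; positivity), fun v hv hP => ?_⟩
  obtain ⟨hH, he, hS⟩ := (h.mk_mem_setDTilde v hv).1 hP
  simp [label, formQ_ne_zero_of_sq_eq hH he, hH, hS, he]

theorem hasLabel_setH1 (h : IsConj q σ) : HasLabel q σ (setH1 q K) 5 := by
  obtain ⟨k, hk, e1, e2, e3, e4, e5, e6⟩ := h.exists_arith
  refine ⟨nonempty_of_ncard_eq h.ncard_setH1 (by
    rw [e1, hk]
    have : (2 * k + 3 + 1) * (2 * k + 2) ^ 2 * (2 * k + 3) ^ 2 / 2 =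
        (k + 2) * (2 * k + 2) ^ 2 * (2 * k + 3) ^ 2 :=
      Nat.div_eq_of_eq_mul_right (by norm_num) (by ring)
    rw [this]
    positivity), fun v hv hP => ?_⟩
  obtain ⟨hH, hQ, hs⟩ := (h.mk_mem_setH1 v hv).1 hP
  simp only [label, if_neg hQ, if_pos hH, if_pos hs]

theorem hasLabel_setH2 (h : IsConj q σ) : HasLabel q σ (setH2 q K) 6 := by
  obtain ⟨k, hk, e1, e2, e3, e4, e5, e6⟩ := h.exists_arith
  refine ⟨nonempty_of_ncard_eq h.ncard_setH2 (by
    rw [e1, hk]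
    have : (2 * k + 2) * (2 * k + 3) ^ 2 * (2 * k + 3 + 1) ^ 2 / 2 =
        (k + 1) * (2 * k + 3) ^ 2 * (2 * k + 3 + 1) ^ 2 :=
      Nat.div_eq_of_eq_mul_right (by norm_num) (by ring)
    rw [this]
    positivity), fun v hv hP => ?_⟩
  obtain ⟨hH, hQ, hs⟩ := (h.mk_mem_setH2 v hv).1 hP
  simp only [label, if_neg hQ, if_pos hH, if_neg hs]

/-- For `ξ = 1` and `ξ = -1` the number `1 - 1 / ξ ^ 2` is zero, so these exclusions are automatic.
-/
theorem paramZ1_eq (h : IsConj q σ) :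
    paramZ1 q K = {ξ | ξ ≠ 0 ∧ IsNonzeroSquareFq q (1 - 1 / ξ ^ 2)} := by
  ext ξ
  refine ⟨fun hξ => ⟨hξ.1, hξ.2.2.2⟩, fun hξ => ⟨hξ.1, ?_, ?_, hξ.2⟩⟩
  · rintro rfl
    exact (h.isNonzeroSquareFq_fixed hξ.2).2 (by simp)
  · rintro rfl
    exact (h.isNonzeroSquareFq_fixed hξ.2).2 (by simp)

/-- The value of the label on a surface of either family. -/
theorem label_of_mem_surface (h : IsConj q σ) {ξ : K} (hξ0 : ξ ≠ 0) (hξ : 1 - 1 / ξ ^ 2 ≠ 0)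
    {v : Fin 4 → K} {hv : v ≠ 0}
    (hP : Projectivization.mk K v hv ∈ surfaceTilde q ξ ∪ surfaceTilde q (-ξ)) :
    (IsNonzeroSquareFq q (1 - 1 / ξ ^ 2) → label q σ v = 7) ∧
      (¬ IsNonzeroSquareFq q (1 - 1 / ξ ^ 2) → label q σ v = 8) := by
  obtain ⟨hH, he⟩ := (h.mk_mem_surfaceTilde_union ξ v hv).1 hP
  have hQ := formQ_ne_zero_of_sq_eq hH he
  have hd : formH q v ^ 2 - 4 * (formQ v * σ (formQ v)) = formH q v ^ 2 * (1 - 1 / ξ ^ 2) := by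
    field_simp
    linear_combination he
  have hne : ¬ formH q v ^ 2 = 4 * (formQ v * σ (formQ v)) := by
    rw [← sub_eq_zero, hd]
    exact mul_ne_zero (pow_ne_zero 2 hH) hξ
  have hsq := h.isNonzeroSquareFq_scale (x := 1 - 1 / ξ ^ 2) (h.conj_formH v) hH
  constructor
  · intro hs
    rw [← hsq, ← hd] at hs
    simp only [label, if_neg hQ, if_neg hH, if_neg (h.not_inSigma_of_ne hne), if_neg hne, if_pos hs]
  · intro hs
    rw [← hsq, ← hd] at hs
    simp only [label, if_neg hQ, if_neg hH, if_neg (h.not_inSigma_of_ne hne), if_neg hne, if_neg hs]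

theorem hasLabel_surface_of_mem_paramZ1 (h : IsConj q σ) {ξ : K} (hξ : ξ ∈ paramZ1 q K) :
    HasLabel q σ (surfaceTilde q ξ ∪ surfaceTilde q (-ξ)) 7 := by
  obtain ⟨k, hk, e1, e2, e3, e4, e5, e6⟩ := h.exists_arith
  rw [h.paramZ1_eq] at hξ
  exact ⟨nonempty_of_ncard_eq (h.ncard_surface_of_isNonzeroSquareFq hξ.1 hξ.2)
    (by rw [e1, hk]; positivity), fun v hv hP =>
    (h.label_of_mem_surface hξ.1 (h.isNonzeroSquareFq_fixed hξ.2).2 hP).1 hξ.2⟩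

theorem hasLabel_surface_of_mem_paramZ2 (h : IsConj q σ) {ξ : K} (hξ : ξ ∈ paramZ2 q K) :
    HasLabel q σ (surfaceTilde q ξ ∪ surfaceTilde q (-ξ)) 8 := by
  obtain ⟨k, hk, e1, e2, e3, e4, e5, e6⟩ := h.exists_arith
  obtain ⟨h1, h2⟩ := h.isNonsquareFq_fixed hξ.2
  exact ⟨nonempty_of_ncard_eq (h.ncard_surface_of_isNonsquareFq hξ.1 hξ.2)
    (by rw [e1, hk]; positivity), fun v hv hP =>
    (h.label_of_mem_surface hξ.1 h2 hP).2 ((h.isNonsquareFq_iff_not h1 h2).1 hξ.2)⟩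

/-- Both `ξ ↦ 1 - 1 / ξ ^ 2` and `ξ ↦ S̃_ξ ∪ S̃_{-ξ}` identify `ξ` with `-ξ` only. -/
theorem ncard_surfacePairs (h : IsConj q σ) {R : K → Prop} (hR : ∀ d, R d → σ d = d)
    (hne : ∀ ξ : K, ξ ≠ 0 → R (1 - 1 / ξ ^ 2) →
      (surfaceTilde q ξ ∪ surfaceTilde q (-ξ)).Nonempty) :
    (surfacePairs q {ξ : K | ξ ≠ 0 ∧ R (1 - 1 / ξ ^ 2)}).ncard = {d : K | R d ∧ d ≠ 1}.ncard := by
  have h2 := h.two_ne_zero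
  have h4 := h.four_ne_zero
  have hpair : ∀ ξ : K, ξ ≠ 0 → ({ξ, -ξ} : Set K).ncard = 2 := by
    intro ξ hξ
    rw [Set.ncard_pair]
    intro h3
    apply mul_ne_zero h2 hξ
    linear_combination h3
  have h1 : {ξ : K | ξ ≠ 0 ∧ R (1 - 1 / ξ ^ 2)}.ncard =
      (surfacePairs q {ξ : K | ξ ≠ 0 ∧ R (1 - 1 / ξ ^ 2)}).ncard * 2 := by
    -- the value of `ξ ^ 2` is recovered from any point of the surface
    refine ncard_eq_ncard_mul_of_fibers (fun ξ => surfaceTilde q ξ ∪ surfaceTilde q (-ξ)) 2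
      (fun ξ hξ => ⟨ξ, hξ, rfl⟩) ?_
    rintro _ ⟨ξ, ⟨hξ0, hξ⟩, rfl⟩
    refine Eq.trans (congrArg Set.ncard ?_) (hpair ξ hξ0)
    ext x
    rw [Set.mem_insert_iff, Set.mem_singleton_iff]
    constructor
    · rintro ⟨⟨hx0, hx⟩, he⟩
      obtain ⟨P, hP⟩ := hne ξ hξ0 hξ
      induction P using Projectivization.ind with | _ v hv
      have hP' : Projectivization.mk K v hv ∈ surfaceTilde q x ∪ surfaceTilde q (-x) := by
        have he : surfaceTilde q x ∪ surfaceTilde q (-x) = _ := he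
        rw [he]
        exact hP
      rw [h.mk_mem_surfaceTilde_union] at hP hP'
      have hQ := formQ_ne_zero_of_sq_eq hP.1 hP.2
      have h5 : (4 * (formQ v * σ (formQ v))) * (x ^ 2 - ξ ^ 2) = 0 := by
        linear_combination hP.2 - hP'.2
      have h6 := (mul_eq_zero.1 h5).resolve_left
        (mul_ne_zero h4 (mul_ne_zero hQ (h.conj_ne_zero hQ)))
      exact sq_eq_sq_iff_eq_or_eq_neg.1 (sub_eq_zero.1 h6)
    · rintro (rfl | rfl)
      · exact ⟨⟨hξ0, hξ⟩, rfl⟩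
      · refine ⟨⟨neg_ne_zero.2 hξ0, by rwa [neg_sq]⟩, ?_⟩
        rw [neg_neg, Set.union_comm]
  have h3 : {ξ : K | ξ ≠ 0 ∧ R (1 - 1 / ξ ^ 2)}.ncard = {d : K | R d ∧ d ≠ 1}.ncard * 2 := by
    refine ncard_eq_ncard_mul_of_fibers (fun ξ => 1 - 1 / ξ ^ 2) 2 ?_ ?_
    · rintro ξ ⟨hξ0, hξ⟩
      refine ⟨hξ, fun h5 => ?_⟩
      have h6 : 1 / ξ ^ 2 = 0 := by
        have h5 : 1 - 1 / ξ ^ 2 = 1 := h5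
        linear_combination -h5
      exact div_ne_zero one_ne_zero (pow_ne_zero 2 hξ0) h6
    · rintro d ⟨hd, hd1⟩
      have hd1' : 1 - d ≠ 0 := sub_ne_zero.2 (Ne.symm hd1)
      obtain ⟨ξ, hξ⟩ := h.isSquare_of_fixed (a := (1 - d)⁻¹)
        (by rw [map_inv₀, map_sub, map_one, hR d hd])
      have hξ0 : ξ ≠ 0 := by
        rintro rfl
        exact inv_ne_zero hd1' (by rw [hξ, mul_zero])
      have hξd : 1 - 1 / ξ ^ 2 = d := by
        rw [sq, ← hξ, one_div, inv_inv]
        ring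
      refine Eq.trans (congrArg Set.ncard ?_) (hpair ξ hξ0)
      ext x
      rw [Set.mem_insert_iff, Set.mem_singleton_iff]
      constructor
      · rintro ⟨⟨hx0, hx⟩, he⟩
        have he : 1 - 1 / x ^ 2 = d := he
        rw [← hξd] at he
        have h5 := sub_right_injective he
        rw [one_div, one_div] at h5
        exact sq_eq_sq_iff_eq_or_eq_neg.1 (inv_injective h5)
      · rintro (rfl | rfl)
        · exact ⟨⟨hξ0, by rwa [hξd]⟩, hξd⟩
        · refine ⟨⟨neg_ne_zero.2 hξ0, by rwa [neg_sq, hξd]⟩, ?_⟩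
          rw [neg_sq, hξd]
  omega

theorem ncard_surfacePairs_paramZ1 (h : IsConj q σ) :
    (surfacePairs q (paramZ1 q K)).ncard = (q - 3) / 2 := by
  have hne : ∀ ξ : K, ξ ≠ 0 → IsNonzeroSquareFq q (1 - 1 / ξ ^ 2) →
      (surfaceTilde q ξ ∪ surfaceTilde q (-ξ)).Nonempty := fun ξ hξ0 hξ =>
    (h.hasLabel_surface_of_mem_paramZ1 (by rw [h.paramZ1_eq]; exact ⟨hξ0, hξ⟩)).1
  rw [h.paramZ1_eq, h.ncard_surfacePairs (fun d hd => (h.isNonzeroSquareFq_fixed hd).1) hne]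
  have : {d : K | IsNonzeroSquareFq q d ∧ d ≠ 1} = {d : K | IsNonzeroSquareFq q d} \ {1} := by
    ext
    simp
  have h1 : (1 : K) ∈ {d : K | IsNonzeroSquareFq q d} := by
    refine h.isNonzeroSquareFq_iff.2 ⟨1, ?_⟩
    simp
  rw [this, Set.ncard_sdiff_singleton_of_mem h1, h.ncard_isNonzeroSquareFq]
  omega

theorem ncard_surfacePairs_paramZ2 (h : IsConj q σ) :
    (surfacePairs q (paramZ2 q K)).ncard = (q - 1) / 2 := by
  have hne : ∀ ξ : K, ξ ≠ 0 → IsNonsquareFq q (1 - 1 / ξ ^ 2) →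
      (surfaceTilde q ξ ∪ surfaceTilde q (-ξ)).Nonempty := fun ξ hξ0 hξ =>
    (h.hasLabel_surface_of_mem_paramZ2 ⟨hξ0, hξ⟩).1
  refine (h.ncard_surfacePairs (fun d hd => (h.isNonsquareFq_fixed hd).1) hne).trans ?_
  rw [← h.ncard_isNonsquareFq]
  congr 1
  ext d
  refine and_iff_left_of_imp fun hd => ?_
  rintro rfl
  exact (h.isNonsquareFq_iff.1 hd).2 ⟨1, by simp⟩

theorem hasLabel_sevenOrbits (h : IsConj q σ) (i : Fin 7) :
    HasLabel q σ (sevenOrbits q K i) i := by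
  fin_cases i
  exacts [h.hasLabel_subquadric, h.hasLabel_sigmaTilde, h.hasLabel_setT, h.hasLabel_quadricTilde,
    h.hasLabel_setDTilde, h.hasLabel_setH1, h.hasLabel_setH2]

theorem isOrbitLike_sevenOrbits (h : IsConj q σ) (i : Fin 7) :
    IsOrbitLike q (sevenOrbits q K i) := by
  fin_cases i
  exacts [h.isOrbitLike_subquadric, h.isOrbitLike_sigmaTilde, h.isOrbitLike_setT,
    h.isOrbitLike_quadricTilde, h.isOrbitLike_setDTilde, h.isOrbitLike_setH1, h.isOrbitLike_setH2]

/-- Every point lies in one of the sets of the list. -/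
theorem exists_mem_list (h : IsConj q σ) (P : PG3 K) :
    ∃ S ∈ Set.range (sevenOrbits q K) ∪ surfacePairs q (paramZ1 q K) ∪
      surfacePairs q (paramZ2 q K), P ∈ S := by
  have hseven : (∃ i, P ∈ sevenOrbits q K i) → ∃ S ∈ Set.range (sevenOrbits q K) ∪
      surfacePairs q (paramZ1 q K) ∪ surfacePairs q (paramZ2 q K), P ∈ S :=
    fun ⟨i, hi⟩ => ⟨_, Or.inl (Or.inl ⟨i, rfl⟩), hi⟩
  have h2 := h.two_ne_zero
  have h4 := h.four_ne_zero
  induction P using Projectivization.ind with | _ v hv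
  by_cases hS : InSigma σ v
  · by_cases hQ : formQ v = 0
    · exact hseven ⟨0, (h.mk_mem_subquadric v hv).2 ⟨hQ, hS⟩⟩
    · exact hseven ⟨1, (h.mk_mem_sigmaTilde v hv).2 ⟨hS, hQ⟩⟩
  by_cases hQ : formQ v = 0
  · by_cases hH : formH q v = 0
    · exact hseven ⟨2, (h.mk_mem_setT v hv).2 ⟨hQ, hH, hS⟩⟩
    · exact hseven ⟨3, (h.mk_mem_quadricTilde v hv).2 ⟨hQ, hH⟩⟩
  by_cases hH : formH q v = 0
  · by_cases hs : IsNonzeroSquareFq q (-4 * (formQ v * σ (formQ v)))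
    · exact hseven ⟨5, (h.mk_mem_setH1 v hv).2 ⟨hH, hQ, hs⟩⟩
    · exact hseven ⟨6, (h.mk_mem_setH2 v hv).2 ⟨hH, hQ, hs⟩⟩
  by_cases he : formH q v ^ 2 = 4 * (formQ v * σ (formQ v))
  · exact hseven ⟨4, (h.mk_mem_setDTilde v hv).2 ⟨hH, he, hS⟩⟩
  have hsQ := h.conj_ne_zero hQ
  have hN : formQ v * σ (formQ v) ≠ 0 := mul_ne_zero hQ hsQ
  have hf : σ (formH q v ^ 2 / (4 * (formQ v * σ (formQ v)))) =
      formH q v ^ 2 / (4 * (formQ v * σ (formQ v))) := by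
    rw [map_div₀, map_pow, h.conj_formH, map_mul, h.norm_fixed, map_ofNat]
  obtain ⟨ξ, hξ⟩ := h.isSquare_of_fixed hf
  have hξ0 : ξ ≠ 0 := by
    rintro rfl
    rw [mul_zero] at hξ
    exact div_ne_zero (pow_ne_zero 2 hH) (mul_ne_zero h4 hN) hξ
  have hP : Projectivization.mk K v hv ∈ surfaceTilde q ξ ∪ surfaceTilde q (-ξ) := by
    rw [h.mk_mem_surfaceTilde_union]
    refine ⟨hH, ?_⟩
    rw [sq ξ, ← hξ]
    field_simp
  have hd : σ (1 - 1 / ξ ^ 2) = 1 - 1 / ξ ^ 2 := by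
    rw [sq ξ, ← hξ, map_sub, map_div₀, hf, map_one]
  have hd0 : 1 - 1 / ξ ^ 2 ≠ 0 := by
    intro h0
    apply he
    rw [sq ξ, ← hξ] at h0
    field_simp at h0
    linear_combination h0
  by_cases hs : IsNonzeroSquareFq q (1 - 1 / ξ ^ 2)
  · exact ⟨_, Or.inl (Or.inr ⟨ξ, by rw [h.paramZ1_eq]; exact ⟨hξ0, hs⟩, rfl⟩), hP⟩
  · exact ⟨_, Or.inr ⟨ξ, ⟨hξ0, (h.isNonsquareFq_iff_not hd hd0).2 hs⟩, rfl⟩, hP⟩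

theorem sq_ne_one_of_sub_ne_zero {ξ : K} (hξ : 1 - 1 / ξ ^ 2 ≠ 0) : ξ ^ 2 ≠ 1 := by
  intro h0
  rw [h0] at hξ
  simp at hξ

/-- The sets of the list are nonempty and are orbits. -/
theorem isOrbitLike_of_mem_list (h : IsConj q σ) {S : Set (PG3 K)}
    (hS : S ∈ Set.range (sevenOrbits q K) ∪ surfacePairs q (paramZ1 q K) ∪
      surfacePairs q (paramZ2 q K)) : S.Nonempty ∧ IsOrbitLike q S := by
  rcases hS with (⟨i, rfl⟩ | ⟨ξ, hξ, rfl⟩) | ⟨ξ, hξ, rfl⟩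
  · exact ⟨(h.hasLabel_sevenOrbits i).1, h.isOrbitLike_sevenOrbits i⟩
  · exact ⟨(h.hasLabel_surface_of_mem_paramZ1 hξ).1, h.isOrbitLike_surfaceTilde_union
      (sq_ne_one_of_sub_ne_zero (h.isNonzeroSquareFq_fixed hξ.2.2.2).2)⟩
  · exact ⟨(h.hasLabel_surface_of_mem_paramZ2 hξ).1, h.isOrbitLike_surfaceTilde_union
      (sq_ne_one_of_sub_ne_zero (h.isNonsquareFq_fixed hξ.2).2)⟩

theorem pointOrbits_eq (h : IsConj q σ) : pointOrbits q K =
    Set.range (sevenOrbits q K) ∪ surfacePairs q (paramZ1 q K) ∪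
      surfacePairs q (paramZ2 q K) := by
  ext S
  constructor
  · rintro ⟨P, rfl⟩
    obtain ⟨S, hS, hP⟩ := h.exists_mem_list P
    rw [(h.isOrbitLike_of_mem_list hS).2 P hP]
    exact hS
  · intro hS
    obtain ⟨⟨P, hP⟩, hO⟩ := h.isOrbitLike_of_mem_list hS
    exact ⟨P, (hO P hP).symm⟩

theorem ncard_pointOrbits (h : IsConj q σ) :
    (pointOrbits q K).ncard = 7 + (q - 3) / 2 + (q - 1) / 2 := by
  have hinj : Function.Injective (sevenOrbits q K) := by
    intro i j hij
    have hi := h.hasLabel_sevenOrbits i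
    rw [hij] at hi
    exact Fin.ext (hi.eq (h.hasLabel_sevenOrbits j))
  have hseven : (Set.range (sevenOrbits q K)).ncard = 7 := by
    rw [← Set.image_univ, Set.ncard_image_of_injective _ hinj, Set.ncard_univ, Nat.card_fin]
  have h1 : Disjoint (Set.range (sevenOrbits q K)) (surfacePairs q (paramZ1 q K)) := by
    rw [Set.disjoint_left]
    rintro _ ⟨i, rfl⟩ ⟨ξ, hξ, hi⟩
    have h7 := h.hasLabel_surface_of_mem_paramZ1 hξ
    rw [← hi] at h7
    have := (h.hasLabel_sevenOrbits i).eq h7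
    omega
  have h2 : Disjoint (Set.range (sevenOrbits q K) ∪ surfacePairs q (paramZ1 q K))
      (surfacePairs q (paramZ2 q K)) := by
    rw [Set.disjoint_left]
    rintro _ (⟨i, rfl⟩ | ⟨ξ', hξ', rfl⟩) ⟨ξ, hξ, hi⟩
    · have h8 := h.hasLabel_surface_of_mem_paramZ2 hξ
      rw [← hi] at h8
      have := (h.hasLabel_sevenOrbits i).eq h8
      omega
    · have h8 := h.hasLabel_surface_of_mem_paramZ2 hξ
      rw [← hi] at h8
      have := (h.hasLabel_surface_of_mem_paramZ1 hξ').eq h8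
      omega
  rw [h.pointOrbits_eq, Set.ncard_union_eq h2, Set.ncard_union_eq h1, hseven,
    h.ncard_surfacePairs_paramZ1, h.ncard_surfacePairs_paramZ2]

end IsConj
end
end PointOrbits

theorem mainTheorem4 (q : ℕ) (hq : Odd q) (K : Type*) [Field K] [Finite K]
    (hK : Nat.card K = q ^ 2) :
    -- the list of orbits is complete and contains nothing but orbits
    PointOrbits.pointOrbits q K =
      {PointOrbits.subquadric q K, PointOrbits.sigmaTilde q K, PointOrbits.setT q K,
        PointOrbits.quadricTilde q K, PointOrbits.setDTilde q K,
        PointOrbits.setH1 q K, PointOrbits.setH2 q K} ∪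
      PointOrbits.surfacePairs q (PointOrbits.paramZ1 q K) ∪
      PointOrbits.surfacePairs q (PointOrbits.paramZ2 q K) ∧
    -- the sizes of the orbits
    (PointOrbits.subquadric q K).ncard = (q + 1) ^ 2 ∧
    (PointOrbits.sigmaTilde q K).ncard = q ^ 3 - q ∧
    (PointOrbits.setT q K).ncard = 2 * (q + 1) * (q ^ 2 - q) ∧
    (PointOrbits.quadricTilde q K).ncard = q ^ 4 - 2 * q ^ 3 + q ^ 2 ∧
    (PointOrbits.setDTilde q K).ncard = q * (q ^ 2 - 1) ^ 2 ∧
    (PointOrbits.setH1 q K).ncard = (q + 1) * (q - 1) ^ 2 * q ^ 2 / 2 ∧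
    (PointOrbits.setH2 q K).ncard = (q - 1) * q ^ 2 * (q + 1) ^ 2 / 2 ∧
    (∀ ξ ∈ PointOrbits.paramZ1 q K,
      (PointOrbits.surfaceTilde q ξ ∪ PointOrbits.surfaceTilde q (-ξ)).ncard =
        (q + 1) * (q - 1) ^ 2 * q ^ 2) ∧
    (∀ ξ ∈ PointOrbits.paramZ2 q K,
      (PointOrbits.surfaceTilde q ξ ∪ PointOrbits.surfaceTilde q (-ξ)).ncard =
        (q - 1) * q ^ 2 * (q + 1) ^ 2) ∧
    -- the numbers of orbits in the two families, and no repetitions in the whole list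
    (PointOrbits.surfacePairs q (PointOrbits.paramZ1 q K)).ncard = (q - 3) / 2 ∧
    (PointOrbits.surfacePairs q (PointOrbits.paramZ2 q K)).ncard = (q - 1) / 2 ∧
    (PointOrbits.pointOrbits q K).ncard = 7 + (q - 3) / 2 + (q - 1) / 2 := by
  obtain ⟨σ, h⟩ := PointOrbits.exists_isConj hq hK
  refine ⟨?_, h.ncard_subquadric, h.ncard_sigmaTilde, h.ncard_setT, h.ncard_quadricTilde,
    h.ncard_setDTilde, h.ncard_setH1, h.ncard_setH2,
    fun ξ hξ => h.ncard_surface_of_isNonzeroSquareFq hξ.1 hξ.2.2.2,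
    fun ξ hξ => h.ncard_surface_of_isNonsquareFq hξ.1 hξ.2,
    h.ncard_surfacePairs_paramZ1, h.ncard_surfacePairs_paramZ2, h.ncard_pointOrbits⟩
  rw [h.pointOrbits_eq, PointOrbits.range_sevenOrbits]
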